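/- **Setting.** Let $p_{\max}\ge 2$ be an integer and let $\gamma_2,\dots,\gamma_{p_{\max}}\ge 0$ be real numbers. Let $\varrho$ be the uniform probability measure on either the hypercube $\{\pm1\}^n$ or the sphere $\{\sigma\in\mathbb R^n:\|\sigma\|_2^2=n\}$. Let $\bm G=(\bm G_{i_1,\dots,i_p})$, for $2\le p\le p_{\max}$ and $i_1,\dots,i_p\in[n]$, be independent standard Gaussians. For $\beta\in\mathbb C$ put $$\mathcal H_{\bm G}(\sigma)=\sum_{p=2}^{p_{\max}}\frac{\gamma_p}{n^{(p-1)/2}}\sum_{i_1,\dots,i_p=1}^n \bm G_{i_1,\dots,i_p}\,\sigma_{i_1}\cdots\sigma_{i_p},\qquad Z_{\bm G}(\beta)=\mathbb E_{\sigma\sim\varrho}\big[e^{\beta\mathcal H_{\bm G}(\sigma)}\big].$$ Let $\xi(s)=\sum_{p=2}^{p_{\max}}\gamma_p^2s^p$. On $[-1,1]$ let $h(m)=-\frac12\big((1-m)\log(1-m)+(1+m)\log(1+m)\big)$ for the hypercube, and $h(m)=\frac12\log(1-m^2)$ for the sphere (so $h(\pm1)=-\infty$ there). Let $\beta_{\mathsf{2nd}}\in[0,\infty]$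 be the supremum of all $\beta\ge0$ such that $\varphi(m)=\beta^2\xi(m)+h(m)$ has $0$ as its unique global maximizer on $[-1,1]$ and $\varphi''(0)<0$. Write $\mathbb D(0,r)$ for the open disk of radius $r$ around $0$ in $\mathbb C$. For $C>0$ and $0<\eta<1$ let $m=\lceil C\log(n/\eta)\rceil$, and let $\widehat P$ be the Taylor polynomial at $0$ of degree $m$ of $\beta\mapsto\log Z_{\bm G}(\beta)$. For complex $z,\hat z$, say that $\hat z$ is an $e^{\pm\eta}$-approximation of $z$ if $z=e^{w}\hat z$ for some $w\in\mathbb C$ with $|w|\le\eta$ (for positive reals: $e^{-\eta}\hat z\le z\le e^{\eta}\hat z$). **Theorem 1.3 (Algorithms; the case $\gamma_2=0$).** There is a universal constant $c>0$ such that the following holds. 1. Assume $\gamma_2=0$, and let $0<\varepsilon<1$. There are $\delta(n)=\delta(\varepsilon,n)>0$ (depending also on $\varrho$ and on the $\gamma_p$) with $\delta(n)\to0$ as $n\to\infty$, such that for all $0<\eta<1$, all $C\ge c/\varepsilon$ (in particular $C=c/\varepsilon=\Theta(1/\varepsilon)$) and all $n\ge1$: with probability at least $1-\delta(n)$ over $\bm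 G$, simultaneously for all $\beta\in\mathbb D(0,(1-\varepsilon)\beta_{\mathsf{2nd}})$, $\exp(\widehat P(\beta))$ is an $e^{\pm\eta}$-approximation of $Z_{\bm G}(\beta)$. 2. For each of the two choices of $\varrho$ there is one deterministic program and, for every $p_{\max}$, a constant $K\ge1$ depending only on $p_{\max}$ (and on the choice of $\varrho$), such that for all $n\ge2$, all $0<\eta<1$, all $C\ge c$, all real $\gamma_2,\dots,\gamma_{p_{\max}}$, all real couplings $\bm G$ and all $\beta\in\mathbb C$, the program on input $n,p_{\max},\beta,C,\eta,\{\gamma_p\},\bm G$ outputs the degree $m$, all coefficients of $\widehat P$, and the number $\exp(\widehat P(\beta))$, in at most $n^{K\,C\log(n/\eta)}$ steps. Here programs run on a random access machine with an integer memory and a memory of complex numbers, both with indirect addressing. One step is one of: addition or truncated subtraction of integers, comparison of two integers, $+,-,\times,\div,\exp,\log$ on numbers, comparison of the real parts of two numbers, loading an integer constant, converting an integer to a number, or one memory or input access. In particular, if $\gamma_2=0$, then for $C=\Theta(1/\varepsilon)$ there is a deterministic algorithm with running time $n^{O_{p_{\max}}(C\log(n/\eta))}$ whose output is, with probability $1-o_n(1)$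 over $\bm G$, an $e^{\pm\eta}$-approximation of $Z_{\bm G}(\beta)$ for all $\beta\in\mathbb D(0,(1-\varepsilon)\beta_{\mathsf{2nd}})$. -/

import Mathlib

open scoped ENNReal Topology

noncomputable section

namespace SpinGlass

/-! ### The mixed p-spin model -/

/-- The two admissible background measures. -/
inductive Background where
  | hypercube
  | sphere

/-- `Background.measure b n` is the probability measure `ϱ` on `ℝⁿ`: the uniform measure on `{±1}ⁿ`,
or the (normalised, rotation invariant) surface measure on the sphere of radius `√n` around `0`. -/
def Background.measure (b : Background) (n : ℕ) : MeasureTheory.Measure (Fin n → ℝ) :=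
  match b with
  | .hypercube => ProbabilityTheory.uniformOn {σ : Fin n → ℝ | ∀ i, σ i = 1 ∨ σ i = -1}
  | .sphere =>
      (ProbabilityTheory.cond
        (MeasureTheory.volume : MeasureTheory.Measure (EuclideanSpace ℝ (Fin n))).toSphere
        Set.univ).map
        (fun (x : Metric.sphere (0 : EuclideanSpace ℝ (Fin n)) 1) (i : Fin n) =>
          √(n : ℝ) * (x : EuclideanSpace ℝ (Fin n)) i)

/-- Positions `(p; i₁, …, i_p)` of the couplings, with `2 ≤ p ≤ pmax`. -/
abbrev CouplingIndex (pmax n : ℕ) : Type :=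
  (p : Finset.Icc 2 pmax) × (Fin (p : ℕ) → Fin n)

/-- A realisation of all the couplings `G_{i₁, …, i_p}`. -/
abbrev Couplings (pmax n : ℕ) : Type := CouplingIndex pmax n → ℝ

/-- The law of the couplings: independent standard Gaussians. -/
def couplingLaw (pmax n : ℕ) : MeasureTheory.Measure (Couplings pmax n) :=
  MeasureTheory.Measure.pi fun _ => ProbabilityTheory.gaussianReal 0 1

/-- The Hamiltonian `H_G(σ)`. -/
def hamiltonian {pmax n : ℕ} (γ : ℕ → ℝ) (G : Couplings pmax n) (σ : Fin n → ℝ) : ℝ :=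
  ∑ p : Finset.Icc 2 pmax,
    γ p / (n : ℝ) ^ ((((p : ℕ) : ℝ) - 1) / 2) *
      ∑ i : Fin (p : ℕ) → Fin n, G ⟨p, i⟩ * ∏ j, σ (i j)

/-- The partition function `Z_G(β) = E_{σ ∼ ϱ} exp (β H_G(σ))`, at complex `β`. -/
def partitionFunction (b : Background) {pmax n : ℕ} (γ : ℕ → ℝ) (G : Couplings pmax n)
    (β : ℂ) : ℂ :=
  ∫ σ, Complex.exp (β * (hamiltonian γ G σ : ℂ)) ∂(b.measure n)

/-! ### The second moment threshold -/

/-- The mixture function `ξ(s) = ∑ γ_p² s^p`. -/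
def mixture (pmax : ℕ) (γ : ℕ → ℝ) (s : ℝ) : ℝ :=
  ∑ p ∈ Finset.Icc 2 pmax, γ p ^ 2 * s ^ p

/-- The entropy functional `h` on `[-1, 1]`; on the sphere it is `-∞` at the endpoints. -/
def entropy (b : Background) (m : ℝ) : EReal :=
  match b with
  | .hypercube =>
      ((-(1 / 2) * ((1 - m) * Real.log (1 - m) + (1 + m) * Real.log (1 + m)) : ℝ) : EReal)
  | .sphere => if |m| < 1 then ((1 / 2 * Real.log (1 - m ^ 2) : ℝ) : EReal) else ⊥

/-- `φ(m) = β² ξ(m) + h(m)`. -/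
def phi (b : Background) (pmax : ℕ) (γ : ℕ → ℝ) (β m : ℝ) : EReal :=
  ((β ^ 2 * mixture pmax γ m : ℝ) : EReal) + entropy b m

/-- `0` is the unique global maximiser of `φ` on `[-1, 1]`, and `φ''(0) < 0`
(`φ` is real-valued and smooth on `(-1, 1)`, so that the second derivative is a genuine one). -/
def SecondMomentCondition (b : Background) (pmax : ℕ) (γ : ℕ → ℝ) (β : ℝ) : Prop :=
  (∀ m ∈ Set.Icc (-1 : ℝ) 1, m ≠ 0 → phi b pmax γ β m < phi b pmax γ β 0) ∧
    iteratedDeriv 2 (fun m => (phi b pmax γ β m).toReal) 0 < 0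

/-- The second moment threshold, with values in `[0, ∞]`
(it is infinite exactly when all the `γ_p` vanish). -/
def secondMomentThreshold (b : Background) (pmax : ℕ) (γ : ℕ → ℝ) : ℝ≥0∞ :=
  sSup (ENNReal.ofReal '' {β : ℝ | 0 ≤ β ∧ SecondMomentCondition b pmax γ β})

/-! ### Taylor polynomials of `log Z_G` and multiplicative approximation -/

/-- The `k`-th Taylor coefficient at `0` of `β ↦ log Z_G(β)`, with the principal branch of the
logarithm (`Z_G` is entire and `Z_G(0) = 1`, so that this function is analytic near `0`). -/
def logTaylorCoeff (b : Background) {pmax n : ℕ} (γ : ℕ → ℝ) (G : Couplings pmax n) (k : ℕ) : ℂ :=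
  iteratedDeriv k (fun z => Complex.log (partitionFunction b γ G z)) 0 / (k.factorial : ℂ)

/-- The degree-`d` Taylor polynomial at `0` of `β ↦ log Z_G(β)`. -/
def logTaylorPoly (b : Background) {pmax n : ℕ} (γ : ℕ → ℝ) (G : Couplings pmax n) (d : ℕ)
    (β : ℂ) : ℂ :=
  ∑ k ∈ Finset.range (d + 1), logTaylorCoeff b γ G k * β ^ k

/-- The truncation degree `C log (n / η)`, rounded up. -/
def truncationDegree (C η : ℝ) (n : ℕ) : ℕ := ⌈C * Real.log (n / η)⌉₊

/-- `z` equals `zhat` up to a factor `e^{±η}`. For complex numbers this means `z = e^w zhat` with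
`|w| ≤ η`. For positive reals and `η < 1` it is equivalent to `e^{-η} zhat ≤ z ≤ e^η zhat`. -/
def MultApprox (η : ℝ) (zhat z : ℂ) : Prop :=
  ∃ w : ℂ, ‖w‖ ≤ η ∧ z = Complex.exp w * zhat

/-! ### A random access machine over the complex numbers

Programs are structured (sequence, branch, loop). The machine has an integer memory (used for
counters and addresses) and a number memory, both with indirect addressing, and a read-only input
tape of numbers. Every elementary operation and every test costs one step. On integers only addition
and truncated subtraction are elementary. On numbers these are the field operations, `exp` and `log`
(with the conventions `x / 0 = 0` and `log 0 = 0`); numbers are compared through their real parts.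
The only constants of a program are natural numbers, and there is no rounding of numbers to
integers. -/

/-- The content of the machine: integer memory and number memory. -/
structure State where
  int : ℕ → ℕ
  num : ℕ → ℂ

/-- The elementary operations; the arguments are addresses, except for the last argument of
`intConst`. Write `N[·]` for the integer memory, `X[·]` for the number memory and `T[·]` for the
input tape. -/
inductive Op where
  /-- `N[r] := k` -/
  | intConst (r k : ℕ)
  /-- `N[r] := N[a] + N[b]` -/
  | intAdd (r a b : ℕ)
  /-- `N[r] := N[a] - N[b]`, truncated at `0` -/
  | intSub (r a b : ℕ)
  /-- `N[r] := N[N[a]]` -/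
  | intLoad (r a : ℕ)
  /-- `N[N[r]] := N[a]` -/
  | intStore (r a : ℕ)
  /-- `X[r] := N[a]` -/
  | ofInt (r a : ℕ)
  /-- `X[r] := T[N[a]]` -/
  | read (r a : ℕ)
  /-- `X[r] := X[N[a]]` -/
  | load (r a : ℕ)
  /-- `X[N[r]] := X[a]` -/
  | store (r a : ℕ)
  /-- `X[r] := X[a] + X[b]` -/
  | add (r a b : ℕ)
  /-- `X[r] := X[a] - X[b]` -/
  | sub (r a b : ℕ)
  /-- `X[r] := X[a] * X[b]` -/
  | mul (r a b : ℕ)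
  /-- `X[r] := X[a] / X[b]` -/
  | div (r a b : ℕ)
  /-- `X[r] := exp X[a]` -/
  | exp (r a : ℕ)
  /-- `X[r] := log X[a]` -/
  | log (r a : ℕ)

/-- Overwrite an integer cell. -/
def State.setInt (s : State) (r k : ℕ) : State := { s with int := Function.update s.int r k }

/-- Overwrite a number cell. -/
def State.setNum (s : State) (r : ℕ) (x : ℂ) : State := { s with num := Function.update s.num r x }

/-- The effect of an elementary operation. -/
def Op.apply (T : ℕ → ℂ) (s : State) : Op → State
  | .intConst r k => s.setInt r k
  | .intAdd r a b => s.setInt r (s.int a + s.int b)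
  | .intSub r a b => s.setInt r (s.int a - s.int b)
  | .intLoad r a => s.setInt r (s.int (s.int a))
  | .intStore r a => s.setInt (s.int r) (s.int a)
  | .ofInt r a => s.setNum r (s.int a)
  | .read r a => s.setNum r (T (s.int a))
  | .load r a => s.setNum r (s.num (s.int a))
  | .store r a => s.setNum (s.int r) (s.num a)
  | .add r a b => s.setNum r (s.num a + s.num b)
  | .sub r a b => s.setNum r (s.num a - s.num b)
  | .mul r a b => s.setNum r (s.num a * s.num b)
  | .div r a b => s.setNum r (s.num a / s.num b)
  | .exp r a => s.setNum r (Complex.exp (s.num a))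
  | .log r a => s.setNum r (Complex.log (s.num a))

/-- The tests. -/
inductive Test where
  /-- `N[a] ≤ N[b]` -/
  | intLe (a b : ℕ)
  /-- `Re X[a] ≤ Re X[b]` -/
  | numLe (a b : ℕ)

/-- When a test succeeds. -/
def Test.Holds (s : State) : Test → Prop
  | .intLe a b => s.int a ≤ s.int b
  | .numLe a b => (s.num a).re ≤ (s.num b).re

/-- Programs. -/
inductive Program where
  | op (o : Op)
  | seq (P Q : Program)
  | branch (c : Test) (P Q : Program)
  | loop (c : Test) (P : Program)

/-- `Exec T P s s₁ t`: on input tape `T`, the program `P` started in `s` halts in `s₁` after exactly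
`t` steps. -/
inductive Exec (T : ℕ → ℂ) : Program → State → State → ℕ → Prop where
  | op (o : Op) (s : State) : Exec T (.op o) s (o.apply T s) 1
  | seq {P Q : Program} {s s₁ s₂ : State} {t₁ t₂ : ℕ} :
      Exec T P s s₁ t₁ → Exec T Q s₁ s₂ t₂ → Exec T (.seq P Q) s s₂ (t₁ + t₂)
  | branchTrue {c : Test} {P Q : Program} {s s₁ : State} {t : ℕ} :
      c.Holds s → Exec T P s s₁ t → Exec T (.branch c P Q) s s₁ (1 + t)
  | branchFalse {c : Test} {P Q : Program} {s s₁ : State} {t : ℕ} :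
      ¬ c.Holds s → Exec T Q s s₁ t → Exec T (.branch c P Q) s s₁ (1 + t)
  | loopDone {c : Test} {P : Program} {s : State} :
      ¬ c.Holds s → Exec T (.loop c P) s s 1
  | loopStep {c : Test} {P : Program} {s s₁ s₂ : State} {t₁ t₂ : ℕ} :
      c.Holds s → Exec T P s s₁ t₁ → Exec T (.loop c P) s₁ s₂ t₂ →
      Exec T (.loop c P) s s₂ (1 + t₁ + t₂)

/-- The machine is deterministic: the final state and the number of steps are determined by the
program, the input tape and the initial state. -/
theorem Exec.deterministic {T : ℕ → ℂ} {P : Program} {s s₁ s₂ : State} {t₁ t₂ : ℕ}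
    (h₁ : Exec T P s s₁ t₁) (h₂ : Exec T P s s₂ t₂) : s₁ = s₂ ∧ t₁ = t₂ := by
  induction h₁ generalizing s₂ t₂ with
  | op o s => cases h₂; exact ⟨rfl, rfl⟩
  | seq _ _ ih₁ ih₂ =>
    cases h₂ with
    | seq k₁ k₂ =>
      obtain ⟨rfl, rfl⟩ := ih₁ k₁
      obtain ⟨rfl, rfl⟩ := ih₂ k₂
      exact ⟨rfl, rfl⟩
  | branchTrue hc _ ih =>
    cases h₂ with
    | branchTrue _ k => obtain ⟨rfl, rfl⟩ := ih k; exact ⟨rfl, rfl⟩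
    | branchFalse hn _ => exact absurd hc hn
  | branchFalse hc _ ih =>
    cases h₂ with
    | branchTrue hn _ => exact absurd hn hc
    | branchFalse _ k => obtain ⟨rfl, rfl⟩ := ih k; exact ⟨rfl, rfl⟩
  | loopDone hc =>
    cases h₂ with
    | loopDone _ => exact ⟨rfl, rfl⟩
    | loopStep hn _ _ => exact absurd hn hc
  | loopStep hc _ _ ih₁ ih₂ =>
    cases h₂ with
    | loopDone hn => exact absurd hc hn
    | loopStep _ k₁ k₂ =>
      obtain ⟨rfl, rfl⟩ := ih₁ k₁
      obtain ⟨rfl, rfl⟩ := ih₂ k₂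
      exact ⟨rfl, rfl⟩

/-- The numbers on the input tape: `β`, `C`, `η`, then `γ_2, …, γ_pmax`, then for `p = 2, …, pmax`
the `n^p` couplings of order `p`, where `(i₁, …, i_p)` has rank `∑ i_j n^(j-1)`
(indices counted from `0`). -/
def inputList {pmax n : ℕ} (γ : ℕ → ℝ) (G : Couplings pmax n) (C η : ℝ) (β : ℂ) : List ℂ :=
  [β, (C : ℂ), (η : ℂ)] ++ (List.range' 2 (pmax - 1)).map (fun p => (γ p : ℂ)) ++
    (List.range' 2 (pmax - 1)).attach.flatMap (fun p : {p : ℕ // p ∈ List.range' 2 (pmax - 1)} =>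
      List.ofFn fun r : Fin (n ^ p.1) =>
        ((G ⟨⟨p.1, by
          have hp := p.2
          rw [List.mem_range'_1] at hp
          exact Finset.mem_Icc.2 ⟨hp.1, by omega⟩⟩, finFunctionFinEquiv.symm r⟩ : ℝ) : ℂ))

/-- The input tape; behind the input it is blank. -/
def inputTape {pmax n : ℕ} (γ : ℕ → ℝ) (G : Couplings pmax n) (C η : ℝ) (β : ℂ) (k : ℕ) : ℂ :=
  (inputList γ G C η β).getD k 0

/-- The initial state: `N[0] = n`, `N[1] = pmax`, and all other cells are `0`. -/
def initialState (pmax n : ℕ) : State where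
  int := fun k => if k = 0 then n else if k = 1 then pmax else 0
  num := fun _ => 0

end SpinGlass

end

open SpinGlass

namespace SpinGlass

/-! ### Straight-line code and counted loops -/

/-! Accuracy. The normalised function W(β) = Z(β) exp(-β² n ξ(1)/2) has mean 1. Gaussian integration
over two replicas gives E|W(β) - 1|² = E exp(n |β|² ξ(R)) - 1, where R is the overlap
(`integral_norm_sq_normPartition_sub_one`). Only |β| enters, so complex β cost no more than real
ones. Large overlaps are rare, P(|R| ≥ x) ≤ 2n exp((n-1) h(x)) (`measure_overlap_le`), and strictly
below the threshold |β|² ξ ≤ -θ h with some θ < 1, so overlaps above the scale n^(-2/5) contribute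
little. Below that scale n ξ(R) = O(n |R|³) is small, because γ_2 = 0
(`integral_exp_overlap_sub_one_le`). Hence W tends to 1 in mean square, uniformly on a circle, and
Cauchy's formula with Markov's inequality turns this into a uniform bound on a smaller disk with
high probability (`measure_exists_lt_norm_normPartition_sub_one_le`). There log W is holomorphic and
bounded, so its Taylor polynomials converge geometrically. The Taylor series of log Z differs from
that of log W by a quadratic monomial, which truncation at degree at least 2 keeps intact
(`multApprox_of_norm_normPartition_sub_one_le`). Degree C log(n/η) with C ≥ 4/ε brings the error
below η.

Algorithm. The Taylor coefficients of Z are the moments of H over k!. With q the maximal order, H^k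
expands into ((q+1) n^q)^k coded monomials, whose moments are explicit
(`integral_background_prod_pow`): products of Rademacher moments on the cube, products of Gaussian
moments with a radial correction on the sphere. The identity f' = (log f)' f then yields the
coefficients of log Z recursively. All these are nested sums and products over ranges bounded by B =
n^((m+1)(q+1)²), m being the truncation degree. `NatComp` and `NumComp` are classes of functions
computable in time polynomial in B, closed under arithmetic and bounded sums and products;
membership of the formulas yields the program. B sits in integer register 2, loops of this calculus
make B + 1 rounds, and quantities that control them are clipped at B + 1; `LargeBound` ensures that
clipping changes nothing. A power of B + 2 is at most n^(K C log(n/η)). -/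

/-- A nonempty sequence of elementary operations. -/
def straight : Op → List Op → Program
  | o, [] => .op o
  | o, o' :: os => .seq (.op o) (straight o' os)

theorem exec_straight (T : ℕ → ℂ) (o : Op) (os : List Op) (s : State) :
    Exec T (straight o os) s ((o :: os).foldl (fun s o => o.apply T s) s) (os.length + 1) := by
  induction os generalizing o s with
  | nil => exact Exec.op o s
  | cons o' os ih =>
    have h := Exec.seq (Exec.op o s) (ih o' (o.apply T s))
    rw [add_comm] at h
    simpa [straight] using h

/-- A loop whose counter `i` runs from `0` to the content `N` of the register `b`. -/
theorem exec_loop_of_invariant {T : ℕ → ℂ} {i b N C : ℕ} {P : Program} (I : ℕ → State → Prop)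
    (hI : ∀ j s, I j s → s.int i = j ∧ s.int b = N)
    (hP : ∀ j ≤ N, ∀ s, I j s → ∃ s' t, Exec T P s s' t ∧ t ≤ C ∧ I (j + 1) s')
    {s : State} (hs : I 0 s) :
    ∃ s' t, Exec T (.loop (.intLe i b) P) s s' t ∧ t ≤ (N + 1) * (C + 1) + 1 ∧ I (N + 1) s' := by
  -- Induction on the number `d` of remaining rounds. The test is `i ≤ N`, so the counter values 0,
  -- …, N all enter the body, which makes `N + 1` rounds.
  suffices H : ∀ d j s, j + d = N + 1 → I j s → ∃ s' t,
      Exec T (.loop (.intLe i b) P) s s' t ∧ t ≤ d * (C + 1) + 1 ∧ I (N + 1) s' from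
    H (N + 1) 0 s (by omega) hs
  intro d
  induction d with
  | zero =>
    intro j s hj hs
    obtain ⟨h₁, h₂⟩ := hI j s hs
    have hj' : j = N + 1 := by omega
    refine ⟨s, 1, .loopDone ?_, by omega, hj' ▸ hs⟩
    simp only [Test.Holds]; omega
  | succ d ih =>
    intro j s hj hs
    obtain ⟨h₁, h₂⟩ := hI j s hs
    obtain ⟨s₁, t₁, e₁, ht₁, hs₁⟩ := hP j (by omega) s hs
    obtain ⟨s₂, t₂, e₂, ht₂, hs₂⟩ := ih (j + 1) s₁ (by omega) hs₁
    refine ⟨s₂, 1 + t₁ + t₂, .loopStep ?_ e₁ e₂, ?_, hs₂⟩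
    · simp only [Test.Holds]; omega
    · rw [add_mul]; omega

/-! ### Frames -/

/-- `s'` agrees with `s` on the integer cells below `l`, on the even number cells below `2 * l` and
on all odd number cells. -/
def Agree (l : ℕ) (s s' : State) : Prop :=
  (∀ i < l, s'.int i = s.int i) ∧ (∀ i < l, s'.num (2 * i) = s.num (2 * i)) ∧
    ∀ i, s'.num (2 * i + 1) = s.num (2 * i + 1)

theorem Agree.refl (l : ℕ) (s : State) : Agree l s s :=
  ⟨fun _ _ => rfl, fun _ _ => rfl, fun _ => rfl⟩

theorem Agree.trans {l : ℕ} {s s' s'' : State} (h : Agree l s s') (h' : Agree l s' s'') :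
    Agree l s s'' :=
  ⟨fun i hi => (h'.1 i hi).trans (h.1 i hi), fun i hi => (h'.2.1 i hi).trans (h.2.1 i hi),
    fun i => (h'.2.2 i).trans (h.2.2 i)⟩

theorem Agree.mono {l l' : ℕ} {s s' : State} (h : Agree l s s') (hl : l' ≤ l) : Agree l' s s' :=
  ⟨fun i hi => h.1 i (hi.trans_le hl), fun i hi => h.2.1 i (hi.trans_le hl), h.2.2⟩

theorem Agree.setInt {l r : ℕ} {s s' : State} (h : Agree l s s') (hr : l ≤ r) (x : ℕ) :
    Agree l s (s'.setInt r x) :=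
  ⟨fun i hi => by
    rw [← h.1 i hi]; simp only [State.setInt]; rw [Function.update_of_ne (by omega)], h.2⟩

theorem Agree.setNum {l r : ℕ} {s s' : State} (h : Agree l s s') (hr : l ≤ r) (x : ℂ) :
    Agree l s (s'.setNum (2 * r) x) :=
  ⟨h.1, fun i hi => by
    rw [← h.2.1 i hi]; simp only [State.setNum]; rw [Function.update_of_ne (by omega)], fun i => by
    rw [← h.2.2 i]; simp only [State.setNum]; rw [Function.update_of_ne (by omega)]⟩

@[simp] theorem State.setInt_int_self (s : State) (r x : ℕ) : (s.setInt r x).int r = x := by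
  simp [State.setInt]

theorem State.setInt_int_of_ne (s : State) {r i : ℕ} (x : ℕ) (h : i ≠ r) :
    (s.setInt r x).int i = s.int i := by
  simp [State.setInt, h]

@[simp] theorem State.setNum_int (s : State) (r : ℕ) (x : ℂ) : (s.setNum r x).int = s.int := rfl

@[simp] theorem State.setInt_num (s : State) (r x : ℕ) : (s.setInt r x).num = s.num := rfl

@[simp] theorem State.setNum_num_self (s : State) (r : ℕ) (x : ℂ) : (s.setNum r x).num r = x := by
  simp [State.setNum]

/-- `f` only depends on the part of the state that `Agree k` preserves. -/
def Stable {α : Type*} (k : ℕ) (f : (ℕ → ℂ) → State → α) : Prop :=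
  ∀ T s s', Agree k s s' → f T s' = f T s

theorem Stable.mono {α : Type*} {k k' : ℕ} {f : (ℕ → ℂ) → State → α} (h : Stable k f)
    (hk : k ≤ k') : Stable k' f :=
  fun T s s' hs => h T s s' (hs.mono hk)

/-! ### Functions computable in time polynomial in the content of register `2` -/

/-- There is a program that brings about `R`, keeps the frame below `l`, and runs in time polynomial
in the content of integer register `2`. -/
def Runs (l : ℕ) (R : (ℕ → ℂ) → State → State → Prop) : Prop :=
  ∃ (P : Program) (c : ℕ), ∀ T s, ∃ s' t,
    Exec T P s s' t ∧ t ≤ (s.int 2 + 2) ^ c ∧ Agree l s s' ∧ R T s s'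

/-- `f` is an integer function of the state below level `k`, computable at each level `l ≥ k`, with
the result in integer register `l`. -/
def NatComp (k : ℕ) (f : (ℕ → ℂ) → State → ℕ) : Prop :=
  3 ≤ k ∧ Stable k f ∧ ∀ l ≥ k, Runs l fun T s s' => s'.int l = f T s

/-- `f` is a complex function of the state below level `k`, computable at each level `l ≥ k`, with
the result in number register `2 * l`. -/
def NumComp (k : ℕ) (f : (ℕ → ℂ) → State → ℂ) : Prop :=
  3 ≤ k ∧ Stable k f ∧ ∀ l ≥ k, Runs l fun T s s' => s'.num (2 * l) = f T s

theorem NatComp.mono {k k' : ℕ} {f : (ℕ → ℂ) → State → ℕ} (h : NatComp k f) (hk : k ≤ k') :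
    NatComp k' f :=
  ⟨h.1.trans hk, h.2.1.mono hk, fun l hl => h.2.2 l (hk.trans hl)⟩

/-- Keeps all running times in the single form `y ^ c`, with `y` two more than register `2`: a sum
of two such bounds is absorbed by a larger exponent. -/
theorem pow_add_pow_le_pow {y : ℕ} (hy : 2 ≤ y) (a b : ℕ) : y ^ a + y ^ b ≤ y ^ (a + b + 1) := by
  have ha : 1 ≤ y ^ a := Nat.one_le_pow _ _ (by omega)
  have hb : 1 ≤ y ^ b := Nat.one_le_pow _ _ (by omega)
  rw [pow_succ, pow_add]
  nlinarith [Nat.mul_le_mul ha hb]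

theorem le_two_pow_self (m : ℕ) {y : ℕ} (hy : 2 ≤ y) : m ≤ y ^ m :=
  (Nat.lt_two_pow_self).le.trans (Nat.pow_le_pow_left hy m)

theorem Runs.straight {l : ℕ} {R : (ℕ → ℂ) → State → State → Prop} (o : Op) (os : List Op)
    (h : ∀ T s, Agree l s ((o :: os).foldl (fun s o => o.apply T s) s) ∧
      R T s ((o :: os).foldl (fun s o => o.apply T s) s)) : Runs l R :=
  ⟨SpinGlass.straight o os, os.length + 1, fun T s =>
    ⟨_, _, exec_straight T o os s, le_two_pow_self _ (by omega), (h T s).1, (h T s).2⟩⟩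

/-- Sequential composition. -/
theorem Runs.comp {l l' : ℕ} {R R' S : (ℕ → ℂ) → State → State → Prop} (h : Runs l R)
    (h' : Runs l' R') (hl : 3 ≤ l) (hll : l ≤ l')
    (hS : ∀ T s s₁ s₂, Agree l s s₁ → R T s s₁ → Agree l' s₁ s₂ → R' T s₁ s₂ → S T s s₂) :
    Runs l S := by
  obtain ⟨P, c, hP⟩ := h
  obtain ⟨P', c', hP'⟩ := h'
  refine ⟨.seq P P', c + c' + 1, fun T s => ?_⟩
  obtain ⟨s₁, t₁, e₁, ht₁, a₁, r₁⟩ := hP T s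
  obtain ⟨s₂, t₂, e₂, ht₂, a₂, r₂⟩ := hP' T s₁
  refine ⟨s₂, _, .seq e₁ e₂, ?_, a₁.trans (a₂.mono hll), hS T s s₁ s₂ a₁ r₁ a₂ r₂⟩
  rw [a₁.1 2 (by omega)] at ht₂
  exact (add_le_add ht₁ ht₂).trans (pow_add_pow_le_pow (by omega) _ _)

theorem Runs.straight_comp {l : ℕ} {R S : (ℕ → ℂ) → State → State → Prop} (h : Runs l R)
    (o : Op) (os : List Op)
    (hS : ∀ T s s₁, Agree l s s₁ → R T s s₁ →
      Agree l s₁ ((o :: os).foldl (fun s o => o.apply T s) s₁) ∧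
      S T s ((o :: os).foldl (fun s o => o.apply T s) s₁)) : Runs l S := by
  obtain ⟨P, c, hP⟩ := h
  refine ⟨.seq P (SpinGlass.straight o os), c + (os.length + 1) + 1, fun T s => ?_⟩
  obtain ⟨s₁, t₁, e₁, ht₁, a₁, r₁⟩ := hP T s
  obtain ⟨h₁, h₂⟩ := hS T s s₁ a₁ r₁
  refine ⟨_, _, .seq e₁ (exec_straight T o os s₁), ?_, a₁.trans h₁, h₂⟩
  exact (add_le_add ht₁ (le_two_pow_self _ (by omega))).trans (pow_add_pow_le_pow (by omega) _ _)

/-- Case distinction. -/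
theorem Runs.branch {l : ℕ} {R R' : (ℕ → ℂ) → State → State → Prop} (a b : ℕ) (h : Runs l R)
    (h' : Runs l R') :
    Runs l fun T s s' => if s.int a ≤ s.int b then R T s s' else R' T s s' := by
  obtain ⟨P, c, hP⟩ := h
  obtain ⟨P', c', hP'⟩ := h'
  have key (y : ℕ) (hy : 2 ≤ y) : 1 + y ^ c ≤ y ^ (c + c' + 1) ∧ 1 + y ^ c' ≤ y ^ (c + c' + 1) := by
    have h := pow_add_pow_le_pow hy c c'
    have h₁ : 1 ≤ y ^ c := Nat.one_le_pow _ _ (by omega)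
    have h₂ : 1 ≤ y ^ c' := Nat.one_le_pow _ _ (by omega)
    omega
  refine ⟨.branch (.intLe a b) P P', c + c' + 1, fun T s => ?_⟩
  by_cases hs : s.int a ≤ s.int b
  · obtain ⟨s₁, t₁, e₁, ht₁, a₁, r₁⟩ := hP T s
    refine ⟨s₁, _, .branchTrue hs e₁, ?_, a₁, by simpa [hs] using r₁⟩
    exact (Nat.add_le_add_left ht₁ 1).trans (key _ (by omega)).1
  · obtain ⟨s₁, t₁, e₁, ht₁, a₁, r₁⟩ := hP' T s
    refine ⟨s₁, _, .branchFalse hs e₁, ?_, a₁, by simpa [hs] using r₁⟩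
    exact (Nat.add_le_add_left ht₁ 1).trans (key _ (by omega)).2

/-- A loop whose counter in register `i` runs from `0` to the content of register `2`. -/
theorem Runs.loop {l i : ℕ} {R : (ℕ → ℂ) → State → State → Prop} (hl : 3 ≤ l) (h : Runs l R)
    (I : (ℕ → ℂ) → State → ℕ → State → Prop) (hI : ∀ T s₀ j s, I T s₀ j s → s.int i = j)
    (hstep : ∀ T s₀ j s s', Agree l s₀ s → I T s₀ j s → Agree l s s' → R T s s' →
      I T s₀ (j + 1) s') :
    ∃ (P : Program) (c : ℕ), ∀ T s₀, I T s₀ 0 s₀ → ∃ s' t, Exec T P s₀ s' t ∧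
      t ≤ (s₀.int 2 + 2) ^ c ∧ Agree l s₀ s' ∧ I T s₀ (s₀.int 2 + 1) s' := by
  obtain ⟨P, c, hP⟩ := h
  refine ⟨.loop (.intLe i 2) P, c + 3, fun T s₀ h₀ => ?_⟩
  obtain ⟨s', t, e, ht, a, hs'⟩ := exec_loop_of_invariant (T := T) (i := i) (b := 2)
    (N := s₀.int 2) (C := (s₀.int 2 + 2) ^ c) (P := P) (fun j s => Agree l s₀ s ∧ I T s₀ j s)
    (fun j s hs => ⟨hI _ _ _ _ hs.2, hs.1.1 2 (by omega)⟩)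
    (fun j _ s hs => by
      obtain ⟨s', t, e, ht, a, r⟩ := hP T s
      rw [hs.1.1 2 (by omega)] at ht
      exact ⟨s', t, e, ht, hs.1.trans a, hstep T s₀ j s s' hs.1 hs.2 a r⟩)
    ⟨Agree.refl _ _, h₀⟩
  refine ⟨s', t, e, ht.trans ?_, a, hs'⟩
  have hc : 1 ≤ (s₀.int 2 + 2) ^ c := Nat.one_le_pow _ _ (by omega)
  rw [pow_add]
  generalize (s₀.int 2 + 2) ^ c = y at *
  generalize s₀.int 2 = N at *
  have h₃ : 2 * N + 3 ≤ (N + 2) ^ 3 := by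
    have : (N + 2) ^ 3 = N ^ 3 + 6 * N ^ 2 + 12 * N + 8 := by ring
    omega
  nlinarith [Nat.mul_le_mul_left y h₃, Nat.mul_le_mul_left N hc]

/-! ### Closure properties of computable functions -/

theorem NatComp.const {k : ℕ} (hk : 3 ≤ k) (x : ℕ) : NatComp k fun _ _ => x :=
  ⟨hk, fun _ _ _ _ => rfl, fun l _ => .straight (.intConst l x) [] fun _ s =>
    ⟨(Agree.refl l s).setInt le_rfl _, State.setInt_int_self _ _ _⟩⟩

theorem NatComp.var {k : ℕ} (hk : 3 ≤ k) {r : ℕ} (hr : r < k) : NatComp k fun _ s => s.int r :=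
  ⟨hk, fun _ _ _ h => h.1 r hr, fun l hl =>
    -- There is no move instruction; the register is copied by adding it to zero.
    .straight (.intConst l 0) [.intAdd l l r] fun _ s =>
      ⟨((Agree.refl l s).setInt le_rfl _).setInt le_rfl _, by
        simp [Op.apply, State.setInt_int_of_ne _ _ (show r ≠ l by omega)]⟩⟩

/-- The second argument is computed one level higher, so that the frame protects the first value in
register `l`; stability of `g` makes it irrelevant that the state has changed in between. -/
theorem NatComp.map₂ {k : ℕ} {f g : (ℕ → ℂ) → State → ℕ} (φ : ℕ → ℕ → ℕ) (o : ℕ → ℕ → ℕ → Op)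
    (ho : ∀ r a b T s, (o r a b).apply T s = s.setInt r (φ (s.int a) (s.int b)))
    (hf : NatComp k f) (hg : NatComp k g) : NatComp k fun T s => φ (f T s) (g T s) := by
  refine ⟨hf.1, fun T s s' h => by beta_reduce; rw [hf.2.1 T s s' h, hg.2.1 T s s' h], fun l hl => ?_⟩
  have hl3 := hf.1.trans hl
  refine ((hf.2.2 l hl).comp (S := fun T s s' => s'.int l = f T s ∧ s'.int (l + 1) = g T s)
    (hg.2.2 (l + 1) (by omega)) hl3 (by omega) ?_).straight_comp (o l l (l + 1)) [] ?_
  · intro T s s₁ s₂ h₁ r₁ h₂ r₂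
    exact ⟨by rw [h₂.1 l (by omega), r₁], by rw [r₂, hg.2.1 T s s₁ (h₁.mono hl)]⟩
  · intro T s s₁ h₁ r₁
    simp only [List.foldl, ho]
    exact ⟨(Agree.refl l s₁).setInt le_rfl _, by simp [r₁.1, r₁.2]⟩

theorem NatComp.add {k : ℕ} {f g : (ℕ → ℂ) → State → ℕ} (hf : NatComp k f) (hg : NatComp k g) :
    NatComp k fun T s => f T s + g T s :=
  hf.map₂ _ Op.intAdd (fun _ _ _ _ _ => rfl) hg

theorem NatComp.sub {k : ℕ} {f g : (ℕ → ℂ) → State → ℕ} (hf : NatComp k f) (hg : NatComp k g) :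
    NatComp k fun T s => f T s - g T s :=
  hf.map₂ _ Op.intSub (fun _ _ _ _ _ => rfl) hg

theorem runs_pair {k l : ℕ} {f g : (ℕ → ℂ) → State → ℕ} (hf : NatComp k f) (hg : NatComp k g)
    (hl : k ≤ l) :
    Runs l fun T s s' => s'.int l = f T s ∧ s'.int (l + 1) = g T s :=
  (hf.2.2 l hl).comp (hg.2.2 (l + 1) (by omega)) (hf.1.trans hl) (by omega)
    fun T s s₁ s₂ h₁ r₁ h₂ r₂ =>
      ⟨by rw [h₂.1 l (by omega), r₁], by rw [r₂, hg.2.1 T s s₁ (h₁.mono hl)]⟩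

theorem NatComp.ite {k : ℕ} {f g x y : (ℕ → ℂ) → State → ℕ} (hf : NatComp k f) (hg : NatComp k g)
    (hx : NatComp k x) (hy : NatComp k y) :
    NatComp k fun T s => if f T s ≤ g T s then x T s else y T s := by
  refine ⟨hf.1, fun T s s' h => by
    simp only [hf.2.1 T s s' h, hg.2.1 T s s' h, hx.2.1 T s s' h, hy.2.1 T s s' h], fun l hl => ?_⟩
  refine (runs_pair hf hg hl).comp (.branch l (l + 1) (hx.2.2 l hl) (hy.2.2 l hl))
    (hf.1.trans hl) le_rfl ?_
  rintro T s s₁ s₂ h₁ ⟨r₁, r₁'⟩ - r₂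
  rw [r₁, r₁', hx.2.1 T s s₁ (h₁.mono hl), hy.2.1 T s s₁ (h₁.mono hl)] at r₂
  beta_reduce
  split_ifs at r₂ ⊢ <;> exact r₂

/-- Iteration, with the content of register `2` as the number of steps. -/
theorem NatComp.fold {k : ℕ} {a : (ℕ → ℂ) → State → ℕ} {g : ℕ → ℕ → (ℕ → ℂ) → State → ℕ}
    (ha : NatComp k a)
    (hg : ∀ k' ≥ k, ∀ u v, NatComp k' u → NatComp k' v →
      NatComp k' fun T s => g (u T s) (v T s) T s) :
    NatComp k fun T s => Nat.rec (a T s) (fun j x => g j x T s) (s.int 2 + 1) := by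
  have hk := ha.1
  have hgs (u v : ℕ) : Stable k (g u v) := (hg k le_rfl _ _ (.const hk u) (.const hk v)).2.1
  have hst (N : ℕ) :
      Stable k fun T s => (Nat.rec (a T s) (fun j x => g j x T s) N : ℕ) := fun T s s' h => by
    simp only [ha.2.1 T s s' h, fun u v => hgs u v T s s' h]
  refine ⟨hk, fun T s s' h => by
    have := hst (s.int 2 + 1) T s s' h
    simp only [h.1 2 (by omega)] at this ⊢
    exact this, fun l hl => ?_⟩
  -- Register `l` is the accumulator and `l + 1` the counter. The body runs at level `l + 2`, where
  -- both are protected and readable as variables; then its result is copied down and the counter is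
  -- increased.
  have hbody : Runs l fun T s s' => s'.int l = g (s.int (l + 1)) (s.int l) T s ∧
      s'.int (l + 1) = s.int (l + 1) + 1 := by
    obtain ⟨P, c, hP⟩ := (hg (l + 2) (by omega) _ _ (.var (r := l + 1) (by omega) (by omega))
      (.var (r := l) (by omega) (by omega))).2.2 (l + 2) le_rfl
    have h₀ : Runs l fun T s s' => s'.int (l + 2) = g (s.int (l + 1)) (s.int l) T s ∧
        s'.int (l + 1) = s.int (l + 1) :=
      ⟨P, c, fun T s => by
        obtain ⟨s', t, e, ht, ag, r⟩ := hP T s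
        exact ⟨s', t, e, ht, ag.mono (by omega), r, ag.1 _ (by omega)⟩⟩
    refine h₀.straight_comp (.intConst l 0) [.intAdd l l (l + 2), .intConst (l + 2) 1,
      .intAdd (l + 1) (l + 1) (l + 2)] ?_
    rintro T s s₁ - ⟨r₁, r₂⟩
    refine ⟨((((Agree.refl l s₁).setInt le_rfl _).setInt le_rfl _).setInt (by omega) _).setInt
      (by omega) _, ?_⟩
    simp [Op.apply, State.setInt, r₁, r₂]
  obtain ⟨P, c, hP⟩ := hbody.loop (i := l + 1) (hk.trans hl)
    (fun T s₀ j s => s.int (l + 1) = j ∧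
      s.int l = (Nat.rec (s₀.int l) (fun j x => g j x T s₀) j : ℕ))
    (fun _ _ _ _ h => h.1) (by
      rintro T s₀ j s s' h₀ ⟨i₁, i₂⟩ - ⟨r₁, r₂⟩
      refine ⟨by rw [r₂, i₁], ?_⟩
      rw [r₁, i₁, i₂, hgs _ _ T s₀ s (h₀.mono hl)])
  have hinit : Runs l fun T s s' => s'.int l = a T s ∧ s'.int (l + 1) = 0 := by
    refine (ha.2.2 l hl).straight_comp (.intConst (l + 1) 0) [] ?_
    intro T s s₁ h₁ r₁
    exact ⟨(Agree.refl l s₁).setInt (by omega) _, by simp [Op.apply, State.setInt, r₁]⟩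
  obtain ⟨P₀, c₀, hP₀⟩ := hinit
  refine ⟨.seq P₀ P, c₀ + c + 1, fun T s => ?_⟩
  obtain ⟨s₁, t₁, e₁, ht₁, h₁, r₁, r₁'⟩ := hP₀ T s
  obtain ⟨s₂, t₂, e₂, ht₂, h₂, r₂, r₂'⟩ := hP T s₁ ⟨r₁', rfl⟩
  rw [h₁.1 2 (by omega)] at ht₂ r₂'
  refine ⟨s₂, _, .seq e₁ e₂, (add_le_add ht₁ ht₂).trans (pow_add_pow_le_pow (by omega) _ _),
    h₁.trans h₂, ?_⟩
  beta_reduce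
  rw [r₂', r₁]
  simp only [fun u v => hgs u v T s s₁ (h₁.mono hl)]

theorem NatComp.sum {k : ℕ} {g : ℕ → (ℕ → ℂ) → State → ℕ} (hk : 3 ≤ k)
    (hg : ∀ k' ≥ k, ∀ u, NatComp k' u → NatComp k' fun T s => g (u T s) T s) :
    NatComp k fun T s => ∑ j ∈ Finset.range (s.int 2 + 1), g j T s := by
  convert NatComp.fold (g := fun j x T s => x + g j T s) (.const hk 0)
    fun k' hk' u v hu hv => hv.add (hg k' hk' u hu) using 3 with T s
  generalize s.int 2 + 1 = N
  induction N with
  | zero => rfl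
  | succ N ih => rw [Finset.sum_range_succ, ih]

/-! Operations on numbers. -/

theorem NumComp.of_nat {k : ℕ} {f : (ℕ → ℂ) → State → ℕ} (hf : NatComp k f)
    (φ : ℕ → (ℕ → ℂ) → State → ℂ) (hφ : ∀ x, Stable k (φ x)) (o : ℕ → Op)
    (ho : ∀ l ≥ k, ∀ T s, (o l).apply T s = s.setNum (2 * l) (φ (s.int l) T s)) :
    NumComp k fun T s => φ (f T s) T s := by
  refine ⟨hf.1, fun T s s' h => by beta_reduce; rw [hf.2.1 T s s' h, hφ _ T s s' h], fun l hl => ?_⟩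
  refine (hf.2.2 l hl).straight_comp (o l) [] fun T s s₁ h₁ r₁ => ?_
  simp only [List.foldl, ho l hl]
  exact ⟨(Agree.refl l s₁).setNum le_rfl _, by simp [r₁, hφ _ T s s₁ (h₁.mono hl)]⟩

theorem NumComp.ofNat {k : ℕ} {f : (ℕ → ℂ) → State → ℕ} (hf : NatComp k f) :
    NumComp k fun T s => (f T s : ℂ) :=
  .of_nat hf (fun x _ _ => x) (fun _ _ _ _ _ => rfl) (fun l => .ofInt (2 * l) l)
    fun _ _ _ _ => rfl

/-- Reading the input tape. -/
theorem NumComp.tape {k : ℕ} {f : (ℕ → ℂ) → State → ℕ} (hf : NatComp k f) :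
    NumComp k fun T s => T (f T s) :=
  .of_nat hf (fun x T _ => T x) (fun _ _ _ _ _ => rfl) (fun l => .read (2 * l) l)
    fun _ _ _ _ => rfl

/-- Reading the array stored in the odd number cells. -/
theorem NumComp.odd {k : ℕ} {f : (ℕ → ℂ) → State → ℕ} (hf : NatComp k f) :
    NumComp k fun T s => s.num (2 * f T s + 1) := by
  have h₂ := (hf.add hf).add (.const hf.1 1)
  refine ⟨hf.1, fun T s s' h => by beta_reduce; rw [hf.2.1 T s s' h, h.2.2], fun l hl => ?_⟩
  refine (h₂.2.2 l hl).straight_comp (.load (2 * l) l) [] fun T s s₁ h₁ r₁ => ?_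
  refine ⟨(Agree.refl l s₁).setNum le_rfl _, ?_⟩
  simp only [List.foldl, Op.apply, State.setNum_num_self, r₁, ← two_mul, h₁.2.2]

theorem NumComp.var {k : ℕ} (hk : 3 ≤ k) {r : ℕ} (hr : r < k) :
    NumComp k fun _ s => s.num (2 * r) :=
  ⟨hk, fun _ _ _ h => h.2.1 r hr, fun l hl =>
    .straight (.intConst l (2 * r)) [.load (2 * l) l] fun _ s =>
      ⟨((Agree.refl l s).setInt le_rfl _).setNum le_rfl _, by simp [Op.apply]⟩⟩

theorem NumComp.map {k : ℕ} {f : (ℕ → ℂ) → State → ℂ} (φ : ℂ → ℂ) (o : ℕ → ℕ → Op)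
    (ho : ∀ r a T s, (o r a).apply T s = s.setNum r (φ (s.num a)))
    (hf : NumComp k f) : NumComp k fun T s => φ (f T s) := by
  refine ⟨hf.1, fun T s s' h => by beta_reduce; rw [hf.2.1 T s s' h], fun l hl => ?_⟩
  refine (hf.2.2 l hl).straight_comp (o (2 * l) (2 * l)) [] fun T s s₁ h₁ r₁ => ?_
  simp only [List.foldl, ho]
  exact ⟨(Agree.refl l s₁).setNum le_rfl _, by simp [r₁]⟩

theorem NumComp.exp {k : ℕ} {f : (ℕ → ℂ) → State → ℂ} (hf : NumComp k f) :
    NumComp k fun T s => Complex.exp (f T s) :=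
  hf.map _ Op.exp fun _ _ _ _ => rfl

theorem NumComp.log {k : ℕ} {f : (ℕ → ℂ) → State → ℂ} (hf : NumComp k f) :
    NumComp k fun T s => Complex.log (f T s) :=
  hf.map _ Op.log fun _ _ _ _ => rfl

theorem NumComp.map₂ {k : ℕ} {f g : (ℕ → ℂ) → State → ℂ} (φ : ℂ → ℂ → ℂ) (o : ℕ → ℕ → ℕ → Op)
    (ho : ∀ r a b T s, (o r a b).apply T s = s.setNum r (φ (s.num a) (s.num b)))
    (hf : NumComp k f) (hg : NumComp k g) : NumComp k fun T s => φ (f T s) (g T s) := by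
  refine ⟨hf.1, fun T s s' h => by beta_reduce; rw [hf.2.1 T s s' h, hg.2.1 T s s' h], fun l hl => ?_⟩
  have hl3 := hf.1.trans hl
  refine ((hf.2.2 l hl).comp
    (S := fun T s s' => s'.num (2 * l) = f T s ∧ s'.num (2 * (l + 1)) = g T s)
    (hg.2.2 (l + 1) (by omega)) hl3 (by omega) ?_).straight_comp
    (o (2 * l) (2 * l) (2 * (l + 1))) [] ?_
  · intro T s s₁ s₂ h₁ r₁ h₂ r₂
    exact ⟨by rw [h₂.2.1 l (by omega), r₁], by rw [r₂, hg.2.1 T s s₁ (h₁.mono hl)]⟩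
  · intro T s s₁ h₁ r₁
    simp only [List.foldl, ho]
    exact ⟨(Agree.refl l s₁).setNum le_rfl _, by simp [r₁.1, r₁.2]⟩

theorem NumComp.add {k : ℕ} {f g : (ℕ → ℂ) → State → ℂ} (hf : NumComp k f) (hg : NumComp k g) :
    NumComp k fun T s => f T s + g T s :=
  hf.map₂ _ Op.add (fun _ _ _ _ _ => rfl) hg

theorem NumComp.sub {k : ℕ} {f g : (ℕ → ℂ) → State → ℂ} (hf : NumComp k f) (hg : NumComp k g) :
    NumComp k fun T s => f T s - g T s :=
  hf.map₂ _ Op.sub (fun _ _ _ _ _ => rfl) hg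

theorem NumComp.mul {k : ℕ} {f g : (ℕ → ℂ) → State → ℂ} (hf : NumComp k f) (hg : NumComp k g) :
    NumComp k fun T s => f T s * g T s :=
  hf.map₂ _ Op.mul (fun _ _ _ _ _ => rfl) hg

theorem NumComp.div {k : ℕ} {f g : (ℕ → ℂ) → State → ℂ} (hf : NumComp k f) (hg : NumComp k g) :
    NumComp k fun T s => f T s / g T s :=
  hf.map₂ _ Op.div (fun _ _ _ _ _ => rfl) hg

theorem NumComp.ite {k : ℕ} {f g : (ℕ → ℂ) → State → ℕ} {x y : (ℕ → ℂ) → State → ℂ}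
    (hf : NatComp k f) (hg : NatComp k g) (hx : NumComp k x) (hy : NumComp k y) :
    NumComp k fun T s => if f T s ≤ g T s then x T s else y T s := by
  refine ⟨hf.1, fun T s s' h => by
    simp only [hf.2.1 T s s' h, hg.2.1 T s s' h, hx.2.1 T s s' h, hy.2.1 T s s' h], fun l hl => ?_⟩
  refine (runs_pair hf hg hl).comp (.branch l (l + 1) (hx.2.2 l hl) (hy.2.2 l hl))
    (hf.1.trans hl) le_rfl ?_
  rintro T s s₁ s₂ h₁ ⟨r₁, r₁'⟩ - r₂
  rw [r₁, r₁', hx.2.1 T s s₁ (h₁.mono hl), hy.2.1 T s s₁ (h₁.mono hl)] at r₂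
  beta_reduce
  split_ifs at r₂ ⊢ <;> exact r₂

/-- Iteration on numbers, with the content of integer register `2` as the number of steps. -/
theorem NumComp.fold {k : ℕ} {a : (ℕ → ℂ) → State → ℂ} {g : ℕ → ℂ → (ℕ → ℂ) → State → ℂ}
    (ha : NumComp k a) (hgs : ∀ u v, Stable k (g u v))
    (hg : ∀ k' ≥ k, ∀ u v, NatComp k' u → NumComp k' v →
      NumComp k' fun T s => g (u T s) (v T s) T s) :
    NumComp k fun T s => Nat.rec (a T s) (fun j x => g j x T s) (s.int 2 + 1) := by
  have hk := ha.1
  -- For integers, stability of `g u v` follows from computability at constant arguments. An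
  -- arbitrary complex constant is not computable, so here it comes from the hypothesis `hgs`.
  have hst (N : ℕ) :
      Stable k fun T s => (Nat.rec (a T s) (fun j x => g j x T s) N : ℂ) := fun T s s' h => by
    simp only [ha.2.1 T s s' h, fun u v => hgs u v T s s' h]
  refine ⟨hk, fun T s s' h => by
    have := hst (s.int 2 + 1) T s s' h
    simp only [h.1 2 (by omega)] at this ⊢
    exact this, fun l hl => ?_⟩
  have hbody : Runs l fun T s s' => s'.num (2 * l) = g (s.int l) (s.num (2 * l)) T s ∧
      s'.int l = s.int l + 1 := by
    obtain ⟨P, c, hP⟩ := (hg (l + 1) (by omega) _ _ (.var (r := l) (by omega) (by omega))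
      (.var (r := l) (by omega) (by omega))).2.2 (l + 1) le_rfl
    have h₀ : Runs l fun T s s' => s'.num (2 * (l + 1)) = g (s.int l) (s.num (2 * l)) T s ∧
        s'.int l = s.int l :=
      ⟨P, c, fun T s => by
        obtain ⟨s', t, e, ht, ag, r⟩ := hP T s
        exact ⟨s', t, e, ht, ag.mono (by omega), r, ag.1 _ (by omega)⟩⟩
    refine h₀.straight_comp (.intConst (l + 1) (2 * (l + 1))) [.load (2 * l) (l + 1),
      .intConst (l + 1) 1, .intAdd l l (l + 1)] ?_
    rintro T s s₁ - ⟨r₁, r₂⟩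
    refine ⟨((((Agree.refl l s₁).setInt (by omega) _).setNum le_rfl _).setInt (by omega) _).setInt
      le_rfl _, ?_⟩
    simp only [mul_add, mul_one] at r₁
    simp [Op.apply, State.setInt, State.setNum, r₁, r₂, mul_add]
  obtain ⟨P, c, hP⟩ := hbody.loop (i := l) (hk.trans hl)
    (fun T s₀ j s => s.int l = j ∧
      s.num (2 * l) = (Nat.rec (s₀.num (2 * l)) (fun j x => g j x T s₀) j : ℂ))
    (fun _ _ _ _ h => h.1) (by
      rintro T s₀ j s s' h₀ ⟨i₁, i₂⟩ - ⟨r₁, r₂⟩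
      refine ⟨by rw [r₂, i₁], ?_⟩
      rw [r₁, i₁, i₂, hgs _ _ T s₀ s (h₀.mono hl)])
  have hinit : Runs l fun T s s' => s'.num (2 * l) = a T s ∧ s'.int l = 0 := by
    refine (ha.2.2 l hl).straight_comp (.intConst l 0) [] ?_
    intro T s s₁ h₁ r₁
    exact ⟨(Agree.refl l s₁).setInt le_rfl _, by simp [Op.apply, State.setInt, r₁]⟩
  obtain ⟨P₀, c₀, hP₀⟩ := hinit
  refine ⟨.seq P₀ P, c₀ + c + 1, fun T s => ?_⟩
  obtain ⟨s₁, t₁, e₁, ht₁, h₁, r₁, r₁'⟩ := hP₀ T s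
  obtain ⟨s₂, t₂, e₂, ht₂, h₂, r₂, r₂'⟩ := hP T s₁ ⟨r₁', rfl⟩
  rw [h₁.1 2 (by omega)] at ht₂ r₂'
  refine ⟨s₂, _, .seq e₁ e₂, (add_le_add ht₁ ht₂).trans (pow_add_pow_le_pow (by omega) _ _),
    h₁.trans h₂, ?_⟩
  beta_reduce
  rw [r₂', r₁]
  simp only [fun u v => hgs u v T s s₁ (h₁.mono hl)]

theorem NumComp.sum {k : ℕ} {g : ℕ → (ℕ → ℂ) → State → ℂ} (hk : 3 ≤ k)
    (hg : ∀ k' ≥ k, ∀ u, NatComp k' u → NumComp k' fun T s => g (u T s) T s) :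
    NumComp k fun T s => ∑ j ∈ Finset.range (s.int 2 + 1), g j T s := by
  have hz : NumComp k fun _ _ => 0 := by simpa using NumComp.ofNat (.const hk 0)
  have hgs (u : ℕ) : Stable k (g u) := (hg k le_rfl _ (.const hk u)).2.1
  convert NumComp.fold (g := fun j x T s => x + g j T s) hz
    (fun u v T s s' h => congrArg (v + ·) (hgs u T s s' h))
    fun k' hk' u v hu hv => hv.add (hg k' hk' u hu) using 3 with T s
  generalize s.int 2 + 1 = N
  induction N with
  | zero => rfl
  | succ N ih => rw [Finset.sum_range_succ, ih]

theorem NumComp.prod {k : ℕ} {g : ℕ → (ℕ → ℂ) → State → ℂ} (hk : 3 ≤ k)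
    (hg : ∀ k' ≥ k, ∀ u, NatComp k' u → NumComp k' fun T s => g (u T s) T s) :
    NumComp k fun T s => ∏ j ∈ Finset.range (s.int 2 + 1), g j T s := by
  have ho : NumComp k fun _ _ => 1 := by simpa using NumComp.ofNat (.const hk 1)
  have hgs (u : ℕ) : Stable k (g u) := (hg k le_rfl _ (.const hk u)).2.1
  convert NumComp.fold (g := fun j x T s => x * g j T s) ho
    (fun u v T s s' h => congrArg (v * ·) (hgs u T s s' h))
    fun k' hk' u v hu hv => hv.mul (hg k' hk' u hu) using 3 with T s
  generalize s.int 2 + 1 = N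
  induction N with
  | zero => rfl
  | succ N ih => rw [Finset.prod_range_succ, ih]

/-! ### Clipped arithmetic -/

/-- Every loop of the calculus has the same length. A shorter range is obtained by masking summands,
and a longer one is cut off; hence the minimum. -/
theorem sum_range_ite_succ_le {M : Type*} [AddCommMonoid M] (b N : ℕ) (g : ℕ → M) :
    ∑ j ∈ Finset.range N, (if j + 1 ≤ b then g j else 0) = ∑ j ∈ Finset.range (min b N), g j := by
  rw [← Finset.sum_filter]
  refine Finset.sum_congr ?_ fun _ _ => rfl
  ext j; simp only [Finset.mem_filter, Finset.mem_range]; omega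

theorem prod_range_ite_succ_le {M : Type*} [CommMonoid M] (b N : ℕ) (g : ℕ → M) :
    ∏ j ∈ Finset.range N, (if j + 1 ≤ b then g j else 1) = ∏ j ∈ Finset.range (min b N), g j := by
  rw [← Finset.prod_filter]
  refine Finset.prod_congr ?_ fun _ _ => rfl
  ext j; simp only [Finset.mem_filter, Finset.mem_range]; omega

theorem NatComp.sumRange {k : ℕ} {b : (ℕ → ℂ) → State → ℕ} {g : ℕ → (ℕ → ℂ) → State → ℕ}
    (hb : NatComp k b)
    (hg : ∀ k' ≥ k, ∀ u, NatComp k' u → NatComp k' fun T s => g (u T s) T s) :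
    NatComp k fun T s => ∑ j ∈ Finset.range (min (b T s) (s.int 2 + 1)), g j T s := by
  simp_rw [← sum_range_ite_succ_le]
  exact .sum hb.1 fun k' hk' u hu => .ite (hu.add (.const hu.1 1)) (hb.mono hk') (hg k' hk' u hu)
    (.const hu.1 0)

theorem NumComp.sumRange {k : ℕ} {b : (ℕ → ℂ) → State → ℕ} {g : ℕ → (ℕ → ℂ) → State → ℂ}
    (hb : NatComp k b)
    (hg : ∀ k' ≥ k, ∀ u, NatComp k' u → NumComp k' fun T s => g (u T s) T s) :
    NumComp k fun T s => ∑ j ∈ Finset.range (min (b T s) (s.int 2 + 1)), g j T s := by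
  simp_rw [← sum_range_ite_succ_le]
  refine .sum hb.1 fun k' hk' u hu => .ite (hu.add (.const hu.1 1)) (hb.mono hk') (hg k' hk' u hu)
    ?_
  simpa using NumComp.ofNat (.const hu.1 0)

theorem NumComp.prodRange {k : ℕ} {b : (ℕ → ℂ) → State → ℕ} {g : ℕ → (ℕ → ℂ) → State → ℂ}
    (hb : NatComp k b)
    (hg : ∀ k' ≥ k, ∀ u, NatComp k' u → NumComp k' fun T s => g (u T s) T s) :
    NumComp k fun T s => ∏ j ∈ Finset.range (min (b T s) (s.int 2 + 1)), g j T s := by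
  simp_rw [← prod_range_ite_succ_le]
  refine .prod hb.1 fun k' hk' u hu => .ite (hu.add (.const hu.1 1)) (hb.mono hk') (hg k' hk' u hu)
    ?_
  simpa using NumComp.ofNat (.const hu.1 1)

/-- Multiplication is repeated addition. Only the first factor, the number of summands, gets
clipped. -/
theorem NatComp.mul {k : ℕ} {f g : (ℕ → ℂ) → State → ℕ} (hf : NatComp k f) (hg : NatComp k g) :
    NatComp k fun T s => min (f T s) (s.int 2 + 1) * g T s := by
  simpa using NatComp.sumRange hf (g := fun _ => g) fun k' hk' _ _ => hg.mono hk'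

theorem NatComp.pow {k : ℕ} {f g : (ℕ → ℂ) → State → ℕ} (hf : NatComp k f) (hg : NatComp k g) :
    NatComp k fun T s => (min (f T s) (s.int 2 + 1)) ^ (min (g T s) (s.int 2 + 1)) := by
  have h := NatComp.fold (g := fun j x T s =>
    if j + 1 ≤ g T s then min (f T s) (s.int 2 + 1) * x else x) (.const hf.1 1)
    fun k' hk' u v hu hv => .ite (hu.add (.const hu.1 1)) (hg.mono hk') ((hf.mono hk').mul hv) hv
  convert h using 3 with T s
  generalize s.int 2 + 1 = N
  generalize min (f T s) N = x
  induction N with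
  | zero => simp
  | succ N ih =>
    simp only [← ih]
    split_ifs with h
    · rw [min_eq_right h, min_eq_right (by omega), pow_succ']
    · rw [min_eq_left (by omega), min_eq_left (by omega)]

/-- Division by counting: `x / y` is the number of positive multiples of `y` up to `x`. -/
theorem sum_range_ite_mul_le (N x : ℕ) {y : ℕ} (hy : 1 ≤ y) :
    ∑ j ∈ Finset.range N, (if (j + 1) * y ≤ x then 1 else 0) = min (x / y) N := by
  simp_rw [← Nat.le_div_iff_mul_le hy]
  rw [sum_range_ite_succ_le]; simp

theorem NatComp.div {k : ℕ} {f g : (ℕ → ℂ) → State → ℕ} (hf : NatComp k f) (hg : NatComp k g) :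
    NatComp k fun T s => min (f T s / g T s) (s.int 2 + 1) := by
  -- The outer test `1 ≤ g` enforces `x / 0 = 0`; without it the count for divisor zero would be the
  -- full length of the loop.
  have h := NatComp.ite (.const hf.1 1) hg (.sum (g := fun j T s =>
      if min (j + 1) (s.int 2 + 1) * g T s ≤ f T s then 1 else 0) hf.1 fun k' hk' u hu =>
    .ite ((hu.add (.const hu.1 1)).mul (hg.mono hk')) (hf.mono hk') (.const hu.1 1)
      (.const hu.1 0)) (.const hf.1 0)
  convert h using 3 with T s
  split_ifs with hy
  · rw [← sum_range_ite_mul_le _ _ hy]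
    refine Finset.sum_congr rfl fun j hj => ?_
    rw [min_eq_left]
    have := Finset.mem_range.1 hj
    omega
  · simp [show g T s = 0 by omega]

/-- Digit `j` of `x` in base `b`, with clipping at `B + 1`. -/
def clipDigit (B x b j : ℕ) : ℕ :=
  min (x / (min b (B + 1)) ^ (min j (B + 1))) (B + 1) -
    min (min (min (x / (min b (B + 1)) ^ (min j (B + 1))) (B + 1) / b) (B + 1)) (B + 1) * b

/-- The nested minima in `clipDigit` are exactly those that the closure lemmas for quotients, powers
and products produce, so these compose without any rewriting. -/
theorem NatComp.digit {k : ℕ} {x b j : (ℕ → ℂ) → State → ℕ} (hx : NatComp k x) (hb : NatComp k b)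
    (hj : NatComp k j) : NatComp k fun T s => clipDigit (s.int 2) (x T s) (b T s) (j T s) :=
  have h := hx.div (hb.pow hj)
  h.sub ((h.div hb).mul hb)

theorem clipDigit_eq {B x b j : ℕ} (hx : x ≤ B + 1) (hb : b ≤ B + 1) (hj : j ≤ B + 1) :
    clipDigit B x b j = x / b ^ j % b := by
  have h₁ : x / b ^ j ≤ B + 1 := (Nat.div_le_self _ _).trans hx
  have h₂ : x / b ^ j / b ≤ B + 1 := (Nat.div_le_self _ _).trans h₁
  rw [clipDigit, min_eq_left hb, min_eq_left hj, min_eq_left h₁, min_eq_left h₂, min_eq_left h₂,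
    mul_comm]
  have := Nat.div_add_mod (x / b ^ j) b
  omega

theorem NatComp.eq {k : ℕ} {f g : (ℕ → ℂ) → State → ℕ} (hf : NatComp k f) (hg : NatComp k g) :
    NatComp k fun T s => if f T s = g T s then 1 else 0 := by
  convert NatComp.ite hf hg (.ite hg hf (.const hf.1 1) (.const hf.1 0)) (.const hf.1 0)
    using 3 with T s
  split_ifs <;> omega

/-! ### The Taylor coefficients as a computable function

A coupling `(p; i₁, …, i_p)` is encoded by `p * n ^ q + r`, with `q` the maximal order and `r` the
rank of `(i₁, …, i_p)`. A sequence of `k` couplings is encoded by a number with `k` digits.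
Everything is clipped at `B + 1`. -/

/-- The number `(q + 1) * n ^ q` of codes. -/
def clipCodes (B n q : ℕ) : ℕ :=
  min (q + 1) (B + 1) * min n (B + 1) ^ min q (B + 1)

/-- The order of the coupling with code `e`. -/
def clipOrder (B n q e : ℕ) : ℕ :=
  min (e / min n (B + 1) ^ min q (B + 1)) (B + 1)

/-- The rank of the coupling with code `e`. -/
def clipRank (B n q e : ℕ) : ℕ :=
  e - min (clipOrder B n q e) (B + 1) * min n (B + 1) ^ min q (B + 1)

/-- The coefficient, read from the tape `T`, of the coupling with order `p` and rank `r`. -/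
noncomputable def clipCoeff (B n q : ℕ) (T : ℕ → ℂ) (p r : ℕ) : ℂ :=
  if 2 ≤ p then
    if r + 1 ≤ min n (B + 1) ^ min p (B + 1) then
      -- The tape starts with `β`, `C`, `η`, so `γ_p` is in cell `p + 1`. The power n^((p-1)/2) is
      -- expressed through `exp` and `log`, and the sum of the n^a over 2 ≤ a < p is the offset of
      -- the block of order `p`.
      T (p + 1) / Complex.exp (((p - 1 : ℕ) : ℂ) / ((2 : ℕ) : ℂ) * Complex.log n) *
        T (3 + (q - 1) + (∑ a ∈ Finset.range (min p (B + 1)),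
          if 2 ≤ a then min n (B + 1) ^ min a (B + 1) else 0) + r)
    else ((0 : ℕ) : ℂ)
  else ((0 : ℕ) : ℂ)

/-- The number of occurrences of the site `i` in the `k` couplings encoded by `u`. -/
def clipCount (B n q k u i : ℕ) : ℕ :=
  ∑ j ∈ Finset.range (min k (B + 1)),
    ∑ l ∈ Finset.range (min (clipOrder B n q (clipDigit B u (clipCodes B n q) j)) (B + 1)),
      if clipDigit B (clipRank B n q (clipDigit B u (clipCodes B n q) j)) n l = i then 1 else 0

/-- The moment of order `c` of a Rademacher or a Gaussian variable. -/
noncomputable def clipSiteWeight (b : Background) (B c : ℕ) : ℂ :=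
  match b with
  | .hypercube => if c ≤ min (c / 2) (B + 1) + min (c / 2) (B + 1) then ((1 : ℕ) : ℂ)
      else ((0 : ℕ) : ℂ)
  | .sphere => if c ≤ min (c / 2) (B + 1) + min (c / 2) (B + 1) then
      ∏ j ∈ Finset.range (min (min (c / 2) (B + 1)) (B + 1)), ((j + j + 1 : ℕ) : ℂ)
      else ((0 : ℕ) : ℂ)

/-- The normalisation of the moments of order `d`. -/
noncomputable def clipLengthWeight (b : Background) (B n d : ℕ) : ℂ :=
  match b with
  | .hypercube => ((1 : ℕ) : ℂ)
  | .sphere => ∏ j ∈ Finset.range (min (min (d / 2) (B + 1)) (B + 1)),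
      (n : ℂ) / ((n + (j + j) : ℕ) : ℂ)

/-- The `k`-th moment of the Hamiltonian. -/
noncomputable def clipMoment (b : Background) (B n q : ℕ) (T : ℕ → ℂ) (k : ℕ) : ℂ :=
  ∑ u ∈ Finset.range (min (min (clipCodes B n q) (B + 1) ^ min k (B + 1)) (B + 1)),
    (∏ j ∈ Finset.range (min k (B + 1)),
      clipCoeff B n q T (clipOrder B n q (clipDigit B u (clipCodes B n q) j))
        (clipRank B n q (clipDigit B u (clipCodes B n q) j))) *
    (clipLengthWeight b B n (∑ i ∈ Finset.range (min n (B + 1)), clipCount B n q k u i) *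
      ∏ i ∈ Finset.range (min n (B + 1)), clipSiteWeight b B (clipCount B n q k u i))

/-- The `k`-th Taylor coefficient of the partition function. -/
noncomputable def clipTaylor (b : Background) (B n q : ℕ) (T : ℕ → ℂ) (k : ℕ) : ℂ :=
  clipMoment b B n q T k / ∏ j ∈ Finset.range (min k (B + 1)), ((j + 1 : ℕ) : ℂ)

/-- The `k`-th Taylor coefficient of the logarithm of the partition function, given the previous
ones in the array `A`. -/
noncomputable def clipLogTaylor (b : Background) (B n q : ℕ) (T A : ℕ → ℂ) (k : ℕ) : ℂ :=
  if k ≤ 0 then ((0 : ℕ) : ℂ) else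
    clipTaylor b B n q T k -
      (∑ j ∈ Finset.range (min k (B + 1)), (j : ℂ) * A j * clipTaylor b B n q T (k - j)) / (k : ℂ)

section
variable {k : ℕ} {x y z w : (ℕ → ℂ) → State → ℕ}

theorem natComp_codes (hk : 3 ≤ k) :
    NatComp k fun _ s => clipCodes (s.int 2) (s.int 0) (s.int 1) :=
  ((NatComp.var hk (by omega)).add (.const hk 1)).mul
    ((NatComp.var hk (by omega)).pow (.var hk (by omega)))

theorem natComp_order (hx : NatComp k x) :
    NatComp k fun T s => clipOrder (s.int 2) (s.int 0) (s.int 1) (x T s) :=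
  hx.div ((NatComp.var hx.1 (by have := hx.1; omega)).pow (.var hx.1 (by have := hx.1; omega)))

theorem natComp_rank (hx : NatComp k x) :
    NatComp k fun T s => clipRank (s.int 2) (s.int 0) (s.int 1) (x T s) :=
  hx.sub ((natComp_order hx).mul
    ((NatComp.var hx.1 (by have := hx.1; omega)).pow (.var hx.1 (by have := hx.1; omega))))

theorem numComp_coeff (hx : NatComp k x) (hy : NatComp k y) :
    NumComp k fun T s => clipCoeff (s.int 2) (s.int 0) (s.int 1) T (x T s) (y T s) := by
  have hk := hx.1
  have h0 : NatComp k fun _ s => s.int 0 := .var hk (by omega)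
  have h1 : NatComp k fun _ s => s.int 1 := .var hk (by omega)
  have c (a : ℕ) : NatComp k fun _ _ => a := .const hk a
  refine .ite (c 2) hx (.ite (hy.add (c 1)) (h0.pow hx) (.mul (.div (.tape (hx.add (c 1)))
    (.exp (.mul (.div (.ofNat (hx.sub (c 1))) (.ofNat (c 2))) (.log (.ofNat h0)))))
    (.tape ((((c 3).add (h1.sub (c 1))).add
      (.sumRange hx fun k' hk' u hu => ?_)).add hy))) (.ofNat (c 0))) (.ofNat (c 0))
  exact .ite (.const hu.1 2) hu ((h0.mono hk').pow hu) (.const hu.1 0)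

theorem natComp_count (hx : NatComp k x) (hy : NatComp k y) (hz : NatComp k z) :
    NatComp k fun T s => clipCount (s.int 2) (s.int 0) (s.int 1) (x T s) (y T s) (z T s) := by
  refine .sumRange hx fun k' hk' u hu => ?_
  have he := (hy.mono hk').digit (natComp_codes hu.1) hu
  refine .sumRange (natComp_order he) fun k'' hk'' v hv => ?_
  exact ((natComp_rank (he.mono hk'')).digit (.var hv.1 (by have := hv.1; omega)) hv).eq
    (hz.mono (hk'.trans hk''))

theorem numComp_siteWeight (b : Background) (hx : NatComp k x) :
    NumComp k fun T s => clipSiteWeight b (s.int 2) (x T s) := by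
  have h := hx.div (.const hx.1 2)
  cases b with
  | hypercube => exact .ite hx (h.add h) (.ofNat (.const hx.1 1)) (.ofNat (.const hx.1 0))
  | sphere =>
    refine .ite hx (h.add h) (.prodRange h fun k' hk' u hu => ?_) (.ofNat (.const hx.1 0))
    exact .ofNat ((hu.add hu).add (.const hu.1 1))

theorem numComp_lengthWeight (b : Background) (hx : NatComp k x) :
    NumComp k fun T s => clipLengthWeight b (s.int 2) (s.int 0) (x T s) := by
  cases b with
  | hypercube => exact .ofNat (.const hx.1 1)
  | sphere =>
    refine .prodRange (hx.div (.const hx.1 2)) fun k' hk' u hu => ?_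
    have h0 : NatComp k' fun _ s => s.int 0 := .var hu.1 (by have := hu.1; omega)
    exact .div (.ofNat h0) (.ofNat (h0.add (hu.add hu)))

theorem numComp_moment (b : Background) (hx : NatComp k x) :
    NumComp k fun T s => clipMoment b (s.int 2) (s.int 0) (s.int 1) T (x T s) := by
  have hk := hx.1
  have h0 : NatComp k fun _ s => s.int 0 := .var hk (by omega)
  refine .sumRange ((natComp_codes hk).pow hx) fun k' hk' u hu => ?_
  refine .mul (.prodRange (hx.mono hk') fun k'' hk'' v hv => ?_)
    (.mul (numComp_lengthWeight b (.sumRange (h0.mono hk') fun k'' hk'' v hv => ?_))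
      (.prodRange (h0.mono hk') fun k'' hk'' v hv => ?_))
  · have he := (hu.mono hk'').digit (natComp_codes hv.1) hv
    exact numComp_coeff (natComp_order he) (natComp_rank he)
  · exact natComp_count (hx.mono (hk'.trans hk'')) (hu.mono hk'') hv
  · exact numComp_siteWeight b (natComp_count (hx.mono (hk'.trans hk'')) (hu.mono hk'') hv)

theorem numComp_taylor (b : Background) (hx : NatComp k x) :
    NumComp k fun T s => clipTaylor b (s.int 2) (s.int 0) (s.int 1) T (x T s) :=
  .div (numComp_moment b hx)
    (.prodRange hx fun _ _ _ hu => .ofNat (hu.add (.const hu.1 1)))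

theorem numComp_logTaylor (b : Background) (hx : NatComp k x) :
    NumComp k fun T s => clipLogTaylor b (s.int 2) (s.int 0) (s.int 1) T
      (fun j => s.num (2 * j + 1)) (x T s) :=
  .ite hx (.const hx.1 0) (.ofNat (.const hx.1 0)) (.sub (numComp_taylor b hx)
    (.div (.sumRange hx fun _ hk' _ hu =>
      .mul (.mul (.ofNat hu) (.odd hu)) (numComp_taylor b ((hx.mono hk').sub hu))) (.ofNat hx)))

/-- The exponential of the polynomial with the coefficients `A`, at the first number on the tape. -/
noncomputable def clipExpPoly (B : ℕ) (T A : ℕ → ℂ) (m : ℕ) : ℂ :=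
  Complex.exp (∑ j ∈ Finset.range (min (m + 1) (B + 1)),
    A j * ∏ _i ∈ Finset.range (min j (B + 1)), T 0)

theorem numComp_expPoly (hx : NatComp k x) :
    NumComp k fun T s => clipExpPoly (s.int 2) T (fun j => s.num (2 * j + 1)) (x T s) :=
  .exp (.sumRange (hx.add (.const hx.1 1)) fun _ _ _ hu => .mul (.odd hu)
    (.prodRange hu fun _ _ _ hv => .tape (.const hv.1 0)))

end

/-! ### The program -/

/-- Total correctness with a time bound. -/
def Triple (T : ℕ → ℂ) (I : State → Prop) (P : Program) (J : State → Prop) (C : ℕ) : Prop :=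
  ∀ s, I s → ∃ s' t, Exec T P s s' t ∧ t ≤ C ∧ J s'

section Triple
variable {T : ℕ → ℂ} {I J L : State → Prop} {P Q : Program} {C C' : ℕ}

theorem Triple.seq (h : Triple T I P J C) (h' : Triple T J Q L C') :
    Triple T I (.seq P Q) L (C + C') := fun s hs => by
  obtain ⟨s₁, t₁, e₁, ht₁, hs₁⟩ := h s hs
  obtain ⟨s₂, t₂, e₂, ht₂, hs₂⟩ := h' s₁ hs₁
  exact ⟨s₂, _, .seq e₁ e₂, add_le_add ht₁ ht₂, hs₂⟩

theorem Triple.mono (h : Triple T I P J C) (hC : C ≤ C') : Triple T I P J C' := fun s hs => by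
  obtain ⟨s₁, t₁, e₁, ht₁, hs₁⟩ := h s hs
  exact ⟨s₁, t₁, e₁, ht₁.trans hC, hs₁⟩

theorem Triple.straight (o : Op) (os : List Op)
    (h : ∀ s, I s → J ((o :: os).foldl (fun s o => o.apply T s) s)) :
    Triple T I (straight o os) J (os.length + 1) :=
  fun s hs => ⟨_, _, exec_straight T o os s, le_rfl, h s hs⟩

theorem Triple.loop {i b N : ℕ} (I : ℕ → State → Prop)
    (hI : ∀ j s, I j s → s.int i = j ∧ s.int b = N)
    (hP : ∀ j ≤ N, Triple T (I j) P (I (j + 1)) C) :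
    Triple T (I 0) (.loop (.intLe i b) P) (I (N + 1)) ((N + 1) * (C + 1) + 1) :=
  fun _ hs => exec_loop_of_invariant I hI hP hs

end Triple

theorem loop_time_le {N B C c : ℕ} (hN : N ≤ B) (hC : C ≤ (B + 2) ^ c) :
    (N + 1) * (C + 1) + 1 ≤ (B + 2) ^ (c + 3) := by
  have hc : 1 ≤ (B + 2) ^ c := Nat.one_le_pow _ _ (by omega)
  rw [pow_add]
  generalize (B + 2) ^ c = y at *
  have h₃ : 2 * B + 3 ≤ (B + 2) ^ 3 := by
    have : (B + 2) ^ 3 = B ^ 3 + 6 * B ^ 2 + 12 * B + 8 := by ring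
    omega
  nlinarith [Nat.mul_le_mul_left y h₃, Nat.mul_le_mul_left B hc,
    Nat.mul_le_mul (Nat.add_le_add_right hN 1) (Nat.add_le_add_right hC 1)]

/-- Computes the truncation degree in register `3`. -/
def degreeProgram : Program :=
  .seq (straight (.intConst 5 2) [.read 0 5, .ofInt 2 0, .div 0 2 0, .log 0 0, .intConst 5 1,
    .read 2 5, .mul 0 2 0, .intConst 3 0, .ofInt 2 3, .intConst 6 1])
    (.loop (.intLe 5 6) (.branch (.numLe 0 2) (.op (.intConst 6 0))
      (straight (.intAdd 3 3 5) [.ofInt 2 3])))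

/-- Numbers cannot be rounded to integers, so the ceiling is found by counting up until the counter,
converted to a number, reaches the target. Register `5` holds 1 and register `6` is the loop flag:
setting it to 0 falsifies the test `N[5] ≤ N[6]`. -/
theorem degreeProgram_correct (T : ℕ → ℂ) (n q : ℕ) :
    Triple T (fun s => s = initialState q n) degreeProgram
      (fun s => s.int 0 = n ∧ s.int 1 = q ∧ s.int 3 = ⌈(T 1 * Complex.log (n / T 2)).re⌉₊)
      (5 * ⌈(T 1 * Complex.log (n / T 2)).re⌉₊ + 20) := by
  set x : ℂ := T 1 * Complex.log (n / T 2)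
  set m := ⌈x.re⌉₊
  have loop : ∀ d j s, j + d = m → s.int 0 = n → s.int 1 = q → s.int 3 = j → s.int 5 = 1 →
      s.int 6 = 1 → s.num 0 = x → s.num 2 = (j : ℂ) →
      ∃ s' t, Exec T (.loop (.intLe 5 6) (.branch (.numLe 0 2) (.op (.intConst 6 0))
        (straight (.intAdd 3 3 5) [.ofInt 2 3]))) s s' t ∧ t ≤ 4 * d + 4 ∧
        s'.int 0 = n ∧ s'.int 1 = q ∧ s'.int 3 = m := by
    intro d
    induction d with
    | zero =>
      intro j s hj h0 h1 h3 h5 h6 x0 x2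
      refine ⟨_, _, .loopStep ?_ (.branchTrue ?_ (.op _ _)) (.loopDone ?_), ?_, ?_⟩
      · simp [Test.Holds, h5, h6]
      · simpa [Test.Holds, x0, x2] using Nat.ceil_le.1 (show m ≤ j by omega)
      · simp [Test.Holds, Op.apply, State.setInt, h5]
      · omega
      · simp [Op.apply, State.setInt, h0, h1, h3]; omega
    | succ d ih =>
      intro j s hj h0 h1 h3 h5 h6 x0 x2
      obtain ⟨s', t, e, ht, hs⟩ := ih (j + 1)
        (((Op.intAdd 3 3 5) :: [.ofInt 2 3]).foldl (fun s o => o.apply T s) s) (by omega)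
        (by simpa [Op.apply, State.setInt, State.setNum] using h0)
        (by simpa [Op.apply, State.setInt, State.setNum] using h1)
        (by simp [Op.apply, State.setInt, State.setNum, h3, h5])
        (by simpa [Op.apply, State.setInt, State.setNum] using h5)
        (by simpa [Op.apply, State.setInt, State.setNum] using h6)
        (by simpa [Op.apply, State.setInt, State.setNum] using x0)
        (by simp [Op.apply, State.setInt, State.setNum, h3, h5])
      refine ⟨_, _, .loopStep ?_ (.branchFalse ?_ (exec_straight T _ _ _)) e, ?_, hs⟩
      · simp [Test.Holds, h5, h6]
      · have := Nat.lt_ceil.1 (show j < m by omega)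
        simpa [Test.Holds, x0, x2] using this
      · simp only [List.length]; omega
  refine ((Triple.straight (J := fun s => s.int 0 = n ∧ s.int 1 = q ∧ s.int 3 = 0 ∧ s.int 5 = 1 ∧
    s.int 6 = 1 ∧ s.num 0 = x ∧ s.num 2 = ((0 : ℕ) : ℂ)) _ _ ?_).seq (L := fun s => s.int 0 = n ∧
      s.int 1 = q ∧ s.int 3 = m) (C' := 4 * m + 4) ?_).mono ?_
  · rintro s rfl
    simp [Op.apply, State.setInt, State.setNum, initialState, x]
  · rintro s ⟨h0, h1, h3, h5, h6, x0, x2⟩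
    exact loop m 0 s (by omega) h0 h1 h3 h5 h6 x0 x2
  · simp only [List.length]; omega

/-- Multiplies register `2` by the content of register `0`, given a nonzero number in register `0`
and its predecessor in register `9`. -/
def mulProgram : Program :=
  .seq (straight (.intConst 7 0) [.intConst 8 0, .intConst 10 1])
    (.seq (.loop (.intLe 8 9) (straight (.intAdd 7 7 2) [.intAdd 8 8 10]))
      (straight (.intConst 2 0) [.intAdd 2 2 7]))

/-- The contents of the registers during the computation of the bound in register `2`. -/
def BoundInv (n q m a b c x : ℕ) (s : State) : Prop :=
  s.int 0 = n ∧ s.int 1 = q ∧ s.int 3 = m ∧ s.int 9 = n - 1 ∧ s.int 4 = a ∧ s.int 5 = b ∧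
    s.int 6 = c ∧ s.int 2 = x

/-- A test `≤` against a bound makes one round more than the bound; hence register `9` holds `n -
1`, and `n ≥ 1` is needed to get exactly `n` additions. -/
theorem mulProgram_correct (T : ℕ → ℂ) (n q m a b c x : ℕ) (hn : 1 ≤ n) :
    Triple T (BoundInv n q m a b c x) mulProgram (BoundInv n q m a b c (n * x)) (3 * n + 6) := by
  refine ((Triple.straight _ _ ?_).seq ((Triple.loop (C := 2) (N := n - 1)
    (fun a' s => BoundInv n q m a b c x s ∧ s.int 8 = a' ∧ s.int 7 = a' * x ∧ s.int 10 = 1)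
    ?_ ?_).seq (Triple.straight _ _ ?_))).mono ?_
  · rintro s ⟨h0, h1, h3, h9, h2, h4, h5, h6⟩
    simp [BoundInv, Op.apply, State.setInt, *]
  · unfold BoundInv; tauto
  · intro a' _
    refine Triple.straight _ _ ?_
    rintro s ⟨⟨h0, h1, h3, h9, h2, h4, h5, h6⟩, h8, h7, h10⟩
    simp [BoundInv, Op.apply, State.setInt, *, add_mul]
  · rintro s ⟨⟨h0, h1, h3, h9, h2, h4, h5, h6⟩, h8, h7, h10⟩
    simp only [Nat.sub_add_cancel hn] at h7
    simp [BoundInv, Op.apply, State.setInt, *]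
  · simp only [List.length, Nat.sub_add_cancel hn]; omega

/-- Multiplies register `2` by the `(q + 1)`-st power of the content of register `0`. -/
def powProgram : Program :=
  .seq (.op (.intConst 6 0)) (.loop (.intLe 6 1) (.seq mulProgram
    (straight (.intConst 7 1) [.intAdd 6 6 7])))

theorem powProgram_correct (T : ℕ → ℂ) (n q m a b c x : ℕ) (hn : 1 ≤ n) :
    Triple T (BoundInv n q m a b c x) powProgram (BoundInv n q m a b (q + 1) (n ^ (q + 1) * x))
      (1 + ((q + 1) * (3 * n + 9) + 1)) := by
  refine Triple.seq (Triple.straight (J := BoundInv n q m a b 0 (n ^ 0 * x)) (.intConst 6 0) [] ?_)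
    (Triple.loop (fun c s => BoundInv n q m a b c (n ^ c * x) s) ?_ fun c _ =>
      (mulProgram_correct T n q m a b c (n ^ c * x) hn).seq (Triple.straight _ _ ?_))
  · rintro s ⟨h0, h1, h3, h9, h2, h4, h5, h6⟩
    simp [BoundInv, Op.apply, State.setInt, *]
  · unfold BoundInv; tauto
  · rintro s ⟨h0, h1, h3, h9, h2, h4, h5, h6⟩
    simp [BoundInv, Op.apply, State.setInt, *]
    ring

/-- Multiplies register `2` by the `(q + 1) ^ 2`-nd power of the content of register `0`. -/
def powPowProgram : Program :=
  .seq (.op (.intConst 5 0)) (.loop (.intLe 5 1) (.seq powProgram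
    (straight (.intConst 7 1) [.intAdd 5 5 7])))

/-- `powProgram` leaves `q + 1` in register `6`. Requiring this value already at the start makes it
a constant of the loop invariant. -/
theorem powPowProgram_correct (T : ℕ → ℂ) (n q m a b c x : ℕ) (hn : 1 ≤ n) (hc : c = q + 1) :
    Triple T (BoundInv n q m a b c x) powPowProgram
      (BoundInv n q m a (q + 1) c (n ^ ((q + 1) * (q + 1)) * x))
      (1 + ((q + 1) * (1 + ((q + 1) * (3 * n + 9) + 1) + 2 + 1) + 1)) := by
  subst hc
  refine Triple.seq (Triple.straight
    (J := BoundInv n q m a 0 (q + 1) (n ^ ((q + 1) * 0) * x)) (.intConst 5 0) [] ?_)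
    (Triple.loop (fun b s => BoundInv n q m a b (q + 1) (n ^ ((q + 1) * b) * x) s) ?_ fun b _ =>
      (powProgram_correct T n q m a b (q + 1) (n ^ ((q + 1) * b) * x) hn).seq
        (Triple.straight _ _ ?_))
  · rintro s ⟨h0, h1, h3, h9, h2, h4, h5, h6⟩
    simp [BoundInv, Op.apply, State.setInt, *]
  · unfold BoundInv; tauto
  · rintro s ⟨h0, h1, h3, h9, h2, h4, h5, h6⟩
    simp [BoundInv, Op.apply, State.setInt, *]
    ring

/-- Computes the bound `n ^ ((m + 1) * (q + 1) ^ 2)` in register `2`. -/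
def boundProgram : Program :=
  .seq (straight (.intConst 2 1) [.intConst 9 1, .intSub 9 0 9, .intConst 4 0, .intConst 5 0,
      .intConst 6 1, .intAdd 6 1 6])
    (.loop (.intLe 4 3) (.seq powPowProgram (straight (.intConst 7 1) [.intAdd 4 4 7])))

theorem boundProgram_correct (T : ℕ → ℂ) (n q m : ℕ) (hn : 2 ≤ n) :
    Triple T (fun s => s.int 0 = n ∧ s.int 1 = q ∧ s.int 3 = m) boundProgram
      (fun s => s.int 0 = n ∧ s.int 1 = q ∧ s.int 3 = m ∧
        s.int 2 = n ^ ((m + 1) * (q + 1) ^ 2))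
      ((n ^ ((m + 1) * (q + 1) ^ 2) + 2) ^ 21) := by
  have key : Triple T (fun s => s.int 0 = n ∧ s.int 1 = q ∧ s.int 3 = m) boundProgram
      (fun s => ∃ b, BoundInv n q m (m + 1) b (q + 1) (n ^ ((q + 1) * (q + 1) * (m + 1))) s)
      (7 + ((m + 1) * (1 + ((q + 1) * (1 + ((q + 1) * (3 * n + 9) + 1) + 2 + 1) + 1) + 2 + 1)
        + 1)) := by
    refine Triple.seq (Triple.straight (J := fun s => ∃ b,
      BoundInv n q m 0 b (q + 1) (n ^ ((q + 1) * (q + 1) * 0)) s) _ _ ?_)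
      (Triple.loop (fun a s => ∃ b,
        BoundInv n q m a b (q + 1) (n ^ ((q + 1) * (q + 1) * a)) s) ?_ fun a _ => ?_)
    · rintro s ⟨h0, h1, h3⟩
      simp [BoundInv, Op.apply, State.setInt, *]
    · unfold BoundInv
      rintro j s ⟨b, h⟩; tauto
    · rintro s ⟨b, hb⟩
      refine ((powPowProgram_correct T n q m a b (q + 1) _ (by omega) rfl).seq
        (Triple.straight _ _ ?_)) s hb
      rintro s ⟨h0, h1, h3, h9, h2, h4, h5, h6⟩
      simp [BoundInv, Op.apply, State.setInt, *]
      ring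
  intro s hs
  obtain ⟨s', t, e, ht, b, h0, h1, h3, -, -, -, -, h2⟩ := key s hs
  refine ⟨s', t, e, ht.trans ?_, h0, h1, h3, h2.trans (by ring_nf)⟩
  set B := n ^ ((m + 1) * (q + 1) ^ 2) with hB
  have hB2 : (m + 1) * (q + 1) ^ 2 ≤ B := Nat.lt_pow_self (by omega) |>.le
  have hmB : m ≤ B := by nlinarith [Nat.one_le_pow 2 (q + 1) (by omega)]
  have hqB : q ≤ B := by nlinarith
  have hnB : n ≤ B := Nat.le_self_pow (by positivity) n
  have hB1 : 1 ≤ B := Nat.one_le_pow _ _ (by omega)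
  have up (x c d : ℕ) (hx : x ≤ (B + 2) ^ c) (hd : d ≤ 8) : x + d ≤ (B + 2) ^ (c + 3) := by
    rw [pow_add]
    have : 27 ≤ (B + 2) ^ 3 := Nat.pow_le_pow_left (show 3 ≤ B + 2 by omega) 3
    have : 1 ≤ (B + 2) ^ c := Nat.one_le_pow _ _ (by omega)
    nlinarith
  -- The exponent 21 is 3 for the innermost loop plus 6 for each of the three enclosing loops: 3
  -- from `loop_time_le` and 3 from `up`.
  have h₁ : 3 * n + 8 ≤ (B + 2) ^ 3 := by
    have : (B + 2) ^ 3 = B ^ 3 + 6 * B ^ 2 + 12 * B + 8 := by ring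
    omega
  have h₂ := up _ _ 3 (loop_time_le hqB h₁) (by omega)
  have h₃ := up _ _ 3 (loop_time_le hqB h₂) (by omega)
  have h₄ := up _ _ 7 (loop_time_le hmB h₃) (by omega)
  refine le_trans (le_of_eq ?_) h₄
  ring

/-- The recursion for entry `k` reads only earlier entries, so a partially filled array serves as
well as the complete one. -/
theorem clipLogTaylor_congr (b : Background) (B n q : ℕ) (T : ℕ → ℂ) {A A' : ℕ → ℂ} {k : ℕ}
    (h : ∀ j < k, A j = A' j) : clipLogTaylor b B n q T A k = clipLogTaylor b B n q T A' k := by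
  simp only [clipLogTaylor]
  congr 3
  refine Finset.sum_congr rfl fun j hj => ?_
  rw [h j (by have := Finset.mem_range.1 hj; omega)]

theorem clipExpPoly_congr (B : ℕ) (T : ℕ → ℂ) {A A' : ℕ → ℂ} {m : ℕ}
    (h : ∀ j ≤ m, A j = A' j) : clipExpPoly B T A m = clipExpPoly B T A' m := by
  simp only [clipExpPoly]
  congr 1
  refine Finset.sum_congr rfl fun j hj => ?_
  rw [h j (by have := Finset.mem_range.1 hj; omega)]

/-- The contents of the registers after the computation of the coefficients below `j`. -/
def CoeffInv (n q B m : ℕ) (A : ℕ → ℂ) (j : ℕ) (s : State) : Prop :=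
  s.int 0 = n ∧ s.int 1 = q ∧ s.int 2 = B ∧ s.int 3 = m ∧ s.int 4 = j ∧
    ∀ i < j, s.num (2 * i + 1) = A i

/-- The odd number cells are filled in increasing order. Any sequence that solves the recursion up
to `m` is reproduced, since each round finds the earlier entries in place. -/
theorem exists_coeffProgram (b : Background) :
    ∃ (P : Program) (c : ℕ), ∀ (T : ℕ → ℂ) (n q B m : ℕ) (A : ℕ → ℂ), m ≤ B →
      (∀ k ≤ m, A k = clipLogTaylor b B n q T A k) →
      Triple T (fun s => s.int 0 = n ∧ s.int 1 = q ∧ s.int 3 = m ∧ s.int 2 = B) P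
        (CoeffInv n q B m A (m + 1)) ((B + 2) ^ c) := by
  -- At level 5 the registers `0` to `4` are protected, and the result arrives in number cell `10 =
  -- 2 * 5`.
  obtain ⟨P, c, hP⟩ := (numComp_logTaylor b (NatComp.var (k := 5) (r := 4) (by omega)
    (by omega))).2.2 5 le_rfl
  refine ⟨.seq (.op (.intConst 4 0)) (.loop (.intLe 4 3) (.seq P (straight (.intConst 5 1)
    [.intAdd 6 4 4, .intAdd 6 6 5, .store 6 10, .intAdd 4 4 5]))), c + 9,
    fun T n q B m A hm hA => ?_⟩
  refine ((Triple.straight (J := CoeffInv n q B m A 0) (.intConst 4 0) [] ?_).seq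
    (Triple.loop (C := (B + 2) ^ (c + 3)) (CoeffInv n q B m A) ?_ fun j hj => ?_)).mono ?_
  · rintro s ⟨h0, h1, h3, h2⟩
    simp [CoeffInv, Op.apply, State.setInt, *]
  · unfold CoeffInv; tauto
  · rintro s ⟨h0, h1, h2, h3, h4, hs⟩
    obtain ⟨s', t, e, ht, ag, r⟩ := hP T s
    refine ⟨_, _, .seq e (exec_straight T _ _ _), ?_, ?_⟩
    · rw [h2] at ht
      have : 1 ≤ (B + 2) ^ c := Nat.one_le_pow _ _ (by omega)
      have : 8 ≤ (B + 2) ^ 3 := Nat.pow_le_pow_left (show 2 ≤ B + 2 by omega) 3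
      rw [pow_add]
      simp only [List.length]
      nlinarith
    · have a0 := ag.1 0 (by omega)
      have a1 := ag.1 1 (by omega)
      have a2 := ag.1 2 (by omega)
      have a3 := ag.1 3 (by omega)
      have a4 := ag.1 4 (by omega)
      have ha := ag.2.2
      beta_reduce at r
      rw [h0, h1, h2, h4, clipLogTaylor_congr b B n q T hs, ← hA j hj] at r
      refine ⟨?_, ?_, ?_, ?_, ?_, fun i hi => ?_⟩
      · simp [Op.apply, State.setInt, State.setNum, *]
      · simp [Op.apply, State.setInt, State.setNum, *]
      · simp [Op.apply, State.setInt, State.setNum, *]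
      · simp [Op.apply, State.setInt, State.setNum, *]
      · simp [Op.apply, State.setInt, State.setNum, *]
      · rcases Nat.lt_succ_iff_lt_or_eq.1 hi with hi | rfl
        · simp [Op.apply, State.setInt, State.setNum, a4, h4]
          rw [Function.update_of_ne (by omega), ha, hs i hi]
        · simp [Op.apply, State.setInt, State.setNum, a4, h4]
          rw [← two_mul, Function.update_self, ← r]
  · have h := loop_time_le hm (le_refl ((B + 2) ^ (c + 3)))
    have : 8 ≤ (B + 2) ^ 3 := Nat.pow_le_pow_left (show 2 ≤ B + 2 by omega) 3
    have : 1 ≤ (B + 2) ^ (c + 3 + 3) := Nat.one_le_pow _ _ (by omega)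
    rw [show c + 9 = c + 3 + 3 + 3 by omega, pow_add _ (c + 3 + 3)]
    simp only [List.length]
    nlinarith

/-- Moves the coefficients and the exponential to their final places. -/
def outputProgram : Program :=
  .seq (straight (.intConst 5 1) [.intAdd 6 3 5, .intAdd 6 6 6, .intAdd 6 6 5, .store 6 10,
      .intConst 4 0])
    (.seq (.loop (.intLe 4 3) (straight (.intConst 5 1) [.intAdd 6 4 4, .intAdd 6 6 5, .load 0 6,
        .intAdd 4 4 5, .store 4 0]))
      (straight (.intAdd 6 4 4) [.intAdd 6 6 5, .load 0 6, .intConst 0 0, .intAdd 0 0 3]))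

/-- Coefficient `j` moves from cell `2j+1` to cell `j+1`. In increasing order this never destroys an
unread coefficient, as `j+1 < 2i+1` for `i > j`. The exponential is parked in cell `2(m+1)+1`,
beyond every cell written by the loop, and number cell `0` serves as buffer until the end. -/
theorem outputProgram_correct (T : ℕ → ℂ) (m : ℕ) (A : ℕ → ℂ) (z : ℂ) :
    Triple T (fun s => s.int 3 = m ∧ s.num 10 = z ∧ ∀ i ≤ m, s.num (2 * i + 1) = A i)
      outputProgram (fun s => s.int 0 = m ∧ (∀ k ≤ m, s.num (k + 1) = A k) ∧ s.num 0 = z)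
      (7 * m + 19) := by
  refine ((Triple.straight _ _ ?_).seq ((Triple.loop (C := 6) (N := m) (fun j s => s.int 3 = m ∧
    s.int 5 = 1 ∧ s.int 4 = j ∧ (∀ i < j, s.num (i + 1) = A i) ∧
    (∀ i, j ≤ i → i ≤ m → s.num (2 * i + 1) = A i) ∧ s.num (2 * (m + 1) + 1) = z) ?_ ?_).seq
    (Triple.straight _ _ ?_))).mono ?_
  · rintro s ⟨h3, x, hs⟩
    refine ⟨?_, ?_, ?_, by omega, fun i _ hi => ?_, ?_⟩
    · simp [Op.apply, State.setInt, State.setNum, *]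
    · simp [Op.apply, State.setInt, State.setNum, *]
    · simp [Op.apply, State.setInt, State.setNum, *]
    · simp [Op.apply, State.setInt, State.setNum, h3]
      rw [Function.update_of_ne (by omega), hs i hi]
    · simp [Op.apply, State.setInt, State.setNum, h3, x]
      rw [← two_mul, Function.update_self]
  · tauto
  · intro j hj
    refine Triple.straight _ _ ?_
    rintro s ⟨h3, h5, h4, hA, hA', hz⟩
    refine ⟨?_, ?_, ?_, fun i hi => ?_, fun i hi hi' => ?_, ?_⟩
    · simp [Op.apply, State.setInt, State.setNum, *]
    · simp [Op.apply, State.setInt, State.setNum, *]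
    · simp [Op.apply, State.setInt, State.setNum, *]
    · rcases Nat.lt_succ_iff_lt_or_eq.1 hi with hi | rfl
      · simp [Op.apply, State.setInt, State.setNum, h4]
        rw [Function.update_of_ne (by omega), Function.update_of_ne (by omega), hA i hi]
      · simp [Op.apply, State.setInt, State.setNum, h4]
        rw [← two_mul, hA' i le_rfl hj]
    · simp [Op.apply, State.setInt, State.setNum, h4]
      rw [Function.update_of_ne (by omega), Function.update_of_ne (by omega), hA' i (by omega) hi']
    · simp [Op.apply, State.setInt, State.setNum, h4]
      rw [Function.update_of_ne (by omega)]
      exact hz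
  · rintro s ⟨h3, h5, h4, hA, hA', hz⟩
    refine ⟨?_, fun k hk => ?_, ?_⟩
    · simp [Op.apply, State.setInt, State.setNum, *]
    · simp [Op.apply, State.setInt, State.setNum]
      exact hA k (by omega)
    · simp [Op.apply, State.setInt, State.setNum, h4, h5]
      rw [← hz]; congr 1; omega
  · simp only [List.length]; omega

/-- The coefficients enter only as a solution `A` of the clipped recursion, which separates the
behaviour of the machine from the model. -/
theorem exists_program (b : Background) :
    ∃ (P : Program) (c : ℕ), ∀ (T : ℕ → ℂ) (n q m B : ℕ) (A : ℕ → ℂ), 2 ≤ n →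
      m = ⌈(T 1 * Complex.log (n / T 2)).re⌉₊ → B = n ^ ((m + 1) * (q + 1) ^ 2) →
      (∀ k ≤ m, A k = clipLogTaylor b B n q T A k) →
      ∃ s t, Exec T P (initialState q n) s t ∧ t ≤ (B + 2) ^ c ∧ s.int 0 = m ∧
        (∀ k ≤ m, s.num (k + 1) = A k) ∧ s.num 0 = clipExpPoly B T A m := by
  obtain ⟨P₁, c₁, h₁⟩ := exists_coeffProgram b
  obtain ⟨P₂, c₂, h₂⟩ := (numComp_expPoly (NatComp.var (k := 5) (r := 3) (by omega)
    (by omega))).2.2 5 le_rfl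
  refine ⟨.seq degreeProgram (.seq boundProgram (.seq P₁ (.seq P₂ outputProgram))),
    (5 + (21 + (c₁ + (c₂ + 5 + 1) + 1) + 1) + 1), fun T n q m B A hn hm hB hA => ?_⟩
  have hmB : m ≤ B := by
    have h : (m + 1) * (q + 1) ^ 2 < B := hB ▸ Nat.lt_pow_self (by omega)
    nlinarith [Nat.one_le_pow 2 (q + 1) (by omega)]
  have h₂' : Triple T (CoeffInv n q B m A (m + 1)) P₂ (fun s => s.int 3 = m ∧
      s.num 10 = clipExpPoly B T A m ∧ ∀ i ≤ m, s.num (2 * i + 1) = A i) ((B + 2) ^ c₂) := by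
    rintro s ⟨h0, h1, h2, h3, h4, hs⟩
    obtain ⟨s', t, e, ht, ag, r⟩ := h₂ T s
    refine ⟨s', t, e, h2 ▸ ht, by rw [ag.1 3 (by omega), h3], ?_, fun i hi => ?_⟩
    · beta_reduce at r
      rw [h2, h3, clipExpPoly_congr B T fun j hj => hs j (by omega)] at r
      exact r
    · rw [ag.2.2, hs i (by omega)]
  have e := hm ▸ degreeProgram_correct T n q
  have e' := boundProgram_correct T n q m hn
  rw [← hB] at e'
  have h := e.seq (e'.seq (((h₁ T n q B m A hmB hA).seq (h₂'.seq (outputProgram_correct T m A _)))))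
  obtain ⟨s, t, e, ht, hs⟩ := h _ rfl
  refine ⟨s, t, e, ht.trans ?_, hs⟩
  have add {x y c d : ℕ} (hx : x ≤ (B + 2) ^ c) (hy : y ≤ (B + 2) ^ d) :
      x + y ≤ (B + 2) ^ (c + d + 1) :=
    (add_le_add hx hy).trans (pow_add_pow_le_pow (by omega) _ _)
  have h5 : 7 * m + 20 ≤ (B + 2) ^ 5 := by
    have : (B + 2) ^ 5 = B ^ 5 + 10 * B ^ 4 + 40 * B ^ 3 + 80 * B ^ 2 + 80 * B + 32 := by ring
    omega
  refine add (le_trans ?_ h5) (add le_rfl (add le_rfl (add le_rfl (le_trans ?_ h5)))) <;> omega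

open MeasureTheory ProbabilityTheory

/-! ### The background measures -/

section hypercube

variable {n : ℕ}

theorem setOf_sign_eq :
    {σ : Fin n → ℝ | ∀ i, σ i = 1 ∨ σ i = -1} =
      ↑(Fintype.piFinset fun _ : Fin n => ({1, -1} : Finset ℝ)) := by
  ext σ; simp

theorem card_signs : (Fintype.piFinset fun _ : Fin n => ({1, -1} : Finset ℝ)).card = 2 ^ n := by
  rw [Fintype.card_piFinset]
  simp [Finset.card_pair (show (1 : ℝ) ≠ -1 by norm_num)]

theorem integral_hypercube {E : Type*} [NormedAddCommGroup E] [NormedSpace ℝ E] [CompleteSpace E]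
    (f : (Fin n → ℝ) → E) :
    ∫ σ, f σ ∂(Background.hypercube.measure n) =
      (2 ^ n : ℝ)⁻¹ • ∑ σ ∈ Fintype.piFinset fun _ : Fin n => ({1, -1} : Finset ℝ), f σ := by
  rw [Background.measure, setOf_sign_eq, uniformOn, ProbabilityTheory.cond, integral_smul_measure,
    Measure.count_apply_finset, card_signs]
  have key (s : Finset (Fin n → ℝ)) : IntegrableOn f s Measure.count := by
    rw [← (s : Set (Fin n → ℝ)).biUnion_of_singleton]
    exact integrableOn_finset_iUnion.2 fun _ _ => integrableOn_singleton (by simp) (by simp)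
  rw [setIntegral_finset _ (key _)]
  simp [Measure.real]

theorem isProbabilityMeasure_hypercube :
    IsProbabilityMeasure (Background.hypercube.measure n) := by
  rw [Background.measure, setOf_sign_eq]
  refine isProbabilityMeasure_uniformOn (Finset.finite_toSet _) ⟨fun _ => 1, by simp⟩

theorem ae_hypercube : ∀ᵐ σ ∂(Background.hypercube.measure n), ∀ i, σ i = 1 ∨ σ i = -1 := by
  rw [Background.measure, uniformOn]
  have h : MeasurableSet {σ : Fin n → ℝ | ∀ i, σ i = 1 ∨ σ i = -1} :=
    setOf_sign_eq (n := n) ▸ Finset.measurableSet _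
  exact ae_cond_mem h

theorem integral_hypercube_prod (f : Fin n → ℝ → ℝ) :
    ∫ σ, ∏ i, f i (σ i) ∂(Background.hypercube.measure n) =
      ∏ i, ((f i 1 + f i (-1)) / 2) := by
  rw [integral_hypercube, ← Finset.prod_univ_sum, Finset.prod_div_distrib]
  simp [Finset.sum_pair (show (1 : ℝ) ≠ -1 by norm_num)]
  ring

end hypercube

section sphere

variable {n : ℕ}

theorem measurable_sphere_embedding :
    Measurable (fun (x : Metric.sphere (0 : EuclideanSpace ℝ (Fin n)) 1) (i : Fin n) =>
      √(n : ℝ) * (x : EuclideanSpace ℝ (Fin n)) i) := by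
  fun_prop

theorem toSphere_univ_ne_zero (hn : 1 ≤ n) :
    (volume : Measure (EuclideanSpace ℝ (Fin n))).toSphere Set.univ ≠ 0 := by
  rw [Measure.measure_univ_ne_zero, Ne, Measure.toSphere_eq_zero_iff_finrank, finrank_euclideanSpace_fin]
  omega

theorem isProbabilityMeasure_sphere (hn : 1 ≤ n) :
    IsProbabilityMeasure (Background.sphere.measure n) := by
  have := cond_isProbabilityMeasure (toSphere_univ_ne_zero hn)
  exact Measure.isProbabilityMeasure_map measurable_sphere_embedding.aemeasurable

theorem ae_sphere : ∀ᵐ σ ∂(Background.sphere.measure n), ∑ i, σ i ^ 2 = (n : ℝ) := by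
  rw [Background.measure, ae_map_iff measurable_sphere_embedding.aemeasurable
    (measurableSet_eq_fun (by fun_prop) (by fun_prop))]
  refine Filter.Eventually.of_forall fun x => ?_
  have hx : ‖(x : EuclideanSpace ℝ (Fin n))‖ = 1 := by simp
  rw [EuclideanSpace.norm_eq, Real.sqrt_eq_one] at hx
  simp only [Real.norm_eq_abs, sq_abs] at hx
  simp only [mul_pow, ← Finset.mul_sum, hx]
  rw [Real.sq_sqrt (by positivity), mul_one]

theorem integral_sphere (f : (Fin n → ℝ) → ℝ) (hf : Continuous f) :
    ∫ σ, f σ ∂(Background.sphere.measure n) =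
      ((volume : Measure (EuclideanSpace ℝ (Fin n))).toSphere.real Set.univ)⁻¹ *
        ∫ x : Metric.sphere (0 : EuclideanSpace ℝ (Fin n)) 1,
          f (fun i => √(n : ℝ) * (x : EuclideanSpace ℝ (Fin n)) i)
            ∂(volume : Measure (EuclideanSpace ℝ (Fin n))).toSphere := by
  rw [Background.measure, integral_map measurable_sphere_embedding.aemeasurable
    hf.aestronglyMeasurable, ProbabilityTheory.cond, integral_smul_measure]
  simp [Measure.real]

end sphere

theorem isProbabilityMeasure_background (b : Background) {n : ℕ} (hn : 1 ≤ n) :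
    IsProbabilityMeasure (b.measure n) := by
  cases b with
  | hypercube => exact isProbabilityMeasure_hypercube
  | sphere => exact isProbabilityMeasure_sphere hn

theorem ae_background (b : Background) (n : ℕ) : ∀ᵐ σ ∂(b.measure n), ∑ i, σ i ^ 2 = (n : ℝ) := by
  cases b with
  | hypercube =>
    filter_upwards [ae_hypercube] with σ hσ
    have : ∀ i, σ i ^ 2 = 1 := fun i => by rcases hσ i with h | h <;> simp [h]
    simp [this]
  | sphere => exact ae_sphere

/-! ### Moments of the background measures -/

/-- The moments of a Rademacher variable, resp. of a standard Gaussian variable. -/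
noncomputable def siteMoment (b : Background) (c : ℕ) : ℝ :=
  match b with
  | .hypercube => if Even c then 1 else 0
  | .sphere => if Even c then ∏ j ∈ Finset.range (c / 2), (2 * j + 1 : ℝ) else 0

/-- The ratio between the moments of degree `d` of the background measure and those of the product
measure. -/
noncomputable def lengthFactor (b : Background) (n d : ℕ) : ℝ :=
  match b with
  | .hypercube => 1
  | .sphere => ∏ j ∈ Finset.range (d / 2), (n / (n + 2 * j) : ℝ)

/-- The moments of the half-normal distribution, up to normalisation. -/
noncomputable def halfMoment (a : ℕ) : ℝ := ∫ x in Set.Ioi (0 : ℝ), x ^ a * Real.exp (-(x ^ 2 / 2))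

theorem halfMoment_eq (a : ℕ) : halfMoment a =
    (1 / 2 : ℝ) ^ (-((a : ℝ) + 1) / 2) * (1 / 2) * Real.Gamma (((a : ℝ) + 1) / 2) := by
  rw [← integral_rpow_mul_exp_neg_mul_rpow (by norm_num) (by linarith [a.cast_nonneg (α := ℝ)])
    (by norm_num), halfMoment]
  refine integral_congr_ae (Filter.Eventually.of_forall fun x => ?_)
  simp only [Real.rpow_natCast, Real.rpow_ofNat]
  ring_nf

theorem halfMoment_pos (a : ℕ) : 0 < halfMoment a := by
  rw [halfMoment_eq]
  have := Real.Gamma_pos_of_pos (s := ((a : ℝ) + 1) / 2) (by positivity)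
  positivity

theorem halfMoment_add_two (a : ℕ) : halfMoment (a + 2) = (a + 1) * halfMoment a := by
  rw [halfMoment_eq, halfMoment_eq]
  rw [show (((a + 2 : ℕ) : ℝ) + 1) / 2 = ((a : ℝ) + 1) / 2 + 1 by push_cast; ring,
    Real.Gamma_add_one (by positivity),
    show -(((a + 2 : ℕ) : ℝ) + 1) / 2 = -((a : ℝ) + 1) / 2 + (-1) by push_cast; ring,
    Real.rpow_add (by norm_num), Real.rpow_neg_one]
  ring

theorem halfMoment_add_two_mul (a k : ℕ) :
    halfMoment (a + 2 * k) = (∏ j ∈ Finset.range k, ((a : ℝ) + 1 + 2 * j)) * halfMoment a := by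
  induction k with
  | zero => simp
  | succ k ih =>
    rw [show a + 2 * (k + 1) = a + 2 * k + 2 by ring, halfMoment_add_two, ih,
      Finset.prod_range_succ]
    push_cast; ring

theorem integral_pow_mul_exp (c : ℕ) :
    ∫ x : ℝ, x ^ c * Real.exp (-(x ^ 2 / 2)) =
      siteMoment .sphere c * ∫ x : ℝ, Real.exp (-(x ^ 2 / 2)) := by
  have even (k : ℕ) : ∫ x : ℝ, x ^ (2 * k) * Real.exp (-(x ^ 2 / 2)) = 2 * halfMoment (2 * k) := by
    rw [halfMoment, ← integral_comp_abs]
    simp [pow_mul]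
  rcases Nat.even_or_odd' c with ⟨k, rfl | rfl⟩
  · have h0 := even 0
    simp only [mul_zero, pow_zero, one_mul] at h0
    have h := halfMoment_add_two_mul 0 k
    rw [even, h0, siteMoment]
    simp only [zero_add] at h
    simp [h]
    have : ∏ x ∈ Finset.range k, (1 + 2 * (x : ℝ)) = ∏ j ∈ Finset.range k, (2 * (j : ℝ) + 1) :=
      Finset.prod_congr rfl fun j _ => by ring
    rw [this]; ring
  · have hodd : ¬ Even (2 * k + 1) := by simp
    simp only [siteMoment, hodd, if_false, zero_mul]
    have h := integral_neg_eq_self (fun x : ℝ => x ^ (2 * k + 1) * Real.exp (-(x ^ 2 / 2))) volume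
    simp only [(Nat.not_even_iff_odd.1 hodd).neg_pow, neg_sq, neg_mul, integral_neg] at h
    linarith

/-- The Gaussian integral of a monomial, computed twice. By Fubini it is a product of
one-dimensional integrals; in polar coordinates it is the spherical integral of the monomial times a
radial integral, which is a `halfMoment`. -/
theorem integral_toSphere_mul_halfMoment {n : ℕ} (hn : 1 ≤ n) (c : Fin n → ℕ) :
    (∫ x : Metric.sphere (0 : EuclideanSpace ℝ (Fin n)) 1,
        ∏ i, (x : EuclideanSpace ℝ (Fin n)) i ^ c i
        ∂(volume : Measure (EuclideanSpace ℝ (Fin n))).toSphere) *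
      halfMoment (n - 1 + ∑ i, c i) =
    (∏ i, siteMoment .sphere (c i)) * ∏ _i : Fin n, ∫ x : ℝ, Real.exp (-(x ^ 2 / 2)) := by
  have : NeZero n := ⟨by omega⟩
  rw [← Finset.prod_mul_distrib]
  simp_rw [← integral_pow_mul_exp]
  rw [← integral_fintype_prod_volume_eq_prod (fun i (x : ℝ) => x ^ c i * Real.exp (-(x ^ 2 / 2)))]
  set F : EuclideanSpace ℝ (Fin n) → ℝ := fun x => ∏ i, (x i ^ c i * Real.exp (-(x i ^ 2 / 2)))
    with hF
  have h₁ := (PiLp.volume_preserving_toLp (Fin n)).integral_comp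
    (MeasurableEquiv.toLp 2 (Fin n → ℝ)).measurableEmbedding F
  simp only [hF] at h₁
  rw [h₁]
  have h₂ := (volume : Measure (EuclideanSpace ℝ (Fin n))).measurePreserving_homeomorphUnitSphereProd
  have h₃ := h₂.integral_comp (Homeomorph.measurableEmbedding _)
    (fun p => F (p.2.1 • (p.1 : EuclideanSpace ℝ (Fin n))))
  have h₄ : ∀ x : ({0}ᶜ : Set (EuclideanSpace ℝ (Fin n))),
      F ((homeomorphUnitSphereProd (EuclideanSpace ℝ (Fin n)) x).2.1 •
        ((homeomorphUnitSphereProd (EuclideanSpace ℝ (Fin n)) x).1 : EuclideanSpace ℝ (Fin n))) =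
      F x := by
    intro x
    congr 1
    exact congrArg Subtype.val
      ((homeomorphUnitSphereProd (EuclideanSpace ℝ (Fin n))).symm_apply_apply x)
  simp only [h₄] at h₃
  -- The origin, which polar coordinates omit, is a null set.
  rw [integral_subtype_comap (measurableSet_singleton _).compl F, restrict_compl_singleton] at h₃
  change _ = ∫ x, F x
  rw [h₃]
  have h₅ : ∀ p : Metric.sphere (0 : EuclideanSpace ℝ (Fin n)) 1 × Set.Ioi (0 : ℝ),
      F (p.2.1 • (p.1 : EuclideanSpace ℝ (Fin n))) =
        (∏ i, (p.1 : EuclideanSpace ℝ (Fin n)) i ^ c i) *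
          (p.2.1 ^ (∑ i, c i) * Real.exp (-(p.2.1 ^ 2 / 2))) := by
    rintro ⟨x, r⟩
    have hx : ‖(x : EuclideanSpace ℝ (Fin n))‖ = 1 := by simp
    rw [EuclideanSpace.norm_eq, Real.sqrt_eq_one] at hx
    simp only [Real.norm_eq_abs, sq_abs] at hx
    simp only [hF, PiLp.smul_apply, smul_eq_mul, Finset.prod_mul_distrib, mul_pow, ← Real.exp_sum,
      Finset.prod_pow_eq_pow_sum]
    rw [Finset.sum_neg_distrib, ← Finset.sum_div, ← Finset.mul_sum, hx]
    ring_nf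
  simp only [h₅]
  rw [integral_prod_mul (fun x : Metric.sphere (0 : EuclideanSpace ℝ (Fin n)) 1 =>
    ∏ i, (x : EuclideanSpace ℝ (Fin n)) i ^ c i)
    (fun r : Set.Ioi (0 : ℝ) => r.1 ^ (∑ i, c i) * Real.exp (-(r.1 ^ 2 / 2)))]
  congr 1
  -- The radial measure has density r^(n-1); together with the degree of the monomial this gives the
  -- exponent in `halfMoment`.
  simp only [Measure.volumeIoiPow, ENNReal.ofReal, finrank_euclideanSpace_fin]
  rw [integral_withDensity_eq_integral_smul (measurable_subtype_coe.pow_const _).real_toNNReal,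
    integral_subtype_comap measurableSet_Ioi fun a : ℝ => Real.toNNReal (a ^ (n - 1)) •
      (a ^ (∑ i, c i) * Real.exp (-(a ^ 2 / 2))), halfMoment]
  refine setIntegral_congr_fun measurableSet_Ioi fun x hx => ?_
  simp only [NNReal.smul_def, Real.coe_toNNReal _ (pow_nonneg (le_of_lt hx) _), pow_add, smul_eq_mul]
  ring

/-- On the sphere, dividing the polar identity for `c` by that for `c = 0` removes the Gaussian
constants. The radius √n contributes n^(d/2) and the ratio of half moments ∏ (n + 2j), whose
quotient is `lengthFactor`. If some exponent is odd, a Gaussian moment vanishes and positivity of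
`halfMoment` forces the spherical integral to vanish as well. -/
theorem integral_background_prod_pow (b : Background) {n : ℕ} (hn : 1 ≤ n) (c : Fin n → ℕ) :
    ∫ σ, ∏ i, σ i ^ c i ∂(b.measure n) =
      lengthFactor b n (∑ i, c i) * ∏ i, siteMoment b (c i) := by
  cases b with
  | hypercube =>
    rw [integral_hypercube_prod (fun i x => x ^ c i), lengthFactor, one_mul]
    refine Finset.prod_congr rfl fun i _ => ?_
    rw [siteMoment]
    split_ifs with h
    · simp [h.neg_pow]
    · simp [(Nat.not_even_iff_odd.1 h).neg_pow]
  | sphere =>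
    rw [integral_sphere _ (by fun_prop)]
    simp only [mul_pow, Finset.prod_mul_distrib, Finset.prod_pow_eq_pow_sum]
    rw [integral_const_mul]
    have h₀ := integral_toSphere_mul_halfMoment hn (fun _ => 0)
    have h₁ := integral_toSphere_mul_halfMoment hn c
    set I := ∏ _i : Fin n, ∫ x : ℝ, Real.exp (-(x ^ 2 / 2)) with hI
    simp [siteMoment, -Measure.toSphere_real_apply_univ] at h₀
    by_cases he : ∀ i, Even (c i)
    · obtain ⟨k, hk⟩ : ∃ k, ∑ i, c i = 2 * k := by
        obtain ⟨k, hk⟩ := Finset.even_sum (s := Finset.univ) c (fun i _ => he i)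
        exact ⟨k, by omega⟩
      rw [hk, halfMoment_add_two_mul] at h₁
      have hn' : ((n - 1 : ℕ) : ℝ) + 1 = n := by
        rw [Nat.cast_sub hn]; simp
      rw [hn'] at h₁
      have hpos := halfMoment_pos (n - 1)
      have hV : (volume : Measure (EuclideanSpace ℝ (Fin n))).toSphere.real Set.univ ≠ 0 :=
        ENNReal.toReal_ne_zero.2 ⟨toSphere_univ_ne_zero hn, measure_ne_top _ _⟩
      have hP : (∏ j ∈ Finset.range k, ((n : ℝ) + 2 * j)) ≠ 0 :=
        Finset.prod_ne_zero_iff.2 fun j _ => by positivity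
      rw [hk, pow_mul, Real.sq_sqrt (by positivity), lengthFactor]
      simp only [Nat.mul_div_cancel_left k two_pos, Finset.prod_div_distrib, Finset.prod_const,
        Finset.card_range]
      rw [← h₀] at h₁
      have h₂ := mul_right_cancel₀ hpos.ne' (((mul_assoc _ _ _).trans h₁).trans
        (mul_assoc _ _ _).symm)
      field_simp
      linear_combination h₂
    · push Not at he
      obtain ⟨i, hi⟩ := he
      have h0 : ∏ i, siteMoment .sphere (c i) = 0 :=
        Finset.prod_eq_zero (Finset.mem_univ i) (by simp [siteMoment, hi])
      rw [h0, zero_mul] at h₁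
      rw [h0, (mul_eq_zero.1 h₁).resolve_right (halfMoment_pos _).ne']
      simp

/-! ### Taylor coefficients of the logarithm -/

/-- The recursion between the Taylor coefficients of `f` and of `log f`. -/
theorem taylorCoeff_log_recursion {f : ℂ → ℂ} (hf : AnalyticAt ℂ f 0) (h0 : f 0 = 1) (k : ℕ) :
    ((k + 1 : ℕ) : ℂ) * (iteratedDeriv (k + 1) f 0 / ((k + 1).factorial : ℂ)) =
      ∑ j ∈ Finset.range (k + 1), ((j + 1 : ℕ) : ℂ) *
        (iteratedDeriv (j + 1) (fun z => Complex.log (f z)) 0 / ((j + 1).factorial : ℂ)) *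
          (iteratedDeriv (k - j) f 0 / ((k - j).factorial : ℂ)) := by
  set L : ℂ → ℂ := fun z => Complex.log (f z) with hL
  have hslit : ∀ᶠ z in 𝓝 (0 : ℂ), f z ∈ Complex.slitPlane :=
    hf.continuousAt.eventually_mem (Complex.isOpen_slitPlane.mem_nhds (by simp [h0]))
  have hLa : AnalyticAt ℂ L 0 := hf.clog (by simp [h0])
  have hderiv : deriv f =ᶠ[𝓝 0] deriv L * f := by
    filter_upwards [hslit, hf.eventually_analyticAt] with z hz hfz
    have h := (hfz.differentiableAt.hasDerivAt.clog hz).deriv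
    have hne : f z ≠ 0 := Complex.slitPlane_ne_zero hz
    change deriv f z = deriv L z * f z
    rw [show deriv L z = deriv f z / f z from h, div_mul_cancel₀ _ hne]
  -- Leibniz rule for the `k`-th derivative of f' = (log f)' f.
  rw [iteratedDeriv_succ', hderiv.iteratedDeriv_eq k,
    iteratedDeriv_mul hLa.deriv.contDiffAt hf.contDiffAt, Nat.factorial_succ, Finset.sum_div,
    Finset.mul_sum]
  refine Finset.sum_congr rfl fun j hj => ?_
  have hjk : j ≤ k := Nat.lt_succ_iff.1 (Finset.mem_range.1 hj)
  rw [← iteratedDeriv_succ', Nat.cast_choose ℂ hjk, Nat.factorial_succ j]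
  have h₁ : ((k.factorial : ℕ) : ℂ) ≠ 0 := by exact_mod_cast k.factorial_ne_zero
  have h₂ : ((j.factorial : ℕ) : ℂ) ≠ 0 := by exact_mod_cast j.factorial_ne_zero
  have h₃ : (((k - j).factorial : ℕ) : ℂ) ≠ 0 := by exact_mod_cast (k - j).factorial_ne_zero
  have h₄ : ((k + 1 : ℕ) : ℂ) ≠ 0 := by exact_mod_cast k.succ_ne_zero
  have h₅ : ((j + 1 : ℕ) : ℂ) ≠ 0 := by exact_mod_cast j.succ_ne_zero
  push_cast at h₄ h₅ ⊢
  field_simp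

/-! ### The partition function as a complex moment generating function -/

/-- Makes analyticity of `Z` and the formula for its derivatives instances of general facts on
moment generating functions. -/
theorem partitionFunction_eq_complexMGF (b : Background) {pmax n : ℕ} (γ : ℕ → ℝ)
    (G : Couplings pmax n) :
    partitionFunction b γ G = complexMGF (hamiltonian γ G) (b.measure n) := rfl

theorem continuous_hamiltonian {pmax n : ℕ} (γ : ℕ → ℝ) (G : Couplings pmax n) :
    Continuous (hamiltonian γ G) := by
  unfold hamiltonian; fun_prop

theorem abs_le_of_sum_sq {n : ℕ} {σ : Fin n → ℝ} (h : ∑ i, σ i ^ 2 = (n : ℝ)) (i : Fin n) :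
    |σ i| ≤ n := by
  have h₁ : σ i ^ 2 ≤ n :=
    h ▸ Finset.single_le_sum (f := fun i => σ i ^ 2) (fun _ _ => sq_nonneg _) (Finset.mem_univ i)
  have h₂ : (1 : ℝ) ≤ n := by exact_mod_cast (i.pos)
  exact abs_le_of_sq_le_sq (by nlinarith) (by positivity)

/-- The total size of the coefficients of the Hamiltonian. -/
theorem exists_abs_hamiltonian_le {pmax n : ℕ} (γ : ℕ → ℝ) :
    ∃ C : ℝ, 0 ≤ C ∧ ∀ (G : Couplings pmax n) (σ : Fin n → ℝ), ∑ i, σ i ^ 2 = (n : ℝ) →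
      |hamiltonian γ G σ| ≤ C * ∑ e, |G e| := by
  refine ⟨(∑ p : Finset.Icc 2 pmax, |γ p / (n : ℝ) ^ ((((p : ℕ) : ℝ) - 1) / 2)|) * (n : ℝ) ^ pmax *
    1, by positivity, fun G σ hσ => ?_⟩
  have hmono (p : Finset.Icc 2 pmax) (i : Fin (p : ℕ) → Fin n) :
      |∏ j, σ (i j)| ≤ (n : ℝ) ^ pmax := by
    have h2 := Finset.mem_Icc.1 p.2
    have hn : (1 : ℝ) ≤ n := by exact_mod_cast (i ⟨0, by omega⟩).pos
    rw [Finset.abs_prod]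
    calc ∏ j, |σ (i j)| ≤ ∏ _j : Fin (p : ℕ), (n : ℝ) :=
          Finset.prod_le_prod (fun _ _ => abs_nonneg _) fun j _ => abs_le_of_sum_sq hσ _
      _ = (n : ℝ) ^ (p : ℕ) := by simp
      _ ≤ _ := pow_le_pow_right₀ hn h2.2
  rw [hamiltonian, mul_one, mul_assoc, Finset.sum_mul]
  refine (Finset.abs_sum_le_sum_abs _ _).trans (Finset.sum_le_sum fun p _ => ?_)
  rw [abs_mul]
  refine mul_le_mul_of_nonneg_left ?_ (abs_nonneg _)
  rw [Fintype.sum_sigma, Finset.mul_sum]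
  refine (Finset.abs_sum_le_sum_abs _ _).trans ?_
  refine le_trans ?_ (Finset.single_le_sum
    (f := fun p : Finset.Icc 2 pmax => (n : ℝ) ^ pmax * ∑ i : Fin (p : ℕ) → Fin n, |G ⟨p, i⟩|)
    (fun p _ => by positivity) (Finset.mem_univ p))
  rw [Finset.mul_sum]
  refine Finset.sum_le_sum fun i _ => ?_
  rw [abs_mul, mul_comm]
  exact mul_le_mul_of_nonneg_right (hmono p i) (abs_nonneg _)

/-- For fixed couplings the Hamiltonian is bounded on the support of the background measure, so
every exponential moment exists and `Z` is entire. -/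
theorem integrableExpSet_hamiltonian (b : Background) {pmax n : ℕ} (hn : 1 ≤ n) (γ : ℕ → ℝ)
    (G : Couplings pmax n) : integrableExpSet (hamiltonian γ G) (b.measure n) = Set.univ := by
  have := isProbabilityMeasure_background b hn
  obtain ⟨C, -, hC⟩ := exists_abs_hamiltonian_le (pmax := pmax) (n := n) γ
  refine Set.eq_univ_of_forall fun t => ?_
  refine Integrable.of_bound (C := Real.exp (|t| * (C * ∑ e, |G e|)))
    (((continuous_hamiltonian γ G).const_mul t).rexp).aestronglyMeasurable ?_
  filter_upwards [ae_background b n] with σ hσ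
  rw [Real.norm_eq_abs, Real.abs_exp]
  refine Real.exp_le_exp.2 ((le_abs_self _).trans ?_)
  rw [abs_mul]
  exact mul_le_mul_of_nonneg_left (hC G σ hσ) (abs_nonneg _)

theorem analyticAt_partitionFunction (b : Background) {pmax n : ℕ} (hn : 1 ≤ n) (γ : ℕ → ℝ)
    (G : Couplings pmax n) (z : ℂ) : AnalyticAt ℂ (partitionFunction b γ G) z :=
  analyticAt_complexMGF (by simp [integrableExpSet_hamiltonian b hn])

theorem partitionFunction_zero (b : Background) {pmax n : ℕ} (hn : 1 ≤ n) (γ : ℕ → ℝ)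
    (G : Couplings pmax n) : partitionFunction b γ G 0 = 1 := by
  have := isProbabilityMeasure_background b hn
  simp [partitionFunction]

theorem iteratedDeriv_partitionFunction (b : Background) {pmax n : ℕ} (hn : 1 ≤ n) (γ : ℕ → ℝ)
    (G : Couplings pmax n) (k : ℕ) : iteratedDeriv k (partitionFunction b γ G) 0 =
      ((∫ σ, hamiltonian γ G σ ^ k ∂(b.measure n) : ℝ) : ℂ) := by
  rw [partitionFunction_eq_complexMGF, iteratedDeriv_complexMGF
    (by simp [integrableExpSet_hamiltonian b hn]), ← integral_complex_ofReal]
  simp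

/-- The recursion for the Taylor coefficients of the logarithm of the partition function. -/
theorem logTaylorCoeff_eq (b : Background) {pmax n : ℕ} (hn : 1 ≤ n) (γ : ℕ → ℝ)
    (G : Couplings pmax n) (k : ℕ) (z : ℕ → ℂ)
    (hz : ∀ j ≤ k, z j = ((∫ σ, hamiltonian γ G σ ^ j ∂(b.measure n) : ℝ) : ℂ) / j.factorial) :
    logTaylorCoeff b γ G k = if k ≤ 0 then 0 else
      z k - (∑ j ∈ Finset.range k, (j : ℂ) * logTaylorCoeff b γ G j * z (k - j)) / (k : ℂ) := by
  rcases k with _ | k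
  · simp [logTaylorCoeff, partitionFunction_zero b hn]
  have h := taylorCoeff_log_recursion (analyticAt_partitionFunction b hn γ G 0)
    (partitionFunction_zero b hn γ G) k
  simp only [iteratedDeriv_partitionFunction b hn] at h
  have hk : ((k + 1 : ℕ) : ℂ) ≠ 0 := by exact_mod_cast k.succ_ne_zero
  have h0 : z 0 = 1 := by
    have := isProbabilityMeasure_background b hn
    simp [hz 0 (by omega)]
  have hs : ∑ j ∈ Finset.range (k + 1), ((j + 1 : ℕ) : ℂ) * logTaylorCoeff b γ G (j + 1) *
      z (k - j) = ((k + 1 : ℕ) : ℂ) * z (k + 1) := by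
    rw [hz (k + 1) le_rfl, h]
    refine Finset.sum_congr rfl fun j _ => ?_
    rw [hz (k - j) (by omega)]; rfl
  -- Since `Z(0) = 1`, the last summand is (k+1) times the coefficient sought, and the identity can
  -- be solved for it.
  rw [Finset.sum_range_succ, Nat.sub_self, h0, mul_one] at hs
  rw [if_neg (by omega), Finset.sum_range_succ']
  simp only [Nat.cast_zero, zero_mul, add_zero, Nat.add_sub_add_right]
  rw [eq_sub_iff_add_eq, ← mul_right_inj' hk, mul_add, mul_div_cancel₀ _ hk, add_comm]
  exact hs

/-! ### Codes of couplings -/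

/-- The coefficient of the monomial of order `p` with site word of rank `r`. -/
noncomputable def codeCoeff {pmax n : ℕ} (γ : ℕ → ℝ) (G : Couplings pmax n) (p r : ℕ) : ℝ :=
  if h : (2 ≤ p ∧ p ≤ pmax) ∧ r < n ^ p then
    γ p / (n : ℝ) ^ (((p : ℝ) - 1) / 2) *
      G ⟨⟨p, Finset.mem_Icc.2 h.1⟩, finFunctionFinEquiv.symm ⟨r, h.2⟩⟩
  else 0

/-- The number of occurrences of the digit `i` among the last `p` digits of `r` in base `n`. -/
def digitCount (n p r i : ℕ) : ℕ := ∑ l ∈ Finset.range p, if r / n ^ l % n = i then 1 else 0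

theorem sum_range_mul_eq {M : Type*} [AddCommMonoid M] (A N : ℕ) (F : ℕ → ℕ → M) :
    ∑ e ∈ Finset.range (A * N), F (e / N) (e % N) =
      ∑ p ∈ Finset.range A, ∑ r ∈ Finset.range N, F p r := by
  induction A with
  | zero => simp
  | succ A ih =>
    rw [Nat.succ_mul, Finset.sum_range_add, ih, Finset.sum_range_succ]
    congr 1
    refine Finset.sum_congr rfl fun r hr => ?_
    have hr := Finset.mem_range.1 hr
    rw [mul_comm, Nat.mul_add_div (by omega), Nat.mul_add_mod, Nat.div_eq_of_lt hr,
      Nat.mod_eq_of_lt hr, add_zero]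

/-- Expanding a `k`-th power of a sum yields a sum over `k`-tuples of indices, and these are the
digit strings in base `E` of the numbers below `E ^ k`. -/
theorem sum_range_pow_digits {M : Type*} [CommSemiring M] (E k : ℕ) (a : ℕ → M) :
    ∑ u ∈ Finset.range (E ^ k), ∏ j ∈ Finset.range k, a (u / E ^ j % E) =
      (∑ e ∈ Finset.range E, a e) ^ k := by
  rw [Finset.sum_range fun e => a e, Fintype.sum_pow, Finset.sum_range,
    ← finFunctionFinEquiv.symm.sum_comp]
  refine Finset.sum_congr rfl fun u _ => ?_
  rw [Finset.prod_range]
  rfl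

theorem prod_digits_eq {n : ℕ} (p : ℕ) (r : Fin (n ^ p)) (σ : Fin n → ℝ) :
    ∏ j, σ ((finFunctionFinEquiv.symm r : Fin p → Fin n) j) =
      ∏ i : Fin n, σ i ^ digitCount n p r i := by
  simp only [digitCount, ← Finset.prod_pow_eq_pow_sum]
  rw [Finset.prod_comm, Finset.prod_range]
  refine Finset.prod_congr rfl fun j _ => ?_
  rw [Finset.prod_eq_single ((finFunctionFinEquiv.symm r : Fin p → Fin n) j)]
  · rw [if_pos (by rfl), pow_one]
  · intro i _ hi
    rw [if_neg, pow_zero]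
    exact fun h => hi (Fin.ext h.symm)
  · simp

/-- All orders get blocks of the common length `n ^ pmax`, so that a code splits by one division.
The superfluous codes, with order below 2 or rank at least `n ^ p`, carry coefficient zero. -/
theorem hamiltonian_eq_sum_codes {pmax n : ℕ} (hn : 1 ≤ n) (γ : ℕ → ℝ) (G : Couplings pmax n)
    (σ : Fin n → ℝ) :
    hamiltonian γ G σ = ∑ e ∈ Finset.range ((pmax + 1) * n ^ pmax),
      codeCoeff γ G (e / n ^ pmax) (e % n ^ pmax) *
        ∏ i : Fin n, σ i ^ digitCount n (e / n ^ pmax) (e % n ^ pmax) i := by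
  rw [sum_range_mul_eq (pmax + 1) (n ^ pmax)
    fun p r => codeCoeff γ G p r * ∏ i : Fin n, σ i ^ digitCount n p r i]
  have hsub : Finset.Icc 2 pmax ⊆ Finset.range (pmax + 1) := fun p hp => by
    have := Finset.mem_Icc.1 hp
    exact Finset.mem_range.2 (by omega)
  rw [← Finset.sum_subset hsub fun p hp hp' => Finset.sum_eq_zero fun r _ => by
    rw [codeCoeff, dif_neg, zero_mul]
    exact fun h => hp' (Finset.mem_Icc.2 h.1), hamiltonian, ← Finset.sum_coe_sort (Finset.Icc 2 pmax)]
  refine Finset.sum_congr rfl fun p _ => ?_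
  have hp := Finset.mem_Icc.1 p.2
  have hsub' : Finset.range (n ^ (p : ℕ)) ⊆ Finset.range (n ^ pmax) :=
    Finset.range_subset_range.2 (Nat.pow_le_pow_right hn hp.2)
  rw [← Finset.sum_subset hsub' fun r _ hr' => by
    rw [codeCoeff, dif_neg, zero_mul]
    exact fun h => hr' (Finset.mem_range.2 h.2), Finset.sum_range, Finset.mul_sum,
    ← finFunctionFinEquiv.symm.sum_comp]
  refine Finset.sum_congr rfl fun r _ => ?_
  rw [codeCoeff, dif_pos ⟨hp, r.2⟩, prod_digits_eq, mul_assoc]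

/-- The number of occurrences of the site `i` in the sequence of `k` couplings with code `u`. -/
def codeCount (n q k u i : ℕ) : ℕ :=
  ∑ j ∈ Finset.range k,
    digitCount n (u / ((q + 1) * n ^ q) ^ j % ((q + 1) * n ^ q) / n ^ q)
      (u / ((q + 1) * n ^ q) ^ j % ((q + 1) * n ^ q) % n ^ q) i

theorem integrable_background_of_continuous (b : Background) {n : ℕ} (hn : 1 ≤ n)
    {f : (Fin n → ℝ) → ℝ} (hf : Continuous f) : Integrable f (b.measure n) := by
  have := isProbabilityMeasure_background b hn
  obtain ⟨C, hC⟩ := (isCompact_univ_pi fun _ : Fin n =>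
    isCompact_Icc (a := -(n : ℝ)) (b := n)).exists_bound_of_continuousOn hf.continuousOn
  refine Integrable.of_bound (C := C) hf.aestronglyMeasurable ?_
  filter_upwards [ae_background b n] with σ hσ
  exact hC σ fun i _ => abs_le.1 (abs_le_of_sum_sq hσ i)

/-- The power is expanded into monomials in the spins. A monomial depends only on how often each
site occurs, and its moment is known in closed form. -/
theorem integral_hamiltonian_pow (b : Background) {pmax n : ℕ} (hn : 1 ≤ n) (γ : ℕ → ℝ)
    (G : Couplings pmax n) (k : ℕ) :
    ∫ σ, hamiltonian γ G σ ^ k ∂(b.measure n) =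
      ∑ u ∈ Finset.range (((pmax + 1) * n ^ pmax) ^ k),
        (∏ j ∈ Finset.range k,
          codeCoeff γ G (u / ((pmax + 1) * n ^ pmax) ^ j % ((pmax + 1) * n ^ pmax) / n ^ pmax)
            (u / ((pmax + 1) * n ^ pmax) ^ j % ((pmax + 1) * n ^ pmax) % n ^ pmax)) *
        (lengthFactor b n (∑ i ∈ Finset.range n, codeCount n pmax k u i) *
          ∏ i ∈ Finset.range n, siteMoment b (codeCount n pmax k u i)) := by
  simp only [hamiltonian_eq_sum_codes hn, ← sum_range_pow_digits, Finset.prod_mul_distrib]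
  rw [integral_finsetSum _ fun u _ => integrable_background_of_continuous b hn (by fun_prop)]
  refine Finset.sum_congr rfl fun u _ => ?_
  rw [integral_const_mul]
  congr 1
  rw [Finset.sum_range fun i => codeCount n pmax k u i,
    Finset.prod_range fun i => siteMoment b (codeCount n pmax k u i),
    ← integral_background_prod_pow b hn]
  refine integral_congr_ae (Filter.Eventually.of_forall fun σ => ?_)
  beta_reduce
  rw [Finset.prod_comm]
  simp only [Finset.prod_pow_eq_pow_sum, codeCount]

/-! ### The input tape -/

section tape
variable {pmax n : ℕ} (γ : ℕ → ℝ) (G : Couplings pmax n) (C η : ℝ) (β : ℂ)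

theorem inputTape_zero : inputTape γ G C η β 0 = β := rfl

theorem inputTape_one : inputTape γ G C η β 1 = C := rfl

theorem inputTape_two : inputTape γ G C η β 2 = η := rfl

theorem inputTape_gamma {p : ℕ} (hp : 2 ≤ p) (hp' : p ≤ pmax) :
    inputTape γ G C η β (p + 1) = γ p := by
  rw [inputTape, inputList, List.append_assoc, List.getD_append_right _ _ _ _ (by simp; omega),
    List.getD_append _ _ _ _ (by simp; omega), List.getD_eq_getElem _ _ (by simp; omega)]
  simp only [List.getElem_map, List.getElem_range', List.length_cons, List.length_nil]
  congr 2; omega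

/-- The couplings of order `p` in the order of their ranks. -/
noncomputable def couplingBlock {pmax n : ℕ} (G : Couplings pmax n) (p : ℕ) : List ℂ :=
  if h : 2 ≤ p ∧ p ≤ pmax then
    List.ofFn fun r : Fin (n ^ p) =>
      ((G ⟨⟨p, Finset.mem_Icc.2 h⟩, finFunctionFinEquiv.symm r⟩ : ℝ) : ℂ)
  else []

theorem inputList_eq : inputList γ G C η β =
    ([β, (C : ℂ), (η : ℂ)] ++ (List.range' 2 (pmax - 1)).map (fun p => (γ p : ℂ))) ++
      (List.range' 2 (pmax - 1)).flatMap (couplingBlock G) := by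
  rw [inputList]
  congr 1
  conv_rhs => rw [← List.attach_map_subtype_val (List.range' 2 (pmax - 1)), List.flatMap_map]
  congr 1
  funext p
  have hp := p.2
  rw [List.mem_range'_1] at hp
  rw [couplingBlock, dif_pos ⟨hp.1, by omega⟩]

theorem length_flatMap_couplingBlock {p : ℕ} (hp : 2 ≤ p) (hp' : p ≤ pmax) :
    ((List.range' 2 (p - 2)).flatMap (couplingBlock G)).length =
      ∑ a ∈ Finset.range p, if 2 ≤ a then n ^ a else 0 := by
  induction p, hp using Nat.le_induction with
  | base => simp [Finset.sum_range_succ]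
  | succ p hp ih =>
    rw [Finset.sum_range_succ, ← ih (by omega), show p + 1 - 2 = p - 2 + 1 by omega,
      List.range'_1_concat, List.flatMap_append, List.length_append, if_pos hp]
    congr 1
    simp [couplingBlock, show 2 + (p - 2) = p by omega, hp, show p ≤ pmax by omega]

theorem inputTape_coupling {p r : ℕ} (hp : 2 ≤ p) (hp' : p ≤ pmax) (hr : r < n ^ p) :
    inputTape γ G C η β
      (3 + (pmax - 1) + (∑ a ∈ Finset.range p, if 2 ≤ a then n ^ a else 0) + r) =
      (G ⟨⟨p, Finset.mem_Icc.2 ⟨hp, hp'⟩⟩, finFunctionFinEquiv.symm ⟨r, hr⟩⟩ : ℝ) := by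
  have hlen := length_flatMap_couplingBlock G hp hp'
  have hsplit : List.range' 2 (pmax - 1) =
      List.range' 2 (p - 2) ++ p :: List.range' (p + 1) (pmax - p) := by
    rw [← List.range'_succ, show p = 2 + (p - 2) by omega]
    simp only [Nat.add_sub_cancel_left]
    rw [List.range'_append_1]; congr 1; omega
  have hl3 : ([β, (C : ℂ), (η : ℂ)] ++
      (List.range' 2 (pmax - 1)).map (fun p => (γ p : ℂ))).length = 3 + (pmax - 1) := by
    simp; omega
  rw [inputTape, inputList_eq, add_assoc, List.getD_append_right _ _ _ _ (by omega), hl3,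
    Nat.add_sub_cancel_left, hsplit, List.flatMap_append,
    List.getD_append_right _ _ _ _ (by omega), hlen, Nat.add_sub_cancel_left, List.flatMap_cons,
    couplingBlock, dif_pos ⟨hp, hp'⟩, List.getD_append _ _ _ _ (by simpa using hr),
    List.getD_eq_getElem _ _ (by simpa using hr)]
  simp

end tape

/-! ### Correctness of the clipped computation -/

/-- `B` is large enough for the computation of the `k`-th moment. -/
structure LargeBound (n q k B : ℕ) : Prop where
  n_le : n ≤ B + 1
  q_le : q + 1 ≤ B + 1
  k_le : k ≤ B + 1
  codes_le : (q + 1) * n ^ q ≤ B + 1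
  seqs_le : ((q + 1) * n ^ q) ^ k ≤ B + 1
  length_le : n * (k * q) ≤ B + 1

section
variable {n q k B : ℕ}

theorem LargeBound.mono {k' : ℕ} (h : LargeBound n q k B) (hn : 1 ≤ n) (hk : k' ≤ k) :
    LargeBound n q k' B where
  n_le := h.n_le
  q_le := h.q_le
  k_le := hk.trans h.k_le
  codes_le := h.codes_le
  seqs_le := (Nat.pow_le_pow_right (by positivity) hk).trans h.seqs_le
  length_le := (by gcongr : n * (k' * q) ≤ n * (k * q)).trans h.length_le

theorem digitCount_le (n p r i : ℕ) : digitCount n p r i ≤ p := by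
  refine (Finset.sum_le_card_nsmul _ _ 1 fun l _ => ?_).trans (by simp)
  split_ifs <;> omega

theorem codeCount_le (hn : 1 ≤ n) (u i : ℕ) : codeCount n q k u i ≤ k * q := by
  refine (Finset.sum_le_card_nsmul _ _ q fun j _ => (digitCount_le _ _ _ _).trans ?_).trans
    (by simp)
  have hE : 0 < (q + 1) * n ^ q := by positivity
  have := Nat.div_lt_of_lt_mul ((Nat.mod_lt (u / ((q + 1) * n ^ q) ^ j) hE).trans_eq (mul_comm _ _))
  omega

theorem siteWeight_eq (b : Background) {c : ℕ} (hc : c ≤ B + 1) :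
    clipSiteWeight b B c = siteMoment b c := by
  have h₁ : c / 2 ≤ B + 1 := by omega
  -- With floor division, this comparison is the parity test available to the machine.
  have h₂ : c ≤ c / 2 + c / 2 ↔ Even c := by rw [Nat.even_iff]; omega
  cases b <;> simp only [clipSiteWeight, siteMoment, min_eq_left h₁, h₂] <;> split_ifs <;>
    simp [two_mul]

theorem lengthWeight_eq (b : Background) {d : ℕ} (hd : d ≤ B + 1) :
    clipLengthWeight b B n d = lengthFactor b n d := by
  have h₁ : d / 2 ≤ B + 1 := by omega
  cases b <;> simp only [clipLengthWeight, lengthFactor, min_eq_left h₁] <;> simp [two_mul]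

theorem clipCount_eq (h : LargeBound n q k B) (hn : 1 ≤ n) {u i : ℕ} (hu : u ≤ B + 1) :
    clipCount B n q k u i = codeCount n q k u i := by
  have hM : n ^ q ≤ B + 1 := (Nat.le_mul_of_pos_left _ (by omega)).trans h.codes_le
  have hq : q ≤ B + 1 := by have := h.q_le; omega
  simp only [clipCount, codeCount, digitCount, clipOrder, clipRank, clipCodes, min_eq_left h.k_le,
    min_eq_left h.n_le, min_eq_left h.q_le, min_eq_left hq]
  refine Finset.sum_congr rfl fun j hj => ?_
  have hj : j ≤ B + 1 := (Finset.mem_range.1 hj).le.trans h.k_le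
  rw [clipDigit_eq hu h.codes_le hj]
  set e := u / ((q + 1) * n ^ q) ^ j % ((q + 1) * n ^ q) with he
  have he1 : e ≤ B + 1 :=
    (Nat.mod_lt _ (by positivity)).le.trans h.codes_le
  have hp : e / n ^ q ≤ B + 1 := (Nat.div_le_self _ _).trans he1
  rw [min_eq_left hp, min_eq_left hp]
  have hr : e - e / n ^ q * n ^ q = e % n ^ q := by
    rw [mul_comm, ← Nat.mod_eq_sub]
  rw [hr]
  refine Finset.sum_congr rfl fun l hl => ?_
  rw [clipDigit_eq ((Nat.mod_le _ _).trans he1) h.n_le ((Finset.mem_range.1 hl).le.trans hp)]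

theorem clipCoeff_eq (h : LargeBound n q k B) (hn : 1 ≤ n) (γ : ℕ → ℝ) (G : Couplings q n)
    (C η : ℝ) (β : ℂ) {p r : ℕ} (hp : p ≤ q) :
    clipCoeff B n q (inputTape γ G C η β) p r = codeCoeff γ G p r := by
  have hpB : p ≤ B + 1 := by have := h.q_le; omega
  have h0 : ((0 : ℕ) : ℂ) = ((0 : ℝ) : ℂ) := by simp
  simp only [clipCoeff, min_eq_left h.n_le, min_eq_left hpB]
  by_cases hp2 : 2 ≤ p
  swap
  · rw [if_neg hp2, codeCoeff, dif_neg (fun h => hp2 h.1.1), h0]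
  by_cases hr : r < n ^ p
  swap
  · rw [if_pos hp2, if_neg (by omega), codeCoeff, dif_neg (fun h => hr h.2), h0]
  rw [if_pos hp2, if_pos (by omega), codeCoeff, dif_pos ⟨⟨hp2, hp⟩, hr⟩, inputTape_gamma _ _ _ _ _ hp2 hp]
  have hs : ∑ a ∈ Finset.range p, (if 2 ≤ a then n ^ min a (B + 1) else 0) =
      ∑ a ∈ Finset.range p, (if 2 ≤ a then n ^ a else 0) :=
    Finset.sum_congr rfl fun a ha => by
      rw [min_eq_left (by have := Finset.mem_range.1 ha; omega)]
  rw [hs, inputTape_coupling _ _ _ _ _ hp2 hp hr]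
  push_cast
  congr 2
  rw [Complex.ofReal_cpow (by positivity), Complex.cpow_def_of_ne_zero (by
    simp only [Complex.ofReal_natCast]; exact_mod_cast (by omega : n ≠ 0))]
  congr 1
  rw [Nat.cast_sub (by omega)]
  push_cast; ring

theorem clipMoment_eq (b : Background) (h : LargeBound n q k B) (hn : 1 ≤ n) (γ : ℕ → ℝ)
    (G : Couplings q n) (C η : ℝ) (β : ℂ) :
    clipMoment b B n q (inputTape γ G C η β) k =
      ((∫ σ, hamiltonian γ G σ ^ k ∂(b.measure n) : ℝ) : ℂ) := by
  have hq : q ≤ B + 1 := by have := h.q_le; omega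
  have hE0 : 0 < (q + 1) * n ^ q := by positivity
  rw [integral_hamiltonian_pow b hn]
  have hcodes : clipCodes B n q = (q + 1) * n ^ q := by
    simp only [clipCodes, min_eq_left h.n_le, min_eq_left h.q_le, min_eq_left hq]
  simp only [clipMoment, hcodes, min_eq_left h.codes_le, min_eq_left h.k_le,
    min_eq_left h.seqs_le, min_eq_left h.n_le]
  push_cast
  refine Finset.sum_congr rfl fun u hu => ?_
  have hu : u ≤ B + 1 := (Finset.mem_range.1 hu).le.trans h.seqs_le
  have hd : ∑ i ∈ Finset.range n, codeCount n q k u i ≤ B + 1 :=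
    ((Finset.sum_le_card_nsmul _ _ (k * q) fun i _ => codeCount_le hn u i).trans
      (by simp)).trans h.length_le
  congr 1
  · refine Finset.prod_congr rfl fun j hj => ?_
    have hj : j ≤ B + 1 := (Finset.mem_range.1 hj).le.trans h.k_le
    rw [clipDigit_eq hu h.codes_le hj]
    set e := u / ((q + 1) * n ^ q) ^ j % ((q + 1) * n ^ q) with he
    have heE : e < (q + 1) * n ^ q := Nat.mod_lt _ hE0
    have he1 : e ≤ B + 1 := heE.le.trans h.codes_le
    have hp : e / n ^ q ≤ B + 1 := (Nat.div_le_self _ _).trans he1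
    have hpq : e / n ^ q < q + 1 := Nat.div_lt_of_lt_mul (heE.trans_eq (mul_comm _ _))
    simp only [clipRank, clipOrder, min_eq_left h.n_le, min_eq_left hq, min_eq_left hp]
    have hr : e - e / n ^ q * n ^ q = e % n ^ q := by
      rw [mul_comm, ← Nat.mod_eq_sub]
    rw [hr, clipCoeff_eq h hn γ G C η β (by omega)]
  · rw [Finset.sum_congr rfl fun i _ => clipCount_eq h hn hu, lengthWeight_eq b hd]
    congr 1
    refine Finset.prod_congr rfl fun i hi => ?_
    rw [clipCount_eq h hn hu, siteWeight_eq b]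
    exact (Finset.single_le_sum (f := fun i => codeCount n q k u i) (fun _ _ => Nat.zero_le _)
      hi).trans hd

theorem clipTaylor_eq (b : Background) (h : LargeBound n q k B) (hn : 1 ≤ n) (γ : ℕ → ℝ)
    (G : Couplings q n) (C η : ℝ) (β : ℂ) :
    clipTaylor b B n q (inputTape γ G C η β) k =
      ((∫ σ, hamiltonian γ G σ ^ k ∂(b.measure n) : ℝ) : ℂ) / k.factorial := by
  rw [clipTaylor, clipMoment_eq b h hn, min_eq_left h.k_le, ← Finset.prod_range_add_one_eq_factorial]
  push_cast; rfl

/-- The true coefficients solve the clipped recursion, which is what `exists_program` asks of its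
array. -/
theorem clipLogTaylor_eq (b : Background) (h : LargeBound n q k B) (hn : 1 ≤ n) (γ : ℕ → ℝ)
    (G : Couplings q n) (C η : ℝ) (β : ℂ) :
    clipLogTaylor b B n q (inputTape γ G C η β) (logTaylorCoeff b γ G) k =
      logTaylorCoeff b γ G k := by
  rw [logTaylorCoeff_eq b hn γ G k (clipTaylor b B n q (inputTape γ G C η β))
    fun j hj => clipTaylor_eq b (h.mono hn hj) hn γ G C η β, clipLogTaylor, min_eq_left h.k_le]
  simp

theorem clipExpPoly_eq (b : Background) {m : ℕ} (hm : m + 1 ≤ B + 1) (γ : ℕ → ℝ)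
    (G : Couplings q n) (C η : ℝ) (β : ℂ) :
    clipExpPoly B (inputTape γ G C η β) (logTaylorCoeff b γ G) m =
      Complex.exp (logTaylorPoly b γ G m β) := by
  rw [clipExpPoly, logTaylorPoly, min_eq_left hm, inputTape_zero]
  congr 1
  refine Finset.sum_congr rfl fun j hj => ?_
  rw [min_eq_left ((Finset.mem_range.1 hj).le.trans hm)]
  simp

/-- As `n ≥ 2`, one has q + 1 ≤ n^q, so the number of codes is at most n^(2q) and that of `k`-tuples
at most n^(2qk). The exponent (m+1)(q+1)² exceeds all exponents that occur. -/
theorem largeBound_pow {m : ℕ} (hn : 2 ≤ n) (hk : k ≤ m) :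
    LargeBound n q k (n ^ ((m + 1) * (q + 1) ^ 2)) := by
  have hlt (x : ℕ) : x < n ^ x := Nat.lt_pow_self (by omega)
  have up {a c : ℕ} (h : a ≤ c) : n ^ a ≤ n ^ c := Nat.pow_le_pow_right (by omega) h
  have hE : (q + 1) * n ^ q ≤ n ^ (2 * q) := by
    rw [two_mul, pow_add]; exact Nat.mul_le_mul_right _ (hlt q)
  have hq2 : (m + 1) * (q + 1) ^ 2 = (m + 1) * (q * q) + (m + 1) * (2 * q) + (m + 1) := by ring
  have hmq : (m + 1) * (2 * q) = 2 * (m * q) + 2 * q := by ring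
  have hkq : k * q ≤ m * q := Nat.mul_le_mul_right _ hk
  refine ⟨?_, ?_, ?_, ?_, ?_, ?_⟩
  · exact (Nat.le_self_pow (by positivity) n).trans (Nat.le_succ _)
  · have := (hlt q).le.trans (up (show q ≤ (m + 1) * (q + 1) ^ 2 by omega))
    omega
  · have := (hlt k).le.trans (up (show k ≤ (m + 1) * (q + 1) ^ 2 by omega))
    omega
  · exact (hE.trans (up (show 2 * q ≤ (m + 1) * (q + 1) ^ 2 by omega))).trans (Nat.le_succ _)
  · refine ((Nat.pow_le_pow_left hE k).trans ?_).trans (Nat.le_succ _)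
    rw [← pow_mul]
    refine up ?_
    have : 2 * q * k = 2 * (k * q) := by ring
    omega
  · refine (le_trans ?_ (up (show 1 + k * q ≤ (m + 1) * (q + 1) ^ 2 by omega))).trans
      (Nat.le_succ _)
    rw [pow_add, pow_one]
    exact Nat.mul_le_mul_left _ (hlt _).le

end

theorem truncationDegree_eq {pmax n : ℕ} (γ : ℕ → ℝ) (G : Couplings pmax n) (C η : ℝ) (β : ℂ)
    (hη : 0 < η) : truncationDegree C η n = ⌈(inputTape γ G C η β 1 *
      Complex.log (n / inputTape γ G C η β 2)).re⌉₊ := by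
  rw [inputTape_one, inputTape_two, ← Complex.ofReal_natCast, ← Complex.ofReal_div,
    ← Complex.ofReal_log (by positivity), ← Complex.ofReal_mul, Complex.ofReal_re, truncationDegree]

/-- One program computes the Taylor polynomials of `log Z` and their exponentials for all inputs. -/
theorem exists_taylorProgram (b : Background) :
    ∃ P : Program, ∀ pmax : ℕ, 2 ≤ pmax → ∃ K : ℝ, 1 ≤ K ∧
      ∀ (n : ℕ) (γ : ℕ → ℝ) (G : Couplings pmax n) (C η : ℝ) (β : ℂ),
        2 ≤ n → 4 ≤ C → 0 < η → η < 1 →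
        ∃ (s : State) (t : ℕ),
          Exec (inputTape γ G C η β) P (initialState pmax n) s t ∧
          (t : ℝ) ≤ (n : ℝ) ^ (K * C * Real.log (n / η)) ∧
          s.int 0 = truncationDegree C η n ∧
          (∀ k ≤ truncationDegree C η n, s.num (k + 1) = logTaylorCoeff b γ G k) ∧
          s.num 0 = Complex.exp (logTaylorPoly b γ G (truncationDegree C η n) β) := by
  obtain ⟨P, c, hP⟩ := exists_program b
  -- One factor 2 comes from B + 2 ≤ B², the other from m + 1 ≤ 2x with x = C log(n/η). The final
  -- summand ensures `1 ≤ K`.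
  refine ⟨P, fun q _ => ⟨2 * (2 * (q + 1) ^ 2) * c + 1, by
    have : (0 : ℝ) ≤ 2 * (2 * (q + 1) ^ 2) * c := by positivity
    linarith, fun n γ G C η β hn hC hη hη1 => ?_⟩⟩
  set m := truncationDegree C η n with hm
  obtain ⟨s, t, e, ht, h0, hs, hx⟩ := hP (inputTape γ G C η β) n q m
    (n ^ ((m + 1) * (q + 1) ^ 2)) (logTaylorCoeff b γ G) hn
    (truncationDegree_eq γ G C η β hη) rfl fun k hk =>
      (clipLogTaylor_eq b (largeBound_pow hn hk) (by omega) γ G C η β).symm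
  refine ⟨s, t, e, ?_, h0, hs, ?_⟩
  · set x := C * Real.log (n / η) with hxdef
    have hn' : (2 : ℝ) ≤ n := by exact_mod_cast hn
    have hlog : Real.log 2 ≤ Real.log (n / η) :=
      Real.log_le_log (by norm_num) (hn'.trans (le_div_self (by linarith) hη hη1.le))
    -- From C ≥ 4 and log 2 > 1/2. This absorbs the rounding: m < x + 1 yields m + 1 ≤ 2x.
    have hx2 : 2 ≤ x := by
      have := Real.log_two_gt_d9
      nlinarith
    have hmx : (m : ℝ) + 1 ≤ 2 * x := by
      have := Nat.ceil_lt_add_one (show 0 ≤ x by linarith)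
      have : (m : ℝ) < x + 1 := this
      linarith
    have hB : n ^ ((m + 1) * (q + 1) ^ 2) + 2 ≤ n ^ (2 * ((m + 1) * (q + 1) ^ 2)) := by
      rw [two_mul, pow_add]
      have h2 : n ≤ n ^ ((m + 1) * (q + 1) ^ 2) := Nat.le_self_pow (by positivity) n
      nlinarith
    have ht' : (t : ℝ) ≤ (n : ℝ) ^ (2 * ((m + 1) * (q + 1) ^ 2) * c) := by
      have := ht.trans (Nat.pow_le_pow_left hB c)
      rw [← pow_mul] at this
      exact_mod_cast this
    refine ht'.trans ?_
    rw [← Real.rpow_natCast]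
    refine Real.rpow_le_rpow_of_exponent_le (by linarith) ?_
    push_cast
    rw [mul_assoc _ C, ← hxdef]
    have hq : (0 : ℝ) ≤ 2 * (q + 1) ^ 2 * c := by positivity
    nlinarith [mul_le_mul_of_nonneg_left hmx hq]
  · rw [hx, clipExpPoly_eq b]
    have h2 : m + 1 ≤ n ^ ((m + 1) * (q + 1) ^ 2) :=
      (Nat.lt_pow_self (show 1 < n by omega)).le.trans
        (Nat.pow_le_pow_right (by omega) (Nat.le_mul_of_pos_right _ (by positivity)))
    omega

/-! ### The second moment of the normalised partition function -/

instance (pmax n : ℕ) : IsProbabilityMeasure (couplingLaw pmax n) := by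
  unfold couplingLaw; infer_instance

/-- The coefficient of the coupling `e` in the Hamiltonian. -/
noncomputable def weight {pmax n : ℕ} (γ : ℕ → ℝ) (σ : Fin n → ℝ) (e : CouplingIndex pmax n) : ℝ :=
  γ e.1 / (n : ℝ) ^ ((((e.1 : ℕ) : ℝ) - 1) / 2) * ∏ j, σ (e.2 j)

section
variable {pmax n : ℕ} (γ : ℕ → ℝ)

theorem hamiltonian_eq_sum_weight (G : Couplings pmax n) (σ : Fin n → ℝ) :
    hamiltonian γ G σ = ∑ e, weight γ σ e * G e := by
  rw [hamiltonian, Fintype.sum_sigma]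
  refine Finset.sum_congr rfl fun p _ => ?_
  rw [Finset.mul_sum]
  exact Finset.sum_congr rfl fun i _ => by rw [weight]; ring

/-- The covariance of the Hamiltonian. -/
theorem sum_weight_mul_weight (hn : 1 ≤ n) (σ τ : Fin n → ℝ) :
    ∑ e : CouplingIndex pmax n, weight γ σ e * weight γ τ e =
      n * mixture pmax γ ((∑ i, σ i * τ i) / n) := by
  have hn0 : (0 : ℝ) < n := by exact_mod_cast hn
  rw [Fintype.sum_sigma, mixture, Finset.mul_sum, ← Finset.sum_coe_sort (Finset.Icc 2 pmax)]
  refine Finset.sum_congr rfl fun p _ => ?_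
  have hp := Finset.mem_Icc.1 p.2
  have h₁ : ((n : ℝ) ^ ((((p : ℕ) : ℝ) - 1) / 2)) ^ 2 = (n : ℝ) ^ ((p : ℕ) - 1) := by
    rw [← Real.rpow_natCast, ← Real.rpow_natCast, ← Real.rpow_mul hn0.le,
      Nat.cast_sub (by omega)]
    congr 1; push_cast; ring
  have h₂ : (n : ℝ) ^ (p : ℕ) = (n : ℝ) ^ ((p : ℕ) - 1) * n := by
    rw [← pow_succ]; congr 1; omega
  have h₃ : ∑ i : Fin (p : ℕ) → Fin n, ∏ j, (σ (i j) * τ (i j)) = (∑ i, σ i * τ i) ^ (p : ℕ) :=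
    (Fintype.sum_pow (fun i => σ i * τ i) _).symm
  calc ∑ i : Fin (p : ℕ) → Fin n, weight γ σ ⟨p, i⟩ * weight γ τ ⟨p, i⟩
      = γ p ^ 2 / ((n : ℝ) ^ ((((p : ℕ) : ℝ) - 1) / 2)) ^ 2 *
          ∑ i : Fin (p : ℕ) → Fin n, ∏ j, (σ (i j) * τ (i j)) := by
        rw [Finset.mul_sum]
        refine Finset.sum_congr rfl fun i _ => ?_
        simp only [weight, Finset.prod_mul_distrib]; ring
    _ = _ := by
        rw [h₁, h₃, div_pow, h₂]
        field_simp

theorem integral_exp_sum_couplings (a : CouplingIndex pmax n → ℂ) :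
    ∫ G, Complex.exp (∑ e, a e * (G e : ℂ)) ∂(couplingLaw pmax n) =
      Complex.exp ((∑ e, a e ^ 2) / 2) := by
  simp_rw [Complex.exp_sum]
  rw [couplingLaw, integral_fintype_prod_eq_prod (fun e (x : ℝ) => Complex.exp (a e * (x : ℂ))),
    Finset.sum_div, Complex.exp_sum]
  refine Finset.prod_congr rfl fun e _ => ?_
  have := complexMGF_id_gaussianReal (μ := 0) (v := 1) (a e)
  simpa [complexMGF] using this

theorem integrable_exp_mul_sum_abs_couplings (a : ℝ) :
    Integrable (fun G : Couplings pmax n => Real.exp (a * ∑ e, |G e|)) (couplingLaw pmax n) := by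
  simp_rw [Finset.mul_sum, Real.exp_sum]
  refine Integrable.fintype_prod (f := fun _ (x : ℝ) => Real.exp (a * |x|)) fun e => ?_
  refine integrable_exp_mul_abs (X := id) ?_ ?_ <;>
  exact integrable_exp_mul_gaussianReal _

/-- The Boltzmann weight, normalised to have expectation `1`. -/
noncomputable def normWeight {pmax n : ℕ} (γ : ℕ → ℝ) (β : ℂ) (G : Couplings pmax n)
    (σ : Fin n → ℝ) : ℂ :=
  Complex.exp (β * (hamiltonian γ G σ : ℂ) - β ^ 2 * (n * mixture pmax γ 1 / 2 : ℝ))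

/-- The partition function, normalised to have expectation `1`. -/
noncomputable def normPartition (b : Background) {pmax n : ℕ} (γ : ℕ → ℝ) (G : Couplings pmax n)
    (β : ℂ) : ℂ :=
  partitionFunction b γ G β * Complex.exp (-(β ^ 2 * (n * mixture pmax γ 1 / 2 : ℝ)))

theorem integral_normWeight (b : Background) (G : Couplings pmax n) (β : ℂ) :
    ∫ σ, normWeight γ β G σ ∂(b.measure n) = normPartition b γ G β := by
  simp only [normWeight, normPartition, partitionFunction, sub_eq_add_neg, Complex.exp_add,
    integral_mul_const]

theorem continuous_hamiltonian_uncurry :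
    Continuous fun p : Couplings pmax n × (Fin n → ℝ) => hamiltonian γ p.1 p.2 := by
  unfold hamiltonian; fun_prop

theorem continuous_normWeight (β : ℂ) :
    Continuous fun p : Couplings pmax n × (Fin n → ℝ) => normWeight γ β p.1 p.2 := by
  have := continuous_hamiltonian_uncurry (pmax := pmax) (n := n) γ
  unfold normWeight
  fun_prop

/-- On configurations of squared length `n` the Hamiltonian has variance n ξ(1), which the
normalisation cancels. -/
theorem expectation_normWeight (hn : 1 ≤ n) (β : ℂ) {σ : Fin n → ℝ}
    (hσ : ∑ i, σ i ^ 2 = (n : ℝ)) : ∫ G, normWeight γ β G σ ∂(couplingLaw pmax n) = 1 := by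
  have hn0 : (n : ℝ) ≠ 0 := by exact_mod_cast (by omega : n ≠ 0)
  have h := integral_exp_sum_couplings fun e : CouplingIndex pmax n => β * (weight γ σ e : ℂ)
  have h₁ := sum_weight_mul_weight (pmax := pmax) γ hn σ σ
  simp only [← pow_two, hσ, div_self hn0] at h₁
  simp only [normWeight, sub_eq_add_neg, Complex.exp_add, integral_mul_const,
    hamiltonian_eq_sum_weight]
  push_cast [Finset.mul_sum]
  simp only [← mul_assoc]
  rw [h, ← Complex.exp_add, ← Complex.exp_zero]
  congr 1
  simp only [mul_pow, ← Finset.mul_sum]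
  have h₂ : ∑ e : CouplingIndex pmax n, (weight γ σ e : ℂ) ^ 2 = (n * mixture pmax γ 1 : ℝ) := by
    rw [← h₁]; push_cast; rfl
  rw [h₂]; push_cast; ring

/-- The Gaussian exponent is half the sum of β² Var, conj(β)² Var and 2|β|² Cov. The normalisation
removes the first two terms, also for complex β, and only the modulus survives next to the
covariance. -/
theorem expectation_normWeight_mul_conj (hn : 1 ≤ n) (β : ℂ) {σ τ : Fin n → ℝ}
    (hσ : ∑ i, σ i ^ 2 = (n : ℝ)) (hτ : ∑ i, τ i ^ 2 = (n : ℝ)) :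
    ∫ G, normWeight γ β G σ * (starRingEnd ℂ) (normWeight γ β G τ) ∂(couplingLaw pmax n) =
      (Real.exp (n * ‖β‖ ^ 2 * mixture pmax γ ((∑ i, σ i * τ i) / n)) : ℂ) := by
  have hn0 : (n : ℝ) ≠ 0 := by exact_mod_cast (by omega : n ≠ 0)
  have h := integral_exp_sum_couplings fun e : CouplingIndex pmax n =>
    β * (weight γ σ e : ℂ) + (starRingEnd ℂ) β * (weight γ τ e : ℂ)
  have h₁ := sum_weight_mul_weight (pmax := pmax) γ hn σ σ
  have h₂ := sum_weight_mul_weight (pmax := pmax) γ hn τ τ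
  have h₃ := sum_weight_mul_weight (pmax := pmax) γ hn σ τ
  simp only [← pow_two, hσ, hτ, div_self hn0] at h₁ h₂
  have hX (G : Couplings pmax n) :
      normWeight γ β G σ * (starRingEnd ℂ) (normWeight γ β G τ) =
        Complex.exp (∑ e, (β * (weight γ σ e : ℂ) + (starRingEnd ℂ) β * (weight γ τ e : ℂ)) * G e) *
          Complex.exp (-((β ^ 2 + (starRingEnd ℂ) β ^ 2) * (n * mixture pmax γ 1 / 2 : ℝ))) := by
    rw [normWeight, normWeight, ← Complex.exp_conj, ← Complex.exp_add, ← Complex.exp_add]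
    congr 1
    simp only [map_sub, map_mul, map_pow, Complex.conj_ofReal, add_mul, Finset.sum_add_distrib,
      hamiltonian_eq_sum_weight, mul_assoc, ← Finset.mul_sum]
    push_cast
    ring
  simp only [hX, integral_mul_const]
  rw [h, ← Complex.exp_add, Complex.ofReal_exp]
  congr 1
  have e₁ : ∑ e : CouplingIndex pmax n, (weight γ σ e : ℂ) ^ 2 = (n * mixture pmax γ 1 : ℝ) := by
    rw [← h₁]; push_cast; rfl
  have e₂ : ∑ e : CouplingIndex pmax n, (weight γ τ e : ℂ) ^ 2 = (n * mixture pmax γ 1 : ℝ) := by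
    rw [← h₂]; push_cast; rfl
  have e₃ : ∑ e : CouplingIndex pmax n, (weight γ σ e : ℂ) * (weight γ τ e : ℂ) =
      (n * mixture pmax γ ((∑ i, σ i * τ i) / n) : ℝ) := by
    rw [← h₃]; push_cast; rfl
  have e₄ : ∑ e : CouplingIndex pmax n,
      (β * (weight γ σ e : ℂ) + (starRingEnd ℂ) β * (weight γ τ e : ℂ)) ^ 2 =
      β ^ 2 * ∑ e : CouplingIndex pmax n, (weight γ σ e : ℂ) ^ 2 +
      (starRingEnd ℂ) β ^ 2 * ∑ e : CouplingIndex pmax n, (weight γ τ e : ℂ) ^ 2 +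
      2 * (β * (starRingEnd ℂ) β) *
        ∑ e : CouplingIndex pmax n, (weight γ σ e : ℂ) * (weight γ τ e : ℂ) := by
    simp only [Finset.mul_sum, ← Finset.sum_add_distrib]
    exact Finset.sum_congr rfl fun e _ => by ring
  rw [e₄, e₁, e₂, e₃, Complex.mul_conj']
  push_cast; ring

theorem exists_norm_normWeight_le (β : ℂ) : ∃ A a : ℝ, 1 ≤ A ∧ 0 ≤ a ∧
    ∀ (G : Couplings pmax n) (σ : Fin n → ℝ), ∑ i, σ i ^ 2 = (n : ℝ) →
      ‖normWeight γ β G σ‖ ≤ A * Real.exp (a * ∑ e, |G e|) := by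
  obtain ⟨C, hC0, hC⟩ := exists_abs_hamiltonian_le (pmax := pmax) (n := n) γ
  refine ⟨Real.exp (‖β ^ 2 * (n * mixture pmax γ 1 / 2 : ℝ)‖), ‖β‖ * C,
    Real.one_le_exp (norm_nonneg _), by positivity, fun G σ hσ => ?_⟩
  rw [normWeight, Complex.norm_exp, ← Real.exp_add]
  refine Real.exp_le_exp.2 ((Complex.re_le_norm _).trans ((norm_sub_le _ _).trans ?_))
  rw [add_comm, norm_mul β, mul_assoc ‖β‖, Complex.norm_real (hamiltonian γ G σ), Real.norm_eq_abs]
  exact add_le_add le_rfl (mul_le_mul_of_nonneg_left (hC G σ hσ) (norm_nonneg _))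

/-- Justifies exchanging the Gaussian expectation with the integral over two replicas. The
domination is by an exponential of ∑ |G e|, which is integrable. -/
theorem integrable_normWeight_sub_one_mul (b : Background) (hn : 1 ≤ n) (β : ℂ) :
    Integrable (fun p : Couplings pmax n × ((Fin n → ℝ) × (Fin n → ℝ)) =>
      (normWeight γ β p.1 p.2.1 - 1) * (starRingEnd ℂ) (normWeight γ β p.1 p.2.2 - 1))
      ((couplingLaw pmax n).prod ((b.measure n).prod (b.measure n))) := by
  have := isProbabilityMeasure_background b hn
  obtain ⟨A, a, hA, ha, hX⟩ := exists_norm_normWeight_le (pmax := pmax) (n := n) γ β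
  have hc := continuous_normWeight (pmax := pmax) (n := n) γ β
  refine Integrable.mono' (g := fun p => (4 * A ^ 2) * Real.exp ((a + a) * ∑ e, |p.1 e|)) ?_ ?_ ?_
  · exact ((integrable_exp_mul_sum_abs_couplings (a + a)).const_mul (4 * A ^ 2)).comp_fst _
  · refine Continuous.aestronglyMeasurable ?_
    have h₁ := hc.comp (f := fun p : Couplings pmax n × ((Fin n → ℝ) × (Fin n → ℝ)) =>
      (p.1, p.2.1)) (by fun_prop)
    have h₂ := hc.comp (f := fun p : Couplings pmax n × ((Fin n → ℝ) × (Fin n → ℝ)) =>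
      (p.1, p.2.2)) (by fun_prop)
    exact (h₁.sub continuous_const).mul (Complex.continuous_conj.comp (h₂.sub continuous_const))
  · have h₁ : ∀ᵐ p ∂((couplingLaw pmax n).prod ((b.measure n).prod (b.measure n))),
        ∑ i, p.2.1 i ^ 2 = (n : ℝ) :=
      (Measure.quasiMeasurePreserving_fst.comp Measure.quasiMeasurePreserving_snd).ae
        (ae_background b n)
    have h₂ : ∀ᵐ p ∂((couplingLaw pmax n).prod ((b.measure n).prod (b.measure n))),
        ∑ i, p.2.2 i ^ 2 = (n : ℝ) :=
      (Measure.quasiMeasurePreserving_snd.comp Measure.quasiMeasurePreserving_snd).ae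
        (ae_background b n)
    filter_upwards [h₁, h₂] with p hp₁ hp₂
    have hs : 0 ≤ ∑ e, |p.1 e| := Finset.sum_nonneg fun _ _ => abs_nonneg _
    have hE : 1 ≤ Real.exp (a * ∑ e, |p.1 e|) := Real.one_le_exp (by positivity)
    rw [norm_mul, RCLike.norm_conj, add_mul, Real.exp_add]
    have key (σ : Fin n → ℝ) (hσ : ∑ i, σ i ^ 2 = (n : ℝ)) :
        ‖normWeight γ β p.1 σ - 1‖ ≤ 2 * A * Real.exp (a * ∑ e, |p.1 e|) := by
      refine (norm_sub_le _ _).trans ?_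
      rw [norm_one]
      nlinarith [hX p.1 σ hσ]
    calc _ ≤ (2 * A * Real.exp (a * ∑ e, |p.1 e|)) * (2 * A * Real.exp (a * ∑ e, |p.1 e|)) :=
          mul_le_mul (key _ hp₁) (key _ hp₂) (norm_nonneg _) (by positivity)
      _ = _ := by ring

theorem integrable_normWeight (β : ℂ) {σ : Fin n → ℝ}
    (hσ : ∑ i, σ i ^ 2 = (n : ℝ)) :
    Integrable (fun G : Couplings pmax n => normWeight γ β G σ) (couplingLaw pmax n) := by
  obtain ⟨A, a, hA, ha, hX⟩ := exists_norm_normWeight_le (pmax := pmax) (n := n) γ β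
  refine Integrable.mono' ((integrable_exp_mul_sum_abs_couplings a).const_mul A)
    ((continuous_normWeight γ β).comp (by fun_prop : Continuous fun G : Couplings pmax n =>
      (G, σ))).aestronglyMeasurable (Filter.Eventually.of_forall fun G => hX G σ hσ)

theorem integrable_normWeight_mul_conj (β : ℂ) {σ τ : Fin n → ℝ}
    (hσ : ∑ i, σ i ^ 2 = (n : ℝ)) (hτ : ∑ i, τ i ^ 2 = (n : ℝ)) :
    Integrable (fun G : Couplings pmax n =>
      normWeight γ β G σ * (starRingEnd ℂ) (normWeight γ β G τ)) (couplingLaw pmax n) := by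
  obtain ⟨A, a, hA, ha, hX⟩ := exists_norm_normWeight_le (pmax := pmax) (n := n) γ β
  have hc (σ : Fin n → ℝ) := (continuous_normWeight (pmax := pmax) γ β).comp
    (by fun_prop : Continuous fun G : Couplings pmax n => (G, σ))
  refine Integrable.mono' ((integrable_exp_mul_sum_abs_couplings (a + a)).const_mul (A * A))
    ((hc σ).mul (Complex.continuous_conj.comp (hc τ))).aestronglyMeasurable
    (Filter.Eventually.of_forall fun G => ?_)
  rw [norm_mul, RCLike.norm_conj, add_mul, Real.exp_add, mul_mul_mul_comm]
  exact mul_le_mul (hX G σ hσ) (hX G τ hτ) (norm_nonneg _) (by positivity)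

/-- Replica trick for the square: the squared modulus of an integral is a double integral over
independent copies. -/
theorem norm_sq_normPartition_sub_one (b : Background) (hn : 1 ≤ n) (G : Couplings pmax n) (β : ℂ) :
    ((‖normPartition b γ G β - 1‖ ^ 2 : ℝ) : ℂ) =
      ∫ p : (Fin n → ℝ) × (Fin n → ℝ), (normWeight γ β G p.1 - 1) *
        (starRingEnd ℂ) (normWeight γ β G p.2 - 1) ∂((b.measure n).prod (b.measure n)) := by
  have := isProbabilityMeasure_background b hn
  have hint : Integrable (normWeight γ β G) (b.measure n) := by
    obtain ⟨A, a, hA, ha, hX⟩ := exists_norm_normWeight_le (pmax := pmax) (n := n) γ β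
    refine Integrable.of_bound (C := A * Real.exp (a * ∑ e, |G e|))
      ((continuous_normWeight γ β).comp (by fun_prop : Continuous fun σ : Fin n → ℝ =>
      (G, σ))).aestronglyMeasurable ?_
    filter_upwards [ae_background b n] with σ hσ using hX G σ hσ
  rw [integral_prod_mul (fun σ => normWeight γ β G σ - 1)
    (fun τ => (starRingEnd ℂ) (normWeight γ β G τ - 1)), integral_conj,
    integral_sub hint (integrable_const _), integral_normWeight, Complex.mul_conj']
  simp

/-- The second moment identity. -/
theorem integral_norm_sq_normPartition_sub_one (b : Background) (hn : 1 ≤ n) (β : ℂ) :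
    Integrable (fun G : Couplings pmax n => ‖normPartition b γ G β - 1‖ ^ 2)
      (couplingLaw pmax n) ∧
    ∫ G, ‖normPartition b γ G β - 1‖ ^ 2 ∂(couplingLaw pmax n) =
      ∫ p : (Fin n → ℝ) × (Fin n → ℝ),
        (Real.exp (n * ‖β‖ ^ 2 * mixture pmax γ ((∑ i, p.1 i * p.2 i) / n)) - 1)
        ∂((b.measure n).prod (b.measure n)) := by
  have := isProbabilityMeasure_background b hn
  have hint := integrable_normWeight_sub_one_mul (pmax := pmax) γ b hn β
  have h₁ := hint.integral_prod_left
  simp only [← norm_sq_normPartition_sub_one γ b hn] at h₁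
  refine ⟨h₁.re, ?_⟩
  have h₂ := integral_integral_swap (f := fun (G : Couplings pmax n) (p : (Fin n → ℝ) × (Fin n → ℝ)) =>
    (normWeight γ β G p.1 - 1) * (starRingEnd ℂ) (normWeight γ β G p.2 - 1)) hint
  simp only [← norm_sq_normPartition_sub_one γ b hn] at h₂
  rw [integral_complex_ofReal] at h₂
  apply Complex.ofReal_injective
  rw [h₂, ← integral_complex_ofReal]
  refine integral_congr_ae ?_
  have a₁ : ∀ᵐ p ∂((b.measure n).prod (b.measure n)), ∑ i, p.1 i ^ 2 = (n : ℝ) :=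
    Measure.quasiMeasurePreserving_fst.ae (ae_background b n)
  have a₂ : ∀ᵐ p ∂((b.measure n).prod (b.measure n)), ∑ i, p.2 i ^ 2 = (n : ℝ) :=
    Measure.quasiMeasurePreserving_snd.ae (ae_background b n)
  filter_upwards [a₁, a₂] with p hp₁ hp₂
  have i₁ := integrable_normWeight (pmax := pmax) γ β hp₁
  have i₂ := integrable_normWeight (pmax := pmax) γ β hp₂
  have i₂' : Integrable (fun G : Couplings pmax n => (starRingEnd ℂ) (normWeight γ β G p.2))
      (couplingLaw pmax n) := 
    Complex.conjCLE.toContinuousLinearMap.integrable_comp i₂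
  have i₃ := integrable_normWeight_mul_conj (pmax := pmax) γ β hp₁ hp₂
  have hexp (G : Couplings pmax n) : (normWeight γ β G p.1 - 1) *
      (starRingEnd ℂ) (normWeight γ β G p.2 - 1) =
      normWeight γ β G p.1 * (starRingEnd ℂ) (normWeight γ β G p.2) - normWeight γ β G p.1 -
        ((starRingEnd ℂ) (normWeight γ β G p.2) - 1) := by
    simp only [map_sub, map_one]; ring
  simp only [hexp]
  have j₁ : Integrable (fun G : Couplings pmax n => normWeight γ β G p.1 *
      (starRingEnd ℂ) (normWeight γ β G p.2) - normWeight γ β G p.1) (couplingLaw pmax n) :=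
    i₃.sub i₁
  have j₂ : Integrable (fun G : Couplings pmax n => (starRingEnd ℂ) (normWeight γ β G p.2) - 1)
      (couplingLaw pmax n) := i₂'.sub (integrable_const _)
  rw [integral_sub j₁ j₂, integral_sub i₃ i₁,
    integral_sub i₂' (integrable_const _), integral_conj, expectation_normWeight γ hn β hp₁,
    expectation_normWeight γ hn β hp₂, expectation_normWeight_mul_conj γ hn β hp₁ hp₂]
  simp

end

/-! ### The entropy functional and large deviations of the overlap -/

/-- The entropy functional on `(-1, 1)`, with real values. -/
noncomputable def realEntropy (b : Background) (x : ℝ) : ℝ :=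
  match b with
  | .hypercube => -(1 / 2) * ((1 - x) * Real.log (1 - x) + (1 + x) * Real.log (1 + x))
  | .sphere => 1 / 2 * Real.log (1 - x ^ 2)

theorem entropy_eq_realEntropy (b : Background) {x : ℝ} (hx : |x| < 1) :
    entropy b x = (realEntropy b x : EReal) := by
  cases b <;> simp [entropy, realEntropy, hx]

/-- The Gibbs variational principle on two points. -/
theorem realEntropy_hypercube_le {x : ℝ} (hx : |x| < 1) (l : ℝ) :
    realEntropy .hypercube x ≤ Real.log (Real.cosh l) - l * x := by
  obtain ⟨h₁, h₂⟩ := abs_lt.1 hx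
  have hc := Real.cosh_pos l
  -- Added for the two signs, this is nonnegativity of the relative entropy of the law with weights
  -- (1 ± x)/2 with respect to the one with weights e^(±l)/(2 cosh l).
  have key (y s : ℝ) (hy : 0 < y) :
      y - Real.exp s / Real.cosh l ≤ y * (Real.log y + Real.log (Real.cosh l) - s) := by
    have h := Real.one_sub_inv_le_log_of_pos (x := y * Real.cosh l / Real.exp s) (by positivity)
    rw [Real.log_div (by positivity) (by positivity), Real.log_mul hy.ne' hc.ne', Real.log_exp] at h
    have h' := mul_le_mul_of_nonneg_left h hy.le
    refine le_trans (le_of_eq ?_) h'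
    field_simp
  have k₁ := key (1 + x) l (by linarith)
  have k₂ := key (1 - x) (-l) (by linarith)
  have e : Real.exp l / Real.cosh l + Real.exp (-l) / Real.cosh l = 2 := by
    rw [← add_div, Real.cosh_eq]; field_simp
  simp only [realEntropy]
  nlinarith

/-- Supplies the Gaussian decay in the overlap, from whatever fraction of the entropy the energy
leaves over. -/
theorem realEntropy_le (b : Background) {x : ℝ} (hx : |x| < 1) : realEntropy b x ≤ -(x ^ 2 / 2) := by
  cases b with
  | hypercube =>
    refine (realEntropy_hypercube_le hx x).trans ?_
    have h : Real.log (Real.cosh x) ≤ x ^ 2 / 2 := by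
      rw [Real.log_le_iff_le_exp (Real.cosh_pos x)]
      exact Real.cosh_le_exp_half_sq x
    nlinarith
  | sphere =>
    have h : 0 < 1 - x ^ 2 := by nlinarith [sq_lt_one_iff_abs_lt_one x |>.2 hx]
    have := Real.log_le_sub_one_of_pos h
    simp only [realEntropy]
    linarith

theorem integral_exp_overlap_hypercube {n : ℕ} {σ : Fin n → ℝ} (hσ : ∀ i, σ i = 1 ∨ σ i = -1)
    (l : ℝ) :
    ∫ τ, Real.exp (l * ∑ i, σ i * τ i) ∂(Background.hypercube.measure n) = Real.cosh l ^ n := by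
  have h := integral_hypercube_prod (n := n) fun i y => Real.exp (l * (σ i * y))
  simp only [← Real.exp_sum, ← Finset.mul_sum] at h
  rw [h]
  have (i : Fin n) : (Real.exp (l * (σ i * 1)) + Real.exp (l * (σ i * -1))) / 2 = Real.cosh l := by
    rcases hσ i with h | h <;> simp [h, Real.cosh_eq, add_comm]
  rw [Finset.prod_congr rfl fun i _ => this i]
  simp

theorem cosh_eq_exp_of_log {x : ℝ} (hx : |x| < 1) :
    Real.cosh ((Real.log (1 + x) - Real.log (1 - x)) / 2) =
      Real.exp (-((Real.log (1 + x) + Real.log (1 - x)) / 2)) := by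
  obtain ⟨h₁, h₂⟩ := abs_lt.1 hx
  have e₁ : Real.exp ((Real.log (1 + x) - Real.log (1 - x)) / 2) =
      (1 + x) * Real.exp (-((Real.log (1 + x) + Real.log (1 - x)) / 2)) := by
    nth_rw 2 [← Real.exp_log (show 0 < 1 + x by linarith)]
    rw [← Real.exp_add]; congr 1; ring
  have e₂ : Real.exp (-((Real.log (1 + x) - Real.log (1 - x)) / 2)) =
      (1 - x) * Real.exp (-((Real.log (1 + x) + Real.log (1 - x)) / 2)) := by
    nth_rw 2 [← Real.exp_log (show 0 < 1 - x by linarith)]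
    rw [← Real.exp_add]; congr 1; ring
  rw [Real.cosh_eq, e₁, e₂]; ring

/-- Chernoff's bound at the optimal parameter l = artanh x, where log cosh l - l x is exactly the
entropy. The sum of the exponentials at `l` and `-l` handles both tails at once and causes the
factor 2. -/
theorem measure_overlap_hypercube_le {n : ℕ} (hn : 1 ≤ n) {σ : Fin n → ℝ}
    (hσ : ∀ i, σ i = 1 ∨ σ i = -1) {x : ℝ} (hx0 : 0 ≤ x) (hx1 : x < 1) :
    (Background.hypercube.measure n).real {τ | x ≤ |(∑ i, σ i * τ i) / n|} ≤
      2 * Real.exp (n * realEntropy .hypercube x) := by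
  have := isProbabilityMeasure_background .hypercube hn
  have hn0 : (0 : ℝ) < n := by exact_mod_cast hn
  have hx : |x| < 1 := by rwa [abs_of_nonneg hx0]
  set l := (Real.log (1 + x) - Real.log (1 - x)) / 2 with hl
  have hl0 : 0 ≤ l := by
    have := Real.log_le_log (show 0 < 1 - x by linarith) (show 1 - x ≤ 1 + x by linarith)
    rw [hl]; linarith
  have hint (a : ℝ) : Integrable (fun τ : Fin n → ℝ => Real.exp (a * ∑ i, σ i * τ i))
      (Background.hypercube.measure n) :=
    integrable_background_of_continuous .hypercube hn (by fun_prop)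
  have hm := mul_meas_ge_le_integral_of_nonneg
    (f := fun τ : Fin n → ℝ => Real.exp (l * ∑ i, σ i * τ i) + Real.exp (-l * ∑ i, σ i * τ i))
    (μ := Background.hypercube.measure n) (Filter.Eventually.of_forall fun τ => by positivity)
    ((hint l).add (hint (-l))) (Real.exp (l * (n * x)))
  rw [integral_add (hint l) (hint (-l)), integral_exp_overlap_hypercube hσ,
    integral_exp_overlap_hypercube hσ, Real.cosh_neg, hl, cosh_eq_exp_of_log hx, ← hl,
    ← Real.exp_nat_mul, ← two_mul, ← le_div_iff₀' (Real.exp_pos _), mul_div_assoc,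
    ← Real.exp_sub] at hm
  refine (measureReal_mono fun τ hτ => ?_).trans (hm.trans (le_of_eq ?_))
  · simp only [Set.mem_ofPred_eq] at hτ ⊢
    rw [abs_div, Nat.abs_cast, le_div_iff₀ hn0, mul_comm] at hτ
    rcases abs_choice (∑ i, σ i * τ i) with h | h <;> rw [h] at hτ
    · exact le_add_of_le_of_nonneg (Real.exp_le_exp.2 (mul_le_mul_of_nonneg_left hτ hl0))
        (Real.exp_pos _).le
    · refine le_add_of_nonneg_of_le (Real.exp_pos _).le (Real.exp_le_exp.2 ?_)
      rw [neg_mul, ← mul_neg]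
      exact mul_le_mul_of_nonneg_left hτ hl0
  · congr 2
    simp only [realEntropy, hl]; ring

/-! ### Spherical caps, by linear rescaling along an axis -/

section
variable {E : Type*} [NormedAddCommGroup E] [InnerProductSpace ℝ E]

/-- The linear map that multiplies the unit vector `u` by `a` and its orthogonal complement
by `b`. -/
noncomputable def axialScaling (u : E) (a b : ℝ) : E →ₗ[ℝ] E :=
  b • LinearMap.transvection (((a - b) / b) • (innerₛₗ ℝ u)) u

theorem norm_sq_axialScaling {u : E} (hu : ‖u‖ = 1) (a : ℝ) {b : ℝ} (hb : b ≠ 0) (y : E) :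
    ‖axialScaling u a b y‖ ^ 2 = b ^ 2 * ‖y‖ ^ 2 - (b ^ 2 - a ^ 2) * inner ℝ u y ^ 2 := by
  have h : axialScaling u a b y = b • y + ((a - b) * inner ℝ u y) • u := by
    simp only [axialScaling, LinearMap.smul_apply, LinearMap.transvection.apply, smul_add, smul_smul,
      innerₛₗ_apply_apply, smul_eq_mul]
    congr 2; field_simp
  rw [h, norm_add_sq_real, norm_smul, norm_smul, inner_smul_left, inner_smul_right,
    real_inner_comm, hu, mul_pow, mul_pow, Real.norm_eq_abs, Real.norm_eq_abs, sq_abs, sq_abs]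
  simp only [conj_trivial]
  ring

/-- A transvection `y ↦ y + f y • u` has determinant `1 + f u`, here `a / b`; writing `axialScaling`
as a multiple of a transvection is meant for this computation. -/
theorem det_axialScaling [FiniteDimensional ℝ E] {u : E} (hu : ‖u‖ = 1) (a : ℝ) {b : ℝ} (hb : b ≠ 0)
    (hd : 1 ≤ Module.finrank ℝ E) :
    LinearMap.det (axialScaling u a b) = a * b ^ (Module.finrank ℝ E - 1) := by
  rw [axialScaling, LinearMap.det_smul, LinearMap.transvection.det]
  obtain ⟨k, hk⟩ := Nat.exists_eq_add_of_le' hd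
  rw [hk, Nat.add_sub_cancel]
  simp only [LinearMap.smul_apply, innerₛₗ_apply_apply, real_inner_self_eq_norm_sq, hu, smul_eq_mul]
  field_simp
  ring

/-- Two opposite spherical caps are small. -/
theorem toSphere_caps_le [FiniteDimensional ℝ E] [MeasurableSpace E] [BorelSpace E]
    (μ : Measure E) [μ.IsAddHaarMeasure]
    {u : E} (hu : ‖u‖ = 1) {a b x : ℝ} (ha : 0 < a) (hb : 0 < b) (hab : a ≤ b) (hx : 0 ≤ x)
    (h : b ^ 2 * (1 - x ^ 2) + a ^ 2 * x ^ 2 ≤ 1) :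
    μ.toSphere {v | x ≤ |inner ℝ u (v : E)|} ≤
      ENNReal.ofReal (a * b ^ (Module.finrank ℝ E - 1))⁻¹ * μ.toSphere Set.univ := by
  have hE : 1 ≤ Module.finrank ℝ E := by
    have : Nontrivial E := ⟨u, 0, fun h => by simp [h] at hu⟩
    exact Module.finrank_pos
  have hm : MeasurableSet {v : Metric.sphere (0 : E) 1 | x ≤ |inner ℝ u (v : E)|} :=
    measurableSet_le measurable_const (by fun_prop)
  -- Surface measure is the dimension times the volume of the cone over the set. The scaling maps
  -- the cone over the caps into the unit ball, so this cone has at most the volume of the ball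
  -- divided by the determinant.
  rw [Measure.toSphere_apply' _ hm, Measure.toSphere_apply_univ, mul_left_comm]
  refine mul_le_mul_right ?_ _
  have hdet := det_axialScaling hu a hb.ne' hE
  have hd : 0 < a * b ^ (Module.finrank ℝ E - 1) := by positivity
  rw [← abs_of_pos (inv_pos.2 hd), ← hdet, ← Measure.addHaar_preimage_linearMap μ
    (hdet ▸ hd.ne')]
  refine measure_mono ?_
  rintro _ ⟨r, ⟨hr0, hr1⟩, _, ⟨v, hv, rfl⟩, rfl⟩
  have hv1 : ‖(v : E)‖ = 1 := by simp
  have hv' : x ^ 2 ≤ inner ℝ u (v : E) ^ 2 := by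
    rw [← sq_abs (inner ℝ u (v : E))]
    exact pow_le_pow_left₀ hx hv 2
  have hT : ‖axialScaling u a b (v : E)‖ ^ 2 ≤ 1 := by
    rw [norm_sq_axialScaling hu a hb.ne', hv1]
    have : a ^ 2 ≤ b ^ 2 := pow_le_pow_left₀ ha.le hab 2
    nlinarith [mul_le_mul_of_nonneg_left hv' (sub_nonneg.2 this)]
  simp only [Set.mem_preimage, Metric.mem_ball, dist_zero_right, map_smul, norm_smul,
    Real.norm_eq_abs, abs_of_pos hr0]
  have := (sq_le_one_iff₀ (norm_nonneg _)).1 hT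
  nlinarith [norm_nonneg (axialScaling u a b (v : E))]

end

theorem measure_overlap_sphere_le {n : ℕ} (hn : 2 ≤ n) {σ : Fin n → ℝ}
    (hσ : ∑ i, σ i ^ 2 = (n : ℝ)) {x : ℝ} (hx0 : 0 ≤ x) (hx1 : x < 1) :
    (Background.sphere.measure n).real {τ | x ≤ |(∑ i, σ i * τ i) / n|} ≤
      2 * n * Real.exp ((n - 1) * realEntropy .sphere x) := by
  have hn0 : (2 : ℝ) ≤ n := by exact_mod_cast hn
  have hn1 : 1 / (n : ℝ) ≤ 1 / 2 := one_div_le_one_div_of_le (by norm_num) hn0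
  have hxx : 0 < 1 - x ^ 2 := by nlinarith
  set u : EuclideanSpace ℝ (Fin n) := WithLp.toLp 2 fun i => (√(n : ℝ))⁻¹ * σ i with hu
  have hsq : √(n : ℝ) ^ 2 = n := Real.sq_sqrt (by positivity)
  have hs0 : 0 < √(n : ℝ) := Real.sqrt_pos.2 (by positivity)
  have hu1 : ‖u‖ = 1 := by
    rw [EuclideanSpace.norm_eq, Real.sqrt_eq_one]
    simp only [hu, Real.norm_eq_abs, sq_abs, mul_pow, ← Finset.mul_sum, hσ]
    rw [inv_pow, hsq]; field_simp
  -- With a² = 1/n and b² = (1 - 1/n)/(1 - x²), the left side of the cap condition is 1 - (1 -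
  -- x²)/n. The axial factor costs only √n, while b^(-(n-1)) produces exp((n-1) h(x)) up to a
  -- bounded factor.
  set a : ℝ := (√(n : ℝ))⁻¹ with ha
  set b : ℝ := Real.exp ((Real.log (1 - 1 / n) - Real.log (1 - x ^ 2)) / 2) with hb
  have ha2 : a ^ 2 = 1 / n := by rw [ha, inv_pow, hsq, one_div]
  have hb2 : b ^ 2 = (1 - 1 / n) / (1 - x ^ 2) := by
    rw [hb, ← Real.exp_nat_mul, Nat.cast_two, mul_div_cancel₀ _ two_ne_zero, Real.exp_sub,
      Real.exp_log (by linarith), Real.exp_log hxx]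
  have ha0 : 0 < a := by positivity
  have hb0 : 0 < b := Real.exp_pos _
  have hab : a ≤ b := by
    refine (sq_le_sq₀ ha0.le hb0.le).1 ?_
    rw [ha2, hb2, le_div_iff₀ hxx]
    nlinarith [sq_nonneg x]
  have hcap := toSphere_caps_le (volume : Measure (EuclideanSpace ℝ (Fin n))) hu1 ha0 hb0 hab hx0 (by
    rw [ha2, hb2, div_mul_cancel₀ _ hxx.ne']
    nlinarith [one_div_pos.2 (show (0 : ℝ) < n by linarith)])
  have hms : MeasurableSet {τ : Fin n → ℝ | x ≤ |(∑ i, σ i * τ i) / n|} :=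
    measurableSet_le measurable_const (by fun_prop)
  have hpre : (fun (v : Metric.sphere (0 : EuclideanSpace ℝ (Fin n)) 1) (i : Fin n) =>
      √(n : ℝ) * (v : EuclideanSpace ℝ (Fin n)) i) ⁻¹' {τ : Fin n → ℝ | x ≤ |(∑ i, σ i * τ i) / n|} =
      {v : Metric.sphere (0 : EuclideanSpace ℝ (Fin n)) 1 |
        x ≤ |inner ℝ u (v : EuclideanSpace ℝ (Fin n))|} := by
    have han : √(n : ℝ) / n = a := by rw [ha, Real.sqrt_div_self']; rw [one_div]
    ext v
    have : (∑ i, σ i * (√(n : ℝ) * (v : EuclideanSpace ℝ (Fin n)) i)) / n =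
        inner ℝ u (v : EuclideanSpace ℝ (Fin n)) := by
      rw [PiLp.inner_apply, Finset.sum_div]
      refine Finset.sum_congr rfl fun i _ => ?_
      simp only [hu, RCLike.inner_apply, conj_trivial]
      linear_combination (σ i * (v : EuclideanSpace ℝ (Fin n)) i) * han
    simp only [Set.mem_preimage, Set.mem_ofPred_eq, this]
  have hle : (Background.sphere.measure n) {τ | x ≤ |(∑ i, σ i * τ i) / n|} ≤
      ENNReal.ofReal (a * b ^ (n - 1))⁻¹ := by
    rw [Background.measure, Measure.map_apply measurable_sphere_embedding hms, hpre,
      cond_apply MeasurableSet.univ, Set.univ_inter]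
    rw [finrank_euclideanSpace_fin] at hcap
    refine (mul_le_mul_right hcap _).trans (le_of_eq ?_)
    rw [mul_left_comm, ENNReal.inv_mul_cancel (toSphere_univ_ne_zero (by omega))
      (measure_ne_top _ _), mul_one]
  refine (ENNReal.toReal_le_of_le_ofReal (by positivity) hle).trans ?_
  -- The bounded factor is (1 - 1/n)^(-(n-1)/2) ≤ e^(1/2) ≤ 2.
  have hlog : -((n : ℝ) - 1) * Real.log (1 - 1 / n) ≤ 1 := by
    have h := Real.one_sub_inv_le_log_of_pos (x := 1 - 1 / (n : ℝ)) (by linarith)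
    have e : 1 - (1 - 1 / (n : ℝ))⁻¹ = -(1 / (n - 1)) := by
      have : (n : ℝ) - 1 ≠ 0 := by linarith
      field_simp; ring
    rw [e] at h
    have h' := mul_le_mul_of_nonneg_left h (show (0 : ℝ) ≤ n - 1 by linarith)
    have e' : ((n : ℝ) - 1) * -(1 / (n - 1)) = -1 := by
      have : (n : ℝ) - 1 ≠ 0 := by linarith
      field_simp
    linarith
  have he : Real.exp (1 / 2) ≤ 2 := by
    have := Real.exp_bound_div_one_sub_of_interval (x := 1 / 2) (by norm_num) (by norm_num)
    linarith
  have hsn : √(n : ℝ) ≤ n := Real.sqrt_le_iff.2 ⟨by linarith, by nlinarith⟩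
  rw [mul_inv, ha, inv_inv, hb, ← Real.exp_nat_mul, ← Real.exp_neg, Nat.cast_sub (by omega : 1 ≤ n)]
  calc √(n : ℝ) * Real.exp (-(((n : ℝ) - (1 : ℕ)) *
        ((Real.log (1 - 1 / n) - Real.log (1 - x ^ 2)) / 2)))
      ≤ n * (Real.exp (1 / 2) * Real.exp ((n - 1) * realEntropy .sphere x)) := by
        rw [← Real.exp_add]
        refine mul_le_mul hsn (Real.exp_le_exp.2 ?_) (Real.exp_pos _).le (by positivity)
        simp only [realEntropy, Nat.cast_one]
        nlinarith
    _ ≤ n * (2 * Real.exp ((n - 1) * realEntropy .sphere x)) := by gcongr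
    _ = _ := by ring

/-- A common form for both backgrounds. The cube has the sharper bound with `n` in place of `n - 1`,
and since the entropy is nonpositive it may be weakened. -/
theorem measure_overlap_le (b : Background) {n : ℕ} (hn : 2 ≤ n) :
    ∀ᵐ σ ∂(b.measure n), ∀ x : ℝ, 0 ≤ x → x < 1 →
      (b.measure n).real {τ | x ≤ |(∑ i, σ i * τ i) / n|} ≤
        2 * n * Real.exp ((n - 1) * realEntropy b x) := by
  cases b with
  | hypercube =>
    filter_upwards [ae_hypercube] with σ hσ x hx0 hx1
    refine (measure_overlap_hypercube_le (by omega) hσ hx0 hx1).trans ?_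
    have hn' : (2 : ℝ) ≤ n := by exact_mod_cast hn
    have h := realEntropy_le .hypercube (x := x) (by rwa [abs_of_nonneg hx0])
    refine mul_le_mul (by linarith) (Real.exp_le_exp.2 ?_) (Real.exp_pos _).le (by linarith)
    nlinarith [sq_nonneg x]
  | sphere =>
    filter_upwards [ae_sphere] with σ hσ x hx0 hx1 using measure_overlap_sphere_le hn hσ hx0 hx1

/-! ### The mixture function -/

section mixture

variable (pmax : ℕ) (γ : ℕ → ℝ)

theorem mixture_nonneg {x : ℝ} (hx : 0 ≤ x) : 0 ≤ mixture pmax γ x :=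
  Finset.sum_nonneg fun p _ => by positivity

theorem mixture_le_mixture_abs (x : ℝ) : mixture pmax γ x ≤ mixture pmax γ |x| :=
  Finset.sum_le_sum fun p _ => mul_le_mul_of_nonneg_left
    ((le_abs_self _).trans (abs_pow x p).le) (sq_nonneg _)

theorem mixture_zero : mixture pmax γ 0 = 0 :=
  Finset.sum_eq_zero fun p hp => by
    rw [zero_pow (by have := (Finset.mem_Icc.1 hp).1; omega), mul_zero]

/-- This is where γ_2 = 0 enters. A quadratic term would make n ξ(R) of order one at the typical
overlap n^(-1/2), whereas a cubic one is negligible for all overlaps of smaller order than n^(-1/3).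
-/
theorem mixture_le_cube (h2 : γ 2 = 0) {x : ℝ} (hx0 : 0 ≤ x) (hx1 : x ≤ 1) :
    mixture pmax γ x ≤ mixture pmax γ 1 * x ^ 3 := by
  rw [mixture, mixture, Finset.sum_mul]
  refine Finset.sum_le_sum fun p hp => ?_
  rcases Nat.lt_or_ge p 3 with h | h
  · obtain rfl : p = 2 := by have := (Finset.mem_Icc.1 hp).1; omega
    simp [h2]
  · rw [one_pow, mul_one]
    exact mul_le_mul_of_nonneg_left (pow_le_pow_of_le_one hx0 hx1 h) (sq_nonneg _)

theorem pow_sub_pow_le_mul {x y : ℝ} (hx : 0 ≤ x) (hxy : x ≤ y) (hy : y ≤ 1) (p : ℕ) :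
    y ^ p - x ^ p ≤ p * (y - x) := by
  induction p with
  | zero => simp
  | succ p ih =>
    have h₁ : x ^ p ≤ 1 := pow_le_one₀ hx (hxy.trans hy)
    have h₂ : x ^ p ≤ y ^ p := pow_le_pow_left₀ hx hxy p
    push_cast
    have e : y ^ (p + 1) - x ^ (p + 1) = y * (y ^ p - x ^ p) + x ^ p * (y - x) := by ring
    rw [e]
    nlinarith [mul_le_mul_of_nonneg_right hy (sub_nonneg.2 h₂),
      mul_le_mul_of_nonneg_right h₁ (sub_nonneg.2 hxy)]

/-- A Lipschitz bound: across a slice of overlaps of width 1/n, the quantity n ξ changes by at most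
a constant. -/
theorem mixture_le_add {x y : ℝ} (hx : 0 ≤ x) (hxy : x ≤ y) (hy : y ≤ 1) :
    mixture pmax γ y ≤ mixture pmax γ x + (∑ p ∈ Finset.Icc 2 pmax, γ p ^ 2 * p) * (y - x) := by
  rw [mixture, mixture, Finset.sum_mul, ← Finset.sum_add_distrib]
  refine Finset.sum_le_sum fun p _ => ?_
  nlinarith [mul_le_mul_of_nonneg_left (pow_sub_pow_le_mul hx hxy hy p) (sq_nonneg (γ p))]

/-- Below the threshold, the energy is dominated by the entropy. -/
theorem SecondMomentCondition.mixture_le {b : Background} {pmax : ℕ} {γ : ℕ → ℝ} {β : ℝ}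
    (h : SecondMomentCondition b pmax γ β) {x : ℝ} (hx0 : 0 ≤ x) (hx1 : x < 1) :
    β ^ 2 * mixture pmax γ x ≤ -realEntropy b x := by
  have h0 : realEntropy b 0 = 0 := by cases b <;> simp [realEntropy]
  rcases hx0.eq_or_lt with rfl | hx
  · simp [h0, mixture_zero]
  have h' := h.1 x ⟨by linarith, hx1.le⟩ hx.ne'
  rw [phi, phi, entropy_eq_realEntropy b (by rwa [abs_of_pos hx]),
    entropy_eq_realEntropy b (by simp), h0, mixture_zero, ← EReal.coe_add, ← EReal.coe_add,
    EReal.coe_lt_coe_iff] at h'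
  linarith

/-- Overlaps up to k₀/n are treated by the cubic bound. The others are sorted into slices of width
1/n, on each of which the mixture is replaced by its value at the left end. -/
theorem exp_mixture_le (h2 : γ 2 = 0) {t : ℝ} (ht : 0 ≤ t) {n k₀ : ℕ} (hn : 1 ≤ n) {R : ℝ}
    (hR : |R| ≤ 1) :
    Real.exp (n * t * mixture pmax γ R) ≤
      Real.exp (n * t * (mixture pmax γ 1 * (k₀ / n : ℝ) ^ 3)) +
      ∑ k ∈ Finset.Ico k₀ n, Real.exp (t * ∑ p ∈ Finset.Icc 2 pmax, γ p ^ 2 * p) *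
        Real.exp (n * t * mixture pmax γ (k / n)) * Set.indicator {r : ℝ | (k / n : ℝ) ≤ |r|} 1 R := by
  have hn0 : (0 : ℝ) < n := by exact_mod_cast hn
  have hnt : 0 ≤ (n : ℝ) * t := by positivity
  have hsum (k : ℕ) : 0 ≤ Real.exp (t * ∑ p ∈ Finset.Icc 2 pmax, γ p ^ 2 * p) *
        Real.exp (n * t * mixture pmax γ (k / n)) *
        Set.indicator {r : ℝ | (k / n : ℝ) ≤ |r|} (1 : ℝ → ℝ) R :=
    mul_nonneg (by positivity) (Set.indicator_nonneg (fun _ _ => zero_le_one) _)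
  have h₁ := mul_le_mul_of_nonneg_left (mixture_le_mixture_abs pmax γ R) hnt
  rcases le_or_gt |R| (k₀ / n : ℝ) with h | h
  · refine le_add_of_le_of_nonneg (Real.exp_le_exp.2 (h₁.trans ?_))
      (Finset.sum_nonneg fun k _ => hsum k)
    refine mul_le_mul_of_nonneg_left ((mixture_le_cube pmax γ h2 (abs_nonneg R) hR).trans ?_) hnt
    exact mul_le_mul_of_nonneg_left (pow_le_pow_left₀ (abs_nonneg _) h 3)
      (mixture_nonneg _ _ zero_le_one)
  · rw [div_lt_iff₀ hn0] at h
    have hRn : |R| * n ≤ n := mul_le_of_le_one_left hn0.le hR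
    obtain ⟨k, hk, hk₁, hk₂⟩ : ∃ k ∈ Finset.Ico k₀ n, (k : ℝ) ≤ |R| * n ∧ |R| * n ≤ k + 1 := by
      have hk₀ : k₀ < n := by exact_mod_cast h.trans_le hRn
      rcases lt_or_ge ⌊|R| * n⌋₊ n with hf | hf
      · exact ⟨_, Finset.mem_Ico.2 ⟨Nat.le_floor h.le, hf⟩, Nat.floor_le (by positivity),
          (Nat.lt_floor_add_one _).le⟩
      -- This happens only for |R| = 1, which is put into the last slice `k = n - 1`. So the entropy
      -- is never needed at 1, where it may be `-∞`.
      · have h' := (Nat.le_floor_iff (by positivity)).1 hf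
        refine ⟨n - 1, Finset.mem_Ico.2 ⟨by omega, by omega⟩, ?_, ?_⟩ <;>
        · rw [Nat.cast_sub hn]; simp; linarith
    refine le_add_of_nonneg_of_le (Real.exp_pos _).le (le_trans ?_
      (Finset.single_le_sum (f := fun k : ℕ => Real.exp (t * ∑ p ∈ Finset.Icc 2 pmax, γ p ^ 2 * p) *
        Real.exp (n * t * mixture pmax γ (k / n)) *
        Set.indicator {r : ℝ | (k / n : ℝ) ≤ |r|} 1 R) (fun k _ => hsum k) hk))
    have hkR : (k / n : ℝ) ≤ |R| := by rwa [div_le_iff₀ hn0]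
    have hmem : R ∈ {r : ℝ | (k / n : ℝ) ≤ |r|} := hkR
    simp only [Set.indicator_of_mem hmem, Pi.one_apply, mul_one]
    rw [← Real.exp_add]
    refine Real.exp_le_exp.2 (h₁.trans ?_)
    have h₂ := mixture_le_add pmax γ (by positivity) hkR hR
    set L := ∑ p ∈ Finset.Icc 2 pmax, γ p ^ 2 * p
    have hL : 0 ≤ L := Finset.sum_nonneg fun p _ => by positivity
    have h₃ : n * (|R| - k / n) ≤ 1 := by rw [mul_sub, mul_div_cancel₀ _ hn0.ne']; linarith
    calc _ ≤ n * t * (mixture pmax γ (k / n) + L * (|R| - k / n)) :=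
          mul_le_mul_of_nonneg_left h₂ hnt
      _ = t * L * (n * (|R| - k / n)) + n * t * mixture pmax γ (k / n) := by ring
      _ ≤ t * L * 1 + n * t * mixture pmax γ (k / n) := by gcongr
      _ = _ := by ring

end mixture

/-! ### The second moment below the threshold -/

/-- The overlap of two configurations. -/
noncomputable def overlap {n : ℕ} (p : (Fin n → ℝ) × (Fin n → ℝ)) : ℝ := (∑ i, p.1 i * p.2 i) / n

theorem continuous_overlap {n : ℕ} : Continuous (overlap (n := n)) := by
  unfold overlap; fun_prop

theorem abs_overlap_le {n : ℕ} (hn : 1 ≤ n) {p : (Fin n → ℝ) × (Fin n → ℝ)}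
    (h₁ : ∑ i, p.1 i ^ 2 = (n : ℝ)) (h₂ : ∑ i, p.2 i ^ 2 = (n : ℝ)) : |overlap p| ≤ 1 := by
  have hn0 : (0 : ℝ) < n := by exact_mod_cast hn
  have h := Finset.sum_mul_sq_le_sq_mul_sq Finset.univ p.1 p.2
  rw [h₁, h₂] at h
  rw [overlap, abs_div, Nat.abs_cast, div_le_one hn0]
  exact abs_le_of_sq_le_sq (by nlinarith) hn0.le

theorem measure_abs_overlap_le (b : Background) {n : ℕ} (hn : 2 ≤ n) {x : ℝ} (hx0 : 0 ≤ x)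
    (hx1 : x < 1) :
    ((b.measure n).prod (b.measure n)).real {p | x ≤ |overlap p|} ≤
        2 * n * Real.exp ((n - 1) * realEntropy b x) := by
  have := isProbabilityMeasure_background b (by omega : 1 ≤ n)
  have hm : MeasurableSet {p : (Fin n → ℝ) × (Fin n → ℝ) | x ≤ |overlap p|} :=
    measurableSet_le measurable_const continuous_overlap.abs.measurable
  refine ENNReal.toReal_le_of_le_ofReal (by positivity) ?_
  rw [Measure.prod_apply hm]
  refine (lintegral_mono_ae (g := fun _ => ENNReal.ofReal
    (2 * n * Real.exp ((n - 1) * realEntropy b x))) ?_).trans (by simp)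
  filter_upwards [measure_overlap_le b hn] with σ hσ
  exact ENNReal.le_ofReal_iff_toReal_le (measure_ne_top _ _) (by positivity) |>.2 (hσ x hx0 hx1)

/-- Energy against entropy on each slice: the energy costs at most -θ n h with θ = (r/β₀)² < 1, and
the slice has probability about exp((n-1) h). The surplus of entropy is a Gaussian factor in the
overlap, largest at k₀/n; there are at most `n` slices. -/
theorem integral_exp_overlap_sub_one_le (b : Background) {pmax : ℕ} {γ : ℕ → ℝ} (h2 : γ 2 = 0)
    {β₀ r : ℝ} (h : SecondMomentCondition b pmax γ β₀) (hr : 0 ≤ r) (hr₀ : r < β₀) {n : ℕ} (hn : 2 ≤ n)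
    (hn' : 2 ≤ (1 - (r / β₀) ^ 2) * n) (k₀ : ℕ) :
    ∫ p, (Real.exp (n * r ^ 2 * mixture pmax γ (overlap p)) - 1)
      ∂((b.measure n).prod (b.measure n)) ≤
      Real.exp (r ^ 2 * mixture pmax γ 1 * (k₀ ^ 3 / n ^ 2 : ℝ)) +
      2 * Real.exp (r ^ 2 * ∑ p ∈ Finset.Icc 2 pmax, γ p ^ 2 * p) *
        ((n : ℝ) ^ 2 * Real.exp (-((1 - (r / β₀) ^ 2) / 4 * (k₀ ^ 2 / n : ℝ)))) - 1 := by
  have := isProbabilityMeasure_background b (by omega : 1 ≤ n)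
  have hn0 : (2 : ℝ) ≤ n := by exact_mod_cast hn
  have hβ : 0 < β₀ := hr.trans_lt hr₀
  set μ := (b.measure n).prod (b.measure n)
  set θ := (r / β₀) ^ 2 with hθ
  have hθβ : θ * β₀ ^ 2 = r ^ 2 := by rw [hθ]; field_simp
  have hθ0 : 0 ≤ θ := sq_nonneg _
  set L := ∑ p ∈ Finset.Icc 2 pmax, γ p ^ 2 * p
  set g : (Fin n → ℝ) × (Fin n → ℝ) → ℝ := fun p =>
    Real.exp (n * r ^ 2 * (mixture pmax γ 1 * (k₀ / n : ℝ) ^ 3)) +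
      ∑ k ∈ Finset.Ico k₀ n, Real.exp (r ^ 2 * L) *
        Real.exp (n * r ^ 2 * mixture pmax γ (k / n)) *
          Set.indicator {r : ℝ | (k / n : ℝ) ≤ |r|} 1 (overlap p) with hg
  have hm (x : ℝ) : MeasurableSet {p : (Fin n → ℝ) × (Fin n → ℝ) | x ≤ |overlap p|} :=
    measurableSet_le measurable_const continuous_overlap.abs.measurable
  have hind (x : ℝ) : (fun p : (Fin n → ℝ) × (Fin n → ℝ) =>
      Set.indicator {r : ℝ | x ≤ |r|} (1 : ℝ → ℝ) (overlap p)) =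
      Set.indicator {p | x ≤ |overlap p|} 1 := by
    ext p; simp [Set.indicator_apply]
  have hindint (x : ℝ) : Integrable (fun p : (Fin n → ℝ) × (Fin n → ℝ) =>
      Set.indicator {r : ℝ | x ≤ |r|} (1 : ℝ → ℝ) (overlap p)) μ := by
    rw [hind]; exact (integrable_const 1).indicator (hm x)
  have hgint : Integrable g μ := (integrable_const _).add
    (integrable_finsetSum _ fun k _ => (hindint _).const_mul _)
  have hle : ∀ᵐ p ∂μ, Real.exp (n * r ^ 2 * mixture pmax γ (overlap p)) ≤ g p := by
    filter_upwards [Measure.quasiMeasurePreserving_fst.ae (ae_background b n),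
      Measure.quasiMeasurePreserving_snd.ae (ae_background b n)] with p h₁ h₂
    exact exp_mixture_le pmax γ h2 (sq_nonneg r) (by omega) (abs_overlap_le (by omega) h₁ h₂)
  have hfint : Integrable (fun p => Real.exp (n * r ^ 2 * mixture pmax γ (overlap p))) μ := by
    refine hgint.mono' (Continuous.aestronglyMeasurable ?_) ?_
    · have := continuous_overlap (n := n)
      unfold mixture; fun_prop
    · filter_upwards [hle] with p hp
      rwa [Real.norm_eq_abs, Real.abs_exp]
  rw [integral_sub hfint (integrable_const _), integral_const, probReal_univ, one_smul]
  refine sub_le_sub_right ((integral_mono_ae hfint hgint hle).trans ?_) 1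
  rw [hg, integral_add (integrable_const _)
    (integrable_finsetSum _ fun k _ => (hindint _).const_mul _), integral_const, probReal_univ,
    one_smul, integral_finsetSum _ fun k _ => (hindint _).const_mul _]
  refine add_le_add (le_of_eq ?_) ?_
  · congr 1; field_simp
  have hterm : ∀ k ∈ Finset.Ico k₀ n,
      ∫ p, Real.exp (r ^ 2 * L) * Real.exp (n * r ^ 2 * mixture pmax γ (k / n)) *
          Set.indicator {r : ℝ | (k / n : ℝ) ≤ |r|} 1 (overlap p) ∂μ ≤
        2 * Real.exp (r ^ 2 * L) * (n * Real.exp (-((1 - θ) / 4 * (k₀ ^ 2 / n : ℝ)))) := by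
    intro k hk
    obtain ⟨hk₀, hkn⟩ := Finset.mem_Ico.1 hk
    have hk₀' : (k₀ : ℝ) ≤ k := by exact_mod_cast hk₀
    have hx0 : (0 : ℝ) ≤ k / n := by positivity
    have hx1 : (k / n : ℝ) < 1 := by
      rw [div_lt_one (by linarith)]; exact_mod_cast hkn
    rw [integral_const_mul, hind, integral_indicator_one (hm _)]
    have h₁ := measure_abs_overlap_le b hn hx0 hx1
    have h₂ := h.mixture_le hx0 hx1
    have h₃ := realEntropy_le b (x := k / n) (by rwa [abs_of_nonneg hx0])
    have hexp : n * r ^ 2 * mixture pmax γ (k / n) + (n - 1) * realEntropy b (k / n) ≤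
        -((1 - θ) / 4 * (k₀ ^ 2 / n : ℝ)) := by
      have e₁ : n * r ^ 2 * mixture pmax γ (k / n) ≤ n * θ * -realEntropy b (k / n) := by
        rw [← hθβ]
        nlinarith [mul_le_mul_of_nonneg_left h₂ (show 0 ≤ n * θ by positivity)]
      -- By `hn'`, (1-θ) n - 1 is at least half of (1-θ) n, so having n - 1 instead of n in the
      -- large deviation bound loses at most a factor 2 in the exponent.
      have e₂ : ((1 - θ) * n / 2) * ((k / n : ℝ) ^ 2 / 2) ≤
          ((1 - θ) * n - 1) * -realEntropy b (k / n) :=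
        mul_le_mul (by linarith) (by linarith) (by positivity) (by linarith)
      have e₃ : (1 - θ) / 4 * (k₀ ^ 2 / n : ℝ) ≤ ((1 - θ) * n / 2) * ((k / n : ℝ) ^ 2 / 2) := by
        have : ((1 - θ) * n / 2) * ((k / n : ℝ) ^ 2 / 2) = (1 - θ) / 4 * (k ^ 2 / n : ℝ) := by
          field_simp; ring
        rw [this]
        have : 0 ≤ 1 - θ := by nlinarith
        gcongr
      nlinarith
    calc _ ≤ Real.exp (r ^ 2 * L) * Real.exp (n * r ^ 2 * mixture pmax γ (k / n)) *
          (2 * n * Real.exp ((n - 1) * realEntropy b (k / n))) := by gcongr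
      _ = 2 * Real.exp (r ^ 2 * L) * (n * Real.exp (n * r ^ 2 * mixture pmax γ (k / n) +
          (n - 1) * realEntropy b (k / n))) := by rw [Real.exp_add]; ring
      _ ≤ _ := by gcongr
  refine (Finset.sum_le_sum hterm).trans ?_
  rw [Finset.sum_const, Nat.card_Ico, nsmul_eq_mul]
  have : ((n - k₀ : ℕ) : ℝ) ≤ n := by exact_mod_cast Nat.sub_le n k₀
  calc _ ≤ n * (2 * Real.exp (r ^ 2 * L) * (n * Real.exp (-((1 - θ) / 4 * (k₀ ^ 2 / n : ℝ))))) := by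
        gcongr
    _ = _ := by ring

open Filter

theorem tendsto_exp_rpow_add_sq_mul_exp (a L : ℝ) {c : ℝ} (hc : 0 < c) :
    Tendsto (fun n : ℕ => Real.exp (a * (8 * (n : ℝ) ^ (-(1 / 5) : ℝ))) +
      L * ((n : ℝ) ^ 2 * Real.exp (-(c * (n : ℝ) ^ (1 / 5 : ℝ)))) - 1) atTop (𝓝 0) := by
  have h₁ : Tendsto (fun n : ℕ => (n : ℝ) ^ (-(1 / 5) : ℝ)) atTop (𝓝 0) :=
    (tendsto_rpow_neg_atTop (by norm_num)).comp tendsto_natCast_atTop_atTop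
  have h₂ : Tendsto (fun n : ℕ => (n : ℝ) ^ (1 / 5 : ℝ)) atTop atTop :=
    (tendsto_rpow_atTop (by norm_num)).comp tendsto_natCast_atTop_atTop
  have h₃ := (tendsto_rpow_mul_exp_neg_mul_atTop_nhds_zero 10 c hc).comp h₂
  have h₄ : Tendsto (fun n : ℕ => (n : ℝ) ^ 2 * Real.exp (-(c * (n : ℝ) ^ (1 / 5 : ℝ)))) atTop
      (𝓝 0) := by
    refine h₃.congr fun n => ?_
    simp only [Function.comp_apply, neg_mul]
    rw [← Real.rpow_mul (by positivity), ← Real.rpow_natCast]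
    norm_num
  have h₅ := ((h₁.const_mul 8).const_mul a).rexp
  have := (h₅.add (h₄.const_mul L)).sub_const 1
  simpa using this

/-- With k ≈ n^(3/5), k³/n² tends to 0 and k²/n to infinity; any exponent strictly between 1/2 and
2/3 has this property. Rounding up at most doubles the power, whence 8 = 2³. -/
theorem exists_scale (n : ℕ) (hn : 1 ≤ n) : ∃ k : ℕ,
    (k ^ 3 / n ^ 2 : ℝ) ≤ 8 * (n : ℝ) ^ (-(1 / 5) : ℝ) ∧ (n : ℝ) ^ (1 / 5 : ℝ) ≤ k ^ 2 / n := by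
  have hn1 : (1 : ℝ) ≤ n := by exact_mod_cast hn
  have hn0 : (0 : ℝ) < n := by linarith
  have hs : 1 ≤ (n : ℝ) ^ (3 / 5 : ℝ) := Real.one_le_rpow hn1 (by norm_num)
  have hk := Nat.ceil_lt_add_one (show 0 ≤ (n : ℝ) ^ (3 / 5 : ℝ) by positivity)
  refine ⟨⌈(n : ℝ) ^ (3 / 5 : ℝ)⌉₊, ?_, ?_⟩
  · rw [div_le_iff₀ (by positivity)]
    calc (⌈(n : ℝ) ^ (3 / 5 : ℝ)⌉₊ : ℝ) ^ 3 ≤ (2 * (n : ℝ) ^ (3 / 5 : ℝ)) ^ 3 := by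
          gcongr; linarith
      _ = 8 * (n : ℝ) ^ (-(1 / 5) : ℝ) * n ^ 2 := by
          rw [mul_pow, ← Real.rpow_natCast, ← Real.rpow_natCast, ← Real.rpow_natCast,
            ← Real.rpow_mul hn0.le, mul_assoc, ← Real.rpow_add hn0]
          norm_num
  · rw [le_div_iff₀ hn0]
    calc (n : ℝ) ^ (1 / 5 : ℝ) * n = ((n : ℝ) ^ (3 / 5 : ℝ)) ^ 2 := by
          nth_rw 2 [← Real.rpow_one (n : ℝ)]
          rw [← Real.rpow_natCast, ← Real.rpow_mul hn0.le, ← Real.rpow_add hn0]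
          norm_num
      _ ≤ _ := by gcongr; exact Nat.le_ceil _

/-- On circles inside the disk of radius `β₀` the normalised partition function tends to `1` in
mean square. -/
theorem exists_tendsto_secondMoment (b : Background) {pmax : ℕ} {γ : ℕ → ℝ} (h2 : γ 2 = 0)
    {β₀ r : ℝ} (h : SecondMomentCondition b pmax γ β₀) (hr : 0 ≤ r) (hr₀ : r < β₀) :
    ∃ u : ℕ → ℝ, Tendsto u atTop (𝓝 0) ∧ ∀ᶠ n in atTop, ∀ β : ℂ, ‖β‖ = r →
      ∫ G, ‖normPartition b γ G β - 1‖ ^ 2 ∂(couplingLaw pmax n) ≤ u n := by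
  have hβ : 0 < β₀ := hr.trans_lt hr₀
  have hθ : 0 < 1 - (r / β₀) ^ 2 := by
    have : r / β₀ < 1 := (div_lt_one hβ).2 hr₀
    nlinarith [show 0 ≤ r / β₀ by positivity]
  refine ⟨_, tendsto_exp_rpow_add_sq_mul_exp (r ^ 2 * mixture pmax γ 1)
    (2 * Real.exp (r ^ 2 * ∑ p ∈ Finset.Icc 2 pmax, γ p ^ 2 * p))
    (show 0 < (1 - (r / β₀) ^ 2) / 4 by linarith), ?_⟩
  filter_upwards [eventually_ge_atTop 2, (tendsto_natCast_atTop_atTop (R := ℝ)).const_mul_atTop hθ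
    |>.eventually_ge_atTop 2] with n hn hn' β hβr
  obtain ⟨k, hk₁, hk₂⟩ := exists_scale n (by omega)
  rw [(integral_norm_sq_normPartition_sub_one γ b (by omega) β).2, hβr]
  refine (integral_exp_overlap_sub_one_le b h2 h hr hr₀ hn hn' k).trans ?_
  have := mixture_nonneg pmax γ zero_le_one
  gcongr

/-! ### Truncation of Taylor series -/

/-- Cauchy's estimates on the circle of radius `r` bound the tail by a geometric series of ratio
`q`. -/
theorem norm_sub_taylorPoly_le {f : ℂ → ℂ} {r M q : ℝ} (hr : 0 < r)
    (hf : DiffContOnCl ℂ f (Metric.ball 0 r)) (hM : ∀ z ∈ Metric.sphere (0 : ℂ) r, ‖f z‖ ≤ M)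
    (hq : q < 1) {z : ℂ} (hz : ‖z‖ ≤ q * r) (m : ℕ) :
    ‖f z - ∑ k ∈ Finset.range m, iteratedDeriv k f 0 / (k.factorial : ℂ) * z ^ k‖ ≤
      M * q ^ m / (1 - q) := by
  have hq0 : 0 ≤ q := nonneg_of_mul_nonneg_left ((norm_nonneg z).trans hz) hr
  have hM0 : 0 ≤ M := by
    have : (r : ℂ) ∈ Metric.sphere (0 : ℂ) r := by simp [abs_of_pos hr]
    exact (norm_nonneg _).trans (hM _ this)
  have hzr : z ∈ Metric.ball (0 : ℂ) r := by
    rw [mem_ball_zero_iff]; nlinarith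
  have hs := Complex.hasSum_taylorSeries_on_ball hf.differentiableOn hzr
  have hs' : HasSum (fun k : ℕ => iteratedDeriv k f 0 / (k.factorial : ℂ) * z ^ k) (f z) := by
    refine (congrArg (HasSum · (f z)) (funext fun k => ?_)).mp hs
    simp only [smul_eq_mul, sub_zero]; ring
  rw [← ((hasSum_nat_add_iff' m).2 hs').tsum_eq]
  have hg : HasSum (fun k : ℕ => M * q ^ m * q ^ k) (M * q ^ m / (1 - q)) :=
    (hasSum_geometric_of_lt_one hq0 hq).mul_left _
  refine tsum_of_norm_bounded hg fun k => ?_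
  have hc := Complex.norm_iteratedDeriv_le_of_forall_mem_sphere_norm_le (k + m) hr hf hM
  have hfac : (0 : ℝ) < (k + m).factorial := by exact_mod_cast (k + m).factorial_pos
  rw [norm_mul, norm_div, Complex.norm_natCast, norm_pow, mul_assoc, ← pow_add, add_comm m]
  calc _ ≤ ((k + m).factorial * M / r ^ (k + m)) / (k + m).factorial * (q * r) ^ (k + m) := by gcongr
    _ = _ := by rw [mul_pow]; field_simp

/-- Truncation commutes with adding a quadratic monomial once the degree reaches 2; this transfers
the approximation from log W to log Z. -/
theorem sum_taylorCoeff_add_sq {f g : ℂ → ℂ} (hf : AnalyticAt ℂ f 0) (a : ℂ)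
    (hg : g =ᶠ[𝓝 0] fun z => f z + a * z ^ 2) {m : ℕ} (hm : 2 < m) (z : ℂ) :
    ∑ k ∈ Finset.range m, iteratedDeriv k g 0 / (k.factorial : ℂ) * z ^ k =
      ∑ k ∈ Finset.range m, iteratedDeriv k f 0 / (k.factorial : ℂ) * z ^ k + a * z ^ 2 := by
  have h (k : ℕ) : iteratedDeriv k g 0 / (k.factorial : ℂ) * z ^ k =
      iteratedDeriv k f 0 / (k.factorial : ℂ) * z ^ k + if k = 2 then a * z ^ 2 else 0 := by
    rw [hg.iteratedDeriv_eq, show (fun z => f z + a * z ^ 2) = f + fun z => a * z ^ 2 from rfl,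
      iteratedDeriv_add hf.contDiffAt (by fun_prop), iteratedDeriv_const_mul_field,
      iteratedDeriv_fun_pow_zero]
    split_ifs with h₁
    · subst h₁; simp; ring
    · simp
  rw [Finset.sum_congr rfl fun k _ => h k, Finset.sum_add_distrib, Finset.sum_ite_eq' ,
    if_pos (Finset.mem_range.2 hm)]

/-! ### Approximation on a disk where the normalised partition function is close to `1` -/

section
variable (b : Background) {pmax n : ℕ} (γ : ℕ → ℝ)

theorem differentiable_normPartition (hn : 1 ≤ n) (G : Couplings pmax n) :
    Differentiable ℂ (normPartition b γ G) := by
  have h : Differentiable ℂ (partitionFunction b γ G) :=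
    fun z => (analyticAt_partitionFunction b hn γ G z).differentiableAt
  unfold normPartition
  fun_prop

theorem normPartition_zero (hn : 1 ≤ n) (G : Couplings pmax n) : normPartition b γ G 0 = 1 := by
  simp [normPartition, partitionFunction_zero b hn]

theorem partitionFunction_eq_normPartition_mul (G : Couplings pmax n) (z : ℂ) :
    partitionFunction b γ G z =
      normPartition b γ G z * Complex.exp ((n * mixture pmax γ 1 / 2 : ℝ) * z ^ 2) := by
  rw [normPartition, mul_assoc, ← Complex.exp_add, mul_comm (z ^ 2), neg_add_cancel,
    Complex.exp_zero, mul_one]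

/-- The principal logarithm is additive as long as the imaginary part of the sum stays in (-π, π),
which holds near 0 by continuity. The germ is enough, since only Taylor coefficients at 0 are
compared. -/
theorem log_partitionFunction_eventuallyEq (hn : 1 ≤ n) (G : Couplings pmax n) :
    (fun z => Complex.log (partitionFunction b γ G z)) =ᶠ[𝓝 0]
      fun z => Complex.log (normPartition b γ G z) + (n * mixture pmax γ 1 / 2 : ℝ) * z ^ 2 := by
  have hd := (differentiable_normPartition b γ hn G).continuous.continuousAt (x := 0)
  have h0 := normPartition_zero b γ hn G
  have hslit : ∀ᶠ z in 𝓝 (0 : ℂ), normPartition b γ G z ∈ Complex.slitPlane :=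
    hd.eventually_mem (Complex.isOpen_slitPlane.mem_nhds (by simp [h0]))
  have hc : ContinuousAt (fun z => (Complex.log (normPartition b γ G z) +
      (n * mixture pmax γ 1 / 2 : ℝ) * z ^ 2).im) 0 :=
    Complex.continuous_im.continuousAt.comp ((hd.clog (by simp [h0])).add (by fun_prop))
  have him := hc.eventually_mem (Ioo_mem_nhds (a := -Real.pi) (b := Real.pi)
    (by simp [h0, Real.pi_pos]) (by simp [h0, Real.pi_pos]))
  filter_upwards [hslit, him] with z hz hz'
  rw [← Complex.log_exp hz'.1 hz'.2.le, Complex.exp_add,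
    Complex.exp_log (Complex.slitPlane_ne_zero hz), partitionFunction_eq_normPartition_mul]

/-- The witness is log W minus its Taylor polynomial. On the disk W stays within 1/2 of 1, so log W
is holomorphic with modulus at most 3M/2. No branch of log Z is needed away from 0. -/
theorem multApprox_of_norm_normPartition_sub_one_le (hn : 1 ≤ n) (G : Couplings pmax n)
    {r M q η : ℝ} (hr : 0 < r) (hM : M ≤ 1 / 2) (hq : q < 1)
    (hW : ∀ z : ℂ, ‖z‖ ≤ r → ‖normPartition b γ G z - 1‖ ≤ M) {m : ℕ} (hm : 2 ≤ m)
    (hη : 3 / 2 * M * q ^ (m + 1) / (1 - q) ≤ η) {β : ℂ} (hβ : ‖β‖ ≤ q * r) :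
    MultApprox η (Complex.exp (logTaylorPoly b γ G m β)) (partitionFunction b γ G β) := by
  set L : ℂ → ℂ := fun z => Complex.log (normPartition b γ G z) with hL
  have hmem (z : ℂ) (hz : ‖z‖ ≤ r) : normPartition b γ G z ∈ Complex.slitPlane := by
    have := Complex.mem_slitPlane_of_norm_lt_one (z := normPartition b γ G z - 1)
      (by linarith [hW z hz])
    rwa [add_sub_cancel] at this
  have hd := differentiable_normPartition b γ hn G
  have hLd (z : ℂ) (hz : ‖z‖ ≤ r) : DifferentiableAt ℂ L z := (hd z).clog (hmem z hz)
  have hLball : DiffContOnCl ℂ L (Metric.ball 0 r) := by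
    refine DifferentiableOn.diffContOnCl fun z hz => (hLd z ?_).differentiableWithinAt
    exact mem_closedBall_zero_iff.1 (Metric.closure_ball_subset_closedBall hz)
  have hLM (z : ℂ) (hz : z ∈ Metric.sphere (0 : ℂ) r) : ‖L z‖ ≤ 3 / 2 * M := by
    have h := hW z (mem_sphere_zero_iff_norm.1 hz).le
    have h' := Complex.norm_log_one_add_half_le_self (h.trans hM)
    rw [add_sub_cancel] at h'
    exact h'.trans (by linarith)
  have hLa : AnalyticAt ℂ L 0 := (hd.analyticAt 0).clog (hmem 0 (by simpa using hr.le))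
  have htail := norm_sub_taylorPoly_le hr hLball hLM hq hβ (m + 1)
  have hsum := sum_taylorCoeff_add_sq hLa _ (log_partitionFunction_eventuallyEq b γ hn G)
    (show 2 < m + 1 by omega) β
  refine ⟨_, htail.trans hη, ?_⟩
  have hβr : ‖β‖ ≤ r := by nlinarith
  rw [← Complex.exp_add, partitionFunction_eq_normPartition_mul,
    ← Complex.exp_log (Complex.slitPlane_ne_zero (hmem β hβr)), ← Complex.exp_add]
  congr 1
  simp only [logTaylorPoly, logTaylorCoeff]
  rw [hsum]
  ring

end

/-! ### From the mean square on a circle to the supremum on a smaller disk -/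

/-- Cauchy's formula for the holomorphic function f² bounds |f(w)|² directly by a mean square, the
kernel being controlled by |z - w| ≥ R - r. -/
theorem norm_sq_le_integral_circle {f : ℂ → ℂ} (hf : Differentiable ℂ f) {r R : ℝ} (hr : 0 ≤ r)
    (hrR : r < R) {w : ℂ} (hw : ‖w‖ ≤ r) :
    ‖f w‖ ^ 2 ≤ (2 * Real.pi)⁻¹ * (R / (R - r)) *
      ∫ θ in (0 : ℝ)..2 * Real.pi, ‖f (circleMap 0 R θ)‖ ^ 2 := by
  have hR : 0 < R := hr.trans_lt hrR
  have hRr : 0 < R - r := sub_pos.2 hrR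
  have h := DiffContOnCl.two_pi_i_inv_smul_circleIntegral_sub_inv_smul
    (f := fun z => f z ^ 2) (c := 0) (R := R) (w := w) (by
      exact (hf.pow 2).diffContOnCl) (by rw [mem_ball_zero_iff]; linarith)
  rw [← norm_pow, ← h, norm_smul, mul_assoc (2 * Real.pi)⁻¹]
  refine mul_le_mul (le_of_eq ?_) ?_ (norm_nonneg _) (by positivity)
  · simp [abs_of_pos Real.pi_pos]
  rw [circleIntegral, ← intervalIntegral.integral_const_mul]
  have hcont : Continuous fun θ => f (circleMap 0 R θ) := hf.continuous.comp (continuous_circleMap 0 R)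
  refine intervalIntegral.norm_integral_le_of_norm_le (by positivity) (Eventually.of_forall
    fun θ _ => ?_) (((hcont.norm.pow 2).const_mul _).intervalIntegrable _ _)
  have hz : ‖circleMap 0 R θ‖ = R := by simp [abs_of_pos hR]
  have hzw : R - r ≤ ‖circleMap 0 R θ - w‖ := by
    have := norm_sub_norm_le (circleMap 0 R θ) w
    rw [hz] at this; linarith
  rw [deriv_circleMap, norm_smul, norm_mul, hz, Complex.norm_I, mul_one, norm_smul, norm_inv,
    norm_pow, div_eq_mul_inv, mul_assoc]
  gcongr

section
variable (b : Background) {pmax n : ℕ} (γ : ℕ → ℝ)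

theorem stronglyMeasurable_normPartition_circle (hn : 1 ≤ n) (R : ℝ) :
    StronglyMeasurable fun p : Couplings pmax n × ℝ => normPartition b γ p.1 (circleMap 0 R p.2) := by
  have := isProbabilityMeasure_background b hn
  simp only [← integral_normWeight]
  refine StronglyMeasurable.integral_prod_right' (f := fun q : (Couplings pmax n × ℝ) × (Fin n → ℝ) =>
    normWeight γ (circleMap 0 R q.1.2) q.1.1 q.2) (Continuous.stronglyMeasurable ?_)
  have h₁ : Continuous fun q : (Couplings pmax n × ℝ) × (Fin n → ℝ) =>
      hamiltonian γ q.1.1 q.2 :=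
    (continuous_hamiltonian_uncurry γ).comp (by fun_prop : Continuous
      fun q : (Couplings pmax n × ℝ) × (Fin n → ℝ) => (q.1.1, q.2))
  have h₂ := continuous_circleMap 0 R
  unfold normWeight
  fun_prop

/-- A mean square bound on a circle gives, with high probability, a uniform bound on a smaller
disk. -/
theorem measure_exists_lt_norm_normPartition_sub_one_le (hn : 1 ≤ n) {r R : ℝ} (hr : 0 ≤ r)
    (hrR : r < R) {u : ℝ} (hu : ∀ β : ℂ, ‖β‖ = R →
      ∫ G, ‖normPartition b γ G β - 1‖ ^ 2 ∂(couplingLaw pmax n) ≤ u) {a : ℝ} (ha : 0 < a) :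
    couplingLaw pmax n {G | ∃ z : ℂ, ‖z‖ ≤ r ∧ a < ‖normPartition b γ G z - 1‖} ≤
      ENNReal.ofReal (R / (R - r) * u / a ^ 2) := by
  have hR : 0 < R := hr.trans_lt hrR
  have hRr : 0 < R - r := sub_pos.2 hrR
  have hπ := Real.pi_pos
  have hmeas := stronglyMeasurable_normPartition_circle (pmax := pmax) b γ hn R
  set F : Couplings pmax n → ℝ → ℝ≥0∞ := fun G θ =>
    ENNReal.ofReal (‖normPartition b γ G (circleMap 0 R θ) - 1‖ ^ 2) with hF
  have hFm : Measurable (Function.uncurry F) :=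
    ((hmeas.sub stronglyMeasurable_const).norm.measurable.pow_const 2).ennreal_ofReal
  set ν : Measure ℝ := volume.restrict (Set.Ioc 0 (2 * Real.pi)) with hν
  set c : ℝ := 2 * Real.pi * ((R - r) / R) * a ^ 2 with hc
  have hc0 : 0 < c := by positivity
  -- A large value anywhere in the disk forces a large mean square on the circle. Markov's
  -- inequality is applied to this larger set, so the supremum over the disk need not be measurable.
  have hsub : {G : Couplings pmax n | ∃ z : ℂ, ‖z‖ ≤ r ∧ a < ‖normPartition b γ G z - 1‖} ⊆
      {G | ENNReal.ofReal c ≤ ∫⁻ θ, F G θ ∂ν} := by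
    rintro G ⟨z, hz, haz⟩
    have hd := (differentiable_normPartition b γ hn G).sub_const 1
    have h := norm_sq_le_integral_circle hd hr hrR hz
    have hcont : Continuous fun θ => ‖normPartition b γ G (circleMap 0 R θ) - 1‖ ^ 2 :=
      (hd.continuous.comp (continuous_circleMap 0 R)).norm.pow 2
    rw [Set.mem_ofPred_eq, hF, ← ofReal_integral_eq_lintegral_ofReal
      ((hcont.integrableOn_Icc).mono_set Set.Ioc_subset_Icc_self)
      (Eventually.of_forall fun θ => by positivity),
      ← intervalIntegral.integral_of_le (by positivity)]
    refine ENNReal.ofReal_le_ofReal ?_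
    have h₁ : a ^ 2 ≤ ‖normPartition b γ G z - 1‖ ^ 2 := pow_le_pow_left₀ ha.le haz.le 2
    have h₂ := mul_le_mul_of_nonneg_left (h₁.trans h)
      (show 0 ≤ 2 * Real.pi * ((R - r) / R) by positivity)
    refine h₂.trans (le_of_eq ?_)
    field_simp
  have hint : ∫⁻ G, ∫⁻ θ, F G θ ∂ν ∂(couplingLaw pmax n) ≤ ENNReal.ofReal (2 * Real.pi * u) := by
    rw [lintegral_lintegral_swap hFm.aemeasurable]
    have hθ (θ : ℝ) : ∫⁻ G, F G θ ∂(couplingLaw pmax n) ≤ ENNReal.ofReal u := by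
      rw [hF, ← ofReal_integral_eq_lintegral_ofReal
        (integral_norm_sq_normPartition_sub_one γ b hn _).1
        (Eventually.of_forall fun G => by positivity)]
      exact ENNReal.ofReal_le_ofReal (hu _ (by simp [abs_of_pos hR]))
    refine (lintegral_mono hθ).trans (le_of_eq ?_)
    rw [lintegral_const, hν, Measure.restrict_apply_univ, Real.volume_Ioc, sub_zero, mul_comm,
      ← ENNReal.ofReal_mul (by positivity)]
  have hmarkov := (mul_meas_ge_le_lintegral (μ := couplingLaw pmax n)
    (f := fun G => ∫⁻ θ, F G θ ∂ν) hFm.lintegral_prod_right' (ENNReal.ofReal c)).trans hint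
  refine (measure_mono hsub).trans ?_
  have h := (ENNReal.le_div_iff_mul_le (Or.inl (ENNReal.ofReal_pos.2 hc0).ne')
    (Or.inl ENNReal.ofReal_ne_top)).2 ((mul_comm _ _).trans_le hmarkov)
  rw [← ENNReal.ofReal_div_of_pos hc0] at h
  refine h.trans (le_of_eq ?_)
  congr 1
  rw [hc]; field_simp

end

/-! ### The second moment threshold -/

theorem mixture_pos {pmax : ℕ} {γ : ℕ → ℝ} {x : ℝ} (hx : 0 < x)
    (h : ∃ p ∈ Finset.Icc 2 pmax, γ p ≠ 0) : 0 < mixture pmax γ x := by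
  obtain ⟨p, hp, hγ⟩ := h
  exact Finset.sum_pos' (fun p _ => by positivity) ⟨p, hp, by positivity⟩

/-- At overlap 1/2 the mixture is positive and the entropy finite, which bounds every admissible β.
-/
theorem secondMomentThreshold_ne_top (b : Background) {pmax : ℕ} {γ : ℕ → ℝ}
    (h : ∃ p ∈ Finset.Icc 2 pmax, γ p ≠ 0) : secondMomentThreshold b pmax γ ≠ ∞ := by
  have hξ := mixture_pos (x := 1 / 2) (by norm_num) h
  refine ne_top_of_le_ne_top (b := ENNReal.ofReal (√(-realEntropy b (1 / 2) / mixture pmax γ (1 / 2))))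
    ENNReal.ofReal_ne_top (sSup_le ?_)
  rintro _ ⟨β, ⟨-, hβ⟩, rfl⟩
  refine ENNReal.ofReal_le_ofReal (Real.le_sqrt_of_sq_le ?_)
  rw [le_div_iff₀ hξ]
  exact hβ.mixture_le (by norm_num) (by norm_num)

theorem multApprox_of_forall_eq_zero (b : Background) {pmax n : ℕ} (hn : 1 ≤ n) {γ : ℕ → ℝ}
    (h : ∀ p ∈ Finset.Icc 2 pmax, γ p = 0) (G : Couplings pmax n) {η : ℝ} (hη : 0 ≤ η) (m : ℕ)
    (β : ℂ) :
    MultApprox η (Complex.exp (logTaylorPoly b γ G m β)) (partitionFunction b γ G β) := by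
  have := isProbabilityMeasure_background b hn
  have hH (σ : Fin n → ℝ) : hamiltonian γ G σ = 0 :=
    Finset.sum_eq_zero fun p _ => by rw [h p p.2]; simp
  have hZ (z : ℂ) : partitionFunction b γ G z = 1 := by simp [partitionFunction, hH]
  refine ⟨0, by simpa using hη, ?_⟩
  rw [hZ, logTaylorPoly, Finset.sum_eq_zero fun k _ => ?_]
  · simp
  · simp [logTaylorCoeff, hZ]

/-! ### The truncation degree -/

theorem two_le_truncationDegree {C η : ℝ} {n : ℕ} (hC : 4 ≤ C) (hη : 0 < η) (hη1 : η < 1)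
    (hn : 2 ≤ n) : 2 ≤ truncationDegree C η n := by
  have hn' : (2 : ℝ) ≤ n := by exact_mod_cast hn
  have h : Real.log 2 ≤ Real.log (n / η) := by
    refine Real.log_le_log (by norm_num) ?_
    rw [le_div_iff₀ hη]; nlinarith
  have h2 := Real.log_two_gt_d9
  refine Nat.lt_ceil.2 ?_
  push_cast
  nlinarith

/-- The power is at most exp(-(ε/2) C log(n/η)), and ε C ≥ 4 makes the exponent at most -2 log(n/η),
hence at most log η. -/
theorem pow_truncationDegree_le {C η ε : ℝ} {n : ℕ} (hε : 0 < ε) (hε1 : ε < 1) (hC : 4 / ε ≤ C)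
    (hη : 0 < η) (hη1 : η < 1) (hn : 1 ≤ n) : (1 - ε / 2) ^ (truncationDegree C η n + 1) ≤ η := by
  have hn' : (1 : ℝ) ≤ n := by exact_mod_cast hn
  have hlog : 0 ≤ Real.log (n / η) := Real.log_nonneg (by rw [le_div_iff₀ hη]; linarith)
  have hm : C * Real.log (n / η) ≤ truncationDegree C η n := Nat.le_ceil _
  have hεC : 4 ≤ ε * C := by rwa [div_le_iff₀' hε] at hC
  have hlη : -Real.log η ≤ Real.log (n / η) := by
    rw [Real.log_div (by positivity) hη.ne']
    linarith [Real.log_nonneg hn']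
  calc (1 - ε / 2) ^ (truncationDegree C η n + 1)
      ≤ (1 - ε / 2) ^ truncationDegree C η n :=
        pow_le_pow_of_le_one (by linarith) (by linarith) (Nat.le_succ _)
    _ ≤ Real.exp (-(ε / 2)) ^ truncationDegree C η n := by
        refine pow_le_pow_left₀ (by linarith) ?_ _
        have := Real.add_one_le_exp (-(ε / 2)); linarith
    _ = Real.exp (truncationDegree C η n * -(ε / 2)) := (Real.exp_nat_mul _ _).symm
    _ ≤ Real.exp (Real.log η) := by
        refine Real.exp_le_exp.2 ?_
        have h₁ := mul_le_mul_of_nonneg_left hm hε.le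
        have h₂ := mul_le_mul_of_nonneg_right hεC hlog
        nlinarith
    _ = η := Real.exp_log hη

/-- The accuracy of the exponentiated Taylor polynomial. -/
theorem exists_failureProbability (b : Background) (pmax : ℕ) (γ : ℕ → ℝ) (h2 : γ 2 = 0) {ε : ℝ}
    (hε : 0 < ε) (hε1 : ε < 1) :
    ∃ δ : ℕ → ℝ, (∀ n, 0 < δ n) ∧ Tendsto δ atTop (𝓝 0) ∧
      ∀ (C η : ℝ) (n : ℕ), 4 / ε ≤ C → 0 < η → η < 1 → 1 ≤ n →
        couplingLaw pmax n
          {G | ¬ ∀ β : ℂ,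
            ENNReal.ofReal ‖β‖ < ENNReal.ofReal (1 - ε) * secondMomentThreshold b pmax γ →
            MultApprox η
              (Complex.exp (logTaylorPoly b γ G (truncationDegree C η n) β))
              (partitionFunction b γ G β)} ≤ ENNReal.ofReal (δ n) := by
  have hδ₀ : Tendsto (fun n : ℕ => 1 / ((n : ℝ) + 1)) atTop (𝓝 0) :=
    tendsto_one_div_add_atTop_nhds_zero_nat
  by_cases hγ : ∃ p ∈ Finset.Icc 2 pmax, γ p ≠ 0
  swap
  · push Not at hγ
    refine ⟨_, fun n => by positivity, hδ₀, fun C η n _ hη _ hn => ?_⟩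
    refine le_of_eq_of_le ?_ zero_le
    simp [multApprox_of_forall_eq_zero b hn hγ _ hη.le]
  obtain ⟨B, hB, hBB⟩ : ∃ B : ℝ, 0 ≤ B ∧ secondMomentThreshold b pmax γ = ENNReal.ofReal B :=
    ⟨_, ENNReal.toReal_nonneg,
      (ENNReal.ofReal_toReal (secondMomentThreshold_ne_top b hγ)).symm⟩
  rcases hB.eq_or_lt with rfl | hB0
  -- With threshold 0 the open disk is empty.
  · refine ⟨_, fun n => by positivity, hδ₀, fun C η n _ _ _ _ => ?_⟩
    simp [hBB]
  -- Three nested radii: (1-ε)B for the claim, r = (1-ε/2)B for the disk on which W is near 1, and R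
  -- = (1-ε/4)B for the circle carrying the second moment. As R is below the threshold, some
  -- admissible β₀ lies beyond it.
  set r := (1 - ε / 2) * B with hr
  set R := (1 - ε / 4) * B with hR
  have hr0 : 0 < r := mul_pos (by linarith) hB0
  have hrR : r < R := by rw [hr, hR]; nlinarith
  obtain ⟨_, ⟨β₀, ⟨-, hβ₀⟩, rfl⟩, hRβ⟩ : ∃ x ∈ ENNReal.ofReal '' {β : ℝ | 0 ≤ β ∧
      SecondMomentCondition b pmax γ β}, ENNReal.ofReal R < x := by
    refine lt_sSup_iff.1 (show ENNReal.ofReal R < secondMomentThreshold b pmax γ from ?_)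
    rw [hBB, ENNReal.ofReal_lt_ofReal_iff hB0, hR]
    nlinarith
  obtain ⟨u, hu, hN⟩ := exists_tendsto_secondMoment b h2 hβ₀ (hr0.trans hrR).le
    (lt_of_not_ge fun h => absurd (ENNReal.ofReal_le_ofReal h) (not_le.2 hRβ))
  obtain ⟨N, hN⟩ := eventually_atTop.1 hN
  set K := R / (R - r) / (ε / 3) ^ 2
  have hK : 0 ≤ K := div_nonneg (div_nonneg (hr0.trans hrR).le (sub_pos.2 hrR).le) (sq_nonneg _)
  -- The probability bound is trivial for small `n`; adding 1/(n+1) only makes δ positive.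
  refine ⟨fun n => if n < N + 2 then 1 else K * |u n| + 1 / ((n : ℝ) + 1), fun n => ?_, ?_, ?_⟩
  · dsimp only
    split_ifs
    · exact one_pos
    · positivity
  · have h := (hu.abs.const_mul K).add hδ₀
    rw [abs_zero, mul_zero, add_zero] at h
    refine h.congr' ?_
    filter_upwards [eventually_ge_atTop (N + 2)] with n hn
    rw [if_neg (by omega)]
  intro C η n hC hη hη1 hn
  dsimp only
  split_ifs with hnN
  · rw [ENNReal.ofReal_one]; exact prob_le_one
  have hC4 : 4 ≤ C := le_trans (by rw [le_div_iff₀ hε]; linarith) hC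
  refine (measure_mono ?_).trans ((measure_exists_lt_norm_normPartition_sub_one_le b γ hn hr0.le hrR
    (hN n (by omega)) (show 0 < ε / 3 by positivity)).trans (ENNReal.ofReal_le_ofReal ?_))
  · intro G hG
    by_contra hGW
    simp only [Set.mem_ofPred_eq, not_exists, not_and, not_lt] at hG hGW
    refine hG fun β hβ => ?_
    rw [hBB, ← ENNReal.ofReal_mul (by linarith), ENNReal.ofReal_lt_ofReal_iff
      (mul_pos (by linarith) hB0)] at hβ
    have hp := pow_truncationDegree_le hε hε1 hC hη hη1 hn
    -- With M = ε/3 and 1 - q = ε/2 the prefactor (3/2) M/(1-q) is 1, so the error is exactly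
    -- q^(m+1). The disk fits because 1 - ε ≤ (1 - ε/2)².
    refine multApprox_of_norm_normPartition_sub_one_le b γ hn G hr0 (M := ε / 3) (q := 1 - ε / 2)
      (by linarith) (by linarith) hGW (two_le_truncationDegree hC4 hη hη1 (by omega)) ?_ ?_
    · rw [div_le_iff₀ (by linarith)]
      nlinarith
    · rw [hr]; nlinarith [sq_nonneg ε]
  · calc R / (R - r) * u n / (ε / 3) ^ 2 = K * u n := by ring
      _ ≤ K * |u n| := mul_le_mul_of_nonneg_left (le_abs_self _) hK
      _ ≤ _ := le_add_of_nonneg_right (by positivity)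

end SpinGlass

theorem theorem1p3 :
    ∃ c : ℝ, 0 < c ∧
      -- accuracy of the exponentiated Taylor polynomial, with high probability
      (∀ (b : Background) (pmax : ℕ) (γ : ℕ → ℝ), 2 ≤ pmax →
        (∀ p ∈ Finset.Icc 2 pmax, 0 ≤ γ p) → γ 2 = 0 →
        ∀ ε : ℝ, 0 < ε → ε < 1 →
        ∃ δ : ℕ → ℝ, (∀ n, 0 < δ n) ∧ Filter.Tendsto δ Filter.atTop (𝓝 0) ∧
          ∀ (C η : ℝ) (n : ℕ), c / ε ≤ C → 0 < η → η < 1 → 1 ≤ n →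
            couplingLaw pmax n
              {G | ¬ ∀ β : ℂ,
                ENNReal.ofReal ‖β‖ < ENNReal.ofReal (1 - ε) * secondMomentThreshold b pmax γ →
                MultApprox η
                  (Complex.exp (logTaylorPoly b γ G (truncationDegree C η n) β))
                  (partitionFunction b γ G β)} ≤ ENNReal.ofReal (δ n)) ∧
      -- one deterministic program that computes this polynomial and its exponential
      -- (any `C ≥ c`, in particular every `C ≥ c / ε` with `ε < 1`)
      (∀ b : Background, ∃ P : Program, ∀ pmax : ℕ, 2 ≤ pmax → ∃ K : ℝ, 1 ≤ K ∧
        ∀ (n : ℕ) (γ : ℕ → ℝ) (G : Couplings pmax n) (C η : ℝ) (β : ℂ),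
          2 ≤ n → c ≤ C → 0 < η → η < 1 →
          ∃ (s : State) (t : ℕ),
            Exec (inputTape γ G C η β) P (initialState pmax n) s t ∧
            (t : ℝ) ≤ (n : ℝ) ^ (K * C * Real.log (n / η)) ∧
            s.int 0 = truncationDegree C η n ∧
            (∀ k ≤ truncationDegree C η n, s.num (k + 1) = logTaylorCoeff b γ G k) ∧
            s.num 0 = Complex.exp (logTaylorPoly b γ G (truncationDegree C η n) β)) := by
  -- The constant 4 makes the tail decay suffice, makes the degree at least 2, and absorbs the
  -- rounding of the degree in the running time.
  refine ⟨4, by norm_num, fun b pmax γ _ _ h2 ε hε hε1 =>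
    exists_failureProbability b pmax γ h2 hε hε1, exists_taylorProgram⟩
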